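/- **Setting.** Let $\Omega\subset\mathbb R^2$ be a bounded connected open polygonal set carrying a DDFV mesh $\mathcal T=(\overline{\mathfrak M},\overline{\mathfrak M^*})$: primal cells $\mathfrak M$ (disjoint open polygons covering $\Omega$ and meeting along common edges), boundary edges $\partial\mathfrak M$ (degenerate primal cells), dual cells $\overline{\mathfrak M^*}$ around the vertices (polygons contained in $\Omega$, obtained by joining the neighbouring centers), and one diamond $\mathcal D\subset\overline\Omega$ per edge $\sigma=K|L$, with end points $x_{K^*},x_{L^*}$, dual edge $\sigma^*=[x_K,x_L]$, and $x_K,x_L$ on both sides of $\sigma$. Let $\partial\Omega=\Gamma_{Dir}\cup\Gamma_N$ with $\Gamma_{Dir},\Gamma_N$ closed, meeting only at vertices, and $|\Gamma_{Dir}|>0$. A cell $A\in\partial\mathfrak M\cup\partial\mathfrak M^*$ is Dirichlet if its center $x_A$ is in $\Gamma_{Dir}$; $\mathbb R^{\mathcal T_{Dir}}$ is the space of discrete functions on the non-Dirichlet elements of $\overline{\mathfrak M}\cup\overline{\mathfrak M^*}$, extended by $0$ to the Dirichlet ones. Write $\delta_{AB}u=u_B-u_A$. Data, for the phases $\alpha\in\{g,w\}$,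 $|g|=0$, $|w|=1$: the capillary pressure $p_c:\mathbb R\to\mathbb R$ is an increasing homeomorphism, piecewise $C^1$ with bounded derivative, $p_c(0)=0$; the mobilities $M_\alpha$ are continuous, nondecreasing, $0$ on $(-\infty,0]$, constant on $[1,\infty)$, with $M(s)=M_w(1-s)+M_g(s)\ge m_0>0$; the densities $\rho_\alpha\in C^1(\mathbb R)$ are nondecreasing with $0<\rho_0\le\rho_\alpha\le\rho_1$; the porosity satisfies $0<\phi_0\le\phi\le\phi_1$ a.e. in $\Omega$; the permeability $\Lambda$ is measurable, symmetric, bounded and uniformly elliptic. Put $s_{g,A}=p_c^{-1}(p_{g,A}-p_{w,A})$, $s_{w,A}=1-s_{g,A}$, and $M^\epsilon_\alpha=\epsilon+M_\alpha$; let $\mathcal Z$ be the truncation to $[0,1]$, and let $\phi_A$, $\Lambda_{\mathcal D}$ be mean values. With $m_A$ the area of the cell $A$, $m_\sigma,m_{\sigma^*}$ the lengths, $\alpha_{\mathcal D}$ the angle between $\sigma$ and $\sigma^*$, and $\mathbf n_{KL},\mathbf n_{K^*L^*}$ the unit normals of $\sigma$, $\sigma^*$ (pointing from $K$ to $L$,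 resp. from $K^*$ to $L^*$), let $$\tau_{KL}=\tfrac{m_\sigma}{m_{\sigma^*}}\tfrac{\langle\Lambda_{\mathcal D}\mathbf n_{KL},\mathbf n_{KL}\rangle}{\sin\alpha_{\mathcal D}},\quad \tau_{K^*L^*}=\tfrac{m_{\sigma^*}}{m_\sigma}\tfrac{\langle\Lambda_{\mathcal D}\mathbf n_{K^*L^*},\mathbf n_{K^*L^*}\rangle}{\sin\alpha_{\mathcal D}},\quad \eta_{\mathcal D}=\tfrac{\langle\Lambda_{\mathcal D}\mathbf n_{KL},\mathbf n_{K^*L^*}\rangle}{\sin\alpha_{\mathcal D}},$$ $$V^{\alpha,\epsilon}_{KL}=M^{up,\epsilon}_{\alpha,KL}\tau_{KL}\delta_{KL}p_\alpha+\sqrt{M^{min,\epsilon}_{\alpha,KL}}\sqrt{M^{up,\epsilon}_{\alpha,K^*L^*}}\,\eta_{\mathcal D}\,\delta_{K^*L^*}p_\alpha,\qquad p_{c,KL}=\tau_{KL}\delta_{KL}(p_g-p_w),$$ and symmetrically $V^{\alpha,\epsilon}_{K^*L^*}$, $p_{c,K^*L^*}$. Here $M^{up,\epsilon}_{\alpha,AB}=M_\alpha^\epsilon(s_{\alpha,B})$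 if $\delta_{AB}p_\alpha\ge0$ and $M_\alpha^\epsilon(s_{\alpha,A})$ otherwise, $M^{min,\epsilon}_{\alpha,AB}=\min(M_\alpha^\epsilon(s_{\alpha,A}),M_\alpha^\epsilon(s_{\alpha,B}))$, and $1/\rho_{\alpha,AB}$ is the mean value of $1/\rho_\alpha$ between $p_{\alpha,A}$ and $p_{\alpha,B}$ (equal to $1/\rho_\alpha(p_{\alpha,A})$ if these coincide). For $\epsilon,\eta\ge0$ and a time step $\delta t>0$, the $(\epsilon,\eta)$-regularized PP-DDFV scheme $\mathcal F^{\epsilon,\eta}(p_{\mathcal T},p^n_{\mathcal T})=0$, with $p_{\mathcal T}=(p_g,p_w)\in(\mathbb R^{\mathcal T_{Dir}})^2$, has the components $$\mathcal F^{\epsilon,\eta}_{\alpha,A}=m_A\phi_A\big(\rho_\alpha(p_{\alpha,A})\mathcal Z(s_{\alpha,A})-\rho_\alpha(p^n_{\alpha,A})s^n_{\alpha,A}\big)-\delta t\sum_{A|B}\rho_{\alpha,AB}V^{\alpha,\epsilon}_{AB}-\delta t\,\eta(-1)^{|\alpha|}\sum_{A|B}\rho_{\alpha,AB}\,p_{c,AB}$$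 for every primal cell $A\in\mathfrak M$ (sum over its primal edges) and every non-Dirichlet dual cell $A$ (sum over its dual edges), and $$\mathcal F^{\epsilon,\eta}_{\alpha,K}=-\delta t\big(\rho_{\alpha,KL}V^{\alpha,\epsilon}_{KL}+\eta(-1)^{|\alpha|}\rho_{\alpha,KL}\,p_{c,KL}\big)$$ for every Neumann boundary edge $K$ of a cell $L\in\mathfrak M$. The original PP-DDFV scheme $\mathcal F(p_{\mathcal T},p^n_{\mathcal T})=0$ is given by the same formulas with the mobilities $M_\alpha$ and without the capillary flow terms. Let $\|u\|_{\mathcal T,\tau}^2=\sum_{\mathcal D}\tau_{KL}(\delta_{KL}u)^2+\tau_{K^*L^*}(\delta_{K^*L^*}u)^2$. Let $\zeta_g=p_g-\hat p_g(s_g)$ and $\zeta_w=p_w+\hat p_w(s_g)$ be the two expressions of the global pressure, where $\hat p_g(s)=\int_0^s\frac{M_w(1-u)}{M(u)}p_c'(u)\,du$ and $\hat p_w(s)=\int_0^s\frac{M_g(u)}{M(u)}p_c'(u)\,du$. The maximum principle for $p_{\mathcal T}$ means $0\le s_{\alpha,A}\le1$ for all $\alpha\in\{g,w\}$ and all $A\in\mathcal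 T$. **Theorem.** Let $\delta t>0$ and let $p^n_{\mathcal T}\in(\mathbb R^{\mathcal T_{Dir}})^2$ satisfy the maximum principle. Then: * (P.a) $(\epsilon,\eta,p_{\mathcal T})\mapsto\mathcal F^{\epsilon,\eta}(p_{\mathcal T},p^n_{\mathcal T})$ is continuous on $[0,\infty)^2\times(\mathbb R^{\mathcal T_{Dir}})^2$. * (P.b) $\mathcal F^{0,0}=\mathcal F$. * (P.c) For every $\eta>0$, every solution of $\mathcal F^{0,\eta}(p_{\mathcal T},p^n_{\mathcal T})=0$ satisfies the maximum principle. * (P.d) For every $\eta>0$ there is $C_\eta$, independent of $\epsilon$, such that for all $\epsilon>0$ every solution of $\mathcal F^{\epsilon,\eta}(p_{\mathcal T},p^n_{\mathcal T})=0$ satisfies $$\sum_{\alpha}\|\zeta_\alpha\|_{\mathcal T,\tau}^2+\epsilon\sum_\alpha\|p_\alpha\|_{\mathcal T,\tau}^2+\eta\big(\|p_g-p_w\|_{\mathcal T,\tau}^2+\|p_w-p_g\|_{\mathcal T,\tau}^2\big)\le C_\eta.$$ * (P.e) There is $C$, independent of $\eta$, such that for all $\eta>0$ every solution of $\mathcal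 F^{0,\eta}(p_{\mathcal T},p^n_{\mathcal T})=0$ satisfies $\sum_\alpha\|\zeta_\alpha\|_{\mathcal T,\tau}^2\le C$. * For all $\epsilon,\eta>0$ the regularized scheme $\mathcal F^{\epsilon,\eta}(p_{\mathcal T},p^n_{\mathcal T})=0$ has a solution. * The original scheme $\mathcal F(p_{\mathcal T},p^n_{\mathcal T})=0$ has a solution that satisfies the maximum principle. Consequently, for all times $t^0<t^1<\dots<t^N$ and every initial state $p^0_{\mathcal T}$ satisfying the maximum principle, there are $p^1_{\mathcal T},\dots,p^N_{\mathcal T}$, satisfying the maximum principle, such that $p^{n+1}_{\mathcal T}$ solves the original PP-DDFV scheme with time step $t^{n+1}-t^n$ and previous state $p^n_{\mathcal T}$, for all $0\le n<N$. -/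

import Mathlib

open MeasureTheory Set Filter Topology

noncomputable section

/-! ### Plane geometry -/

/-- The Euclidean plane. -/
abbrev Plane : Type := EuclideanSpace ℝ (Fin 2)

/-- The determinant of two plane vectors. -/
def cross (a b : Plane) : ℝ := a 0 * b 1 - a 1 * b 0

/-- The clockwise quarter turn of a plane vector. -/
def perp (b : Plane) : Plane := !₂[b 1, -b 0]

/-- `P` is the open simple polygon whose sides are the segments with the end points listed in
`sides`: the sides form a simple closed polygonal line (a cyclic list of `n ≥ 3` distinct corners
such that the relative interior of a side meets no other side) and `P` is a bounded connected
open set having exactly this line as its frontier (so it is the inside of this line). -/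
def IsOpenPolygon (P : Set Plane) (sides : Set (Sym2 Plane)) : Prop :=
  IsOpen P ∧ IsConnected P ∧ Bornology.IsBounded P ∧
  ∃ n : ℕ, 3 ≤ n ∧ ∃ c : ZMod n → Plane, Function.Injective c ∧
    sides = Set.range (fun i => s(c i, c (i + 1))) ∧
    (∀ i j, i ≠ j →
      Disjoint (openSegment ℝ (c i) (c (i + 1))) (segment ℝ (c j) (c (j + 1)))) ∧
    frontier P = ⋃ i, segment ℝ (c i) (c (i + 1))

/-! ### DDFV meshes -/

/-- A DDFV mesh of a plane domain `Ω` whose boundary is split into a Dirichlet and a Neumann part.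
`Cell` indexes the (interior) primal cells, `IEdge` the interior primal edges, `BEdge` the boundary
edges (which are also the degenerate boundary primal cells), and `Vert` the vertices of the primal
mesh (which also index the dual cells). Diamonds correspond to the edges `IEdge ⊕ BEdge`.

The diamond of an edge is labelled `(K, L, K*, L*)`, where `K` and `L` are the primal cells on both
sides (for a boundary edge, `L` is the edge itself) and `K*`, `L*` are the end points of the edge,
in the order for which `K` is to the left of the edge oriented from `K*` to `L*`. -/
structure DDFVMesh (Cell IEdge BEdge Vert : Type*) where
  /-- the domain -/
  Ω : Set Plane
  isOpen_Ω : IsOpen Ω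
  isConnected_Ω : IsConnected Ω
  isBounded_Ω : Bornology.IsBounded Ω
  /-- the open primal cells -/
  cell : Cell → Set Plane
  /-- the vertices `x_{K*}` of the primal mesh, centers of the dual cells -/
  vertex : Vert → Plane
  /-- the centers `x_K` of the primal cells and of the boundary edges -/
  center : Cell ⊕ BEdge → Plane
  /-- the cell `K` on the left of an edge -/
  left : IEdge ⊕ BEdge → Cell
  /-- the cell `L` on the right of an interior edge -/
  right : IEdge → Cell
  /-- the first end point `K*` of an edge -/
  tail : IEdge ⊕ BEdge → Vert
  /-- the second end point `L*` of an edge -/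
  head : IEdge ⊕ BEdge → Vert
  /-- the open dual cells -/
  dualCell : Vert → Set Plane
  vertex_injective : Function.Injective vertex
  /-- the primal cells are disjoint polygons covering the domain, their sides are the edges -/
  cell_polygon : ∀ K, IsOpenPolygon (cell K)
    {z | ∃ e : IEdge ⊕ BEdge, (left e = K ∨ ∃ i, e = Sum.inl i ∧ right i = K) ∧
      z = s(vertex (tail e), vertex (head e))}
  cell_disjoint : ∀ K L, K ≠ L → Disjoint (cell K) (cell L)
  cell_subset : ∀ K, cell K ⊆ Ω
  iUnion_closure_cell : ⋃ K, closure (cell K) = closure Ω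
  /-- distinct edges meet at most at vertices -/
  edge_disjoint : ∀ e e', e ≠ e' →
    Disjoint (openSegment ℝ (vertex (tail e)) (vertex (head e)))
      (segment ℝ (vertex (tail e')) (vertex (head e')))
  left_ne_right : ∀ i, left (Sum.inl i) ≠ right i
  interior_edge : ∀ i,
    openSegment ℝ (vertex (tail (Sum.inl i))) (vertex (head (Sum.inl i))) ⊆ Ω
  boundary_edge :
    frontier Ω = ⋃ b, segment ℝ (vertex (tail (Sum.inr b))) (vertex (head (Sum.inr b)))
  /-- `K` is locally on the left of its edge and `L` is locally on the right -/
  left_side : ∀ e, ∀ x ∈ openSegment ℝ (vertex (tail e)) (vertex (head e)),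
    ∀ᶠ t in 𝓝[>] (0 : ℝ), x - t • perp (vertex (head e) - vertex (tail e)) ∈ cell (left e)
  right_side : ∀ i,
    ∀ x ∈ openSegment ℝ (vertex (tail (Sum.inl i))) (vertex (head (Sum.inl i))),
    ∀ᶠ t in 𝓝[>] (0 : ℝ),
      x + t • perp (vertex (head (Sum.inl i)) - vertex (tail (Sum.inl i))) ∈ cell (right i)
  /-- the centers of the two cells lie strictly on their side of the line through the edge -/
  center_left : ∀ e, 0 < cross (vertex (head e) - vertex (tail e))
    (center (Sum.inl (left e)) - vertex (tail e))
  center_right : ∀ i, cross (vertex (head (Sum.inl i)) - vertex (tail (Sum.inl i)))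
    (center (Sum.inl (right i)) - vertex (tail (Sum.inl i))) < 0
  /-- the center of a boundary edge is on this edge (usually it is the midpoint) -/
  center_boundary : ∀ b, center (Sum.inr b) ∈
    openSegment ℝ (vertex (tail (Sum.inr b))) (vertex (head (Sum.inr b)))
  /-- the diamonds (unions of two triangles, the second one is degenerate for a boundary edge)
  do not leave the domain -/
  diamond_left_subset : ∀ e, convexHull ℝ {center (Sum.inl (left e)), vertex (tail e),
    vertex (head e)} ⊆ closure Ω
  diamond_right_subset : ∀ i, convexHull ℝ {center (Sum.inl (right i)),
    vertex (tail (Sum.inl i)), vertex (head (Sum.inl i))} ⊆ closure Ω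
  /-- the dual cell around a vertex is the polygon whose sides join the centers of the successive
  cells around this vertex; around a boundary vertex, it is closed up by the segments joining the
  vertex to the centers of the boundary edges that contain it -/
  dualCell_polygon : ∀ v, IsOpenPolygon (dualCell v)
    ({z | ∃ e : IEdge ⊕ BEdge, (tail e = v ∨ head e = v) ∧
        z = s(center (Sum.inl (left e)), center (Sum.map right id e))} ∪
      {z | ∃ b : BEdge, (tail (Sum.inr b) = v ∨ head (Sum.inr b) = v) ∧
        z = s(vertex v, center (Sum.inr b))})
  dualCell_subset : ∀ v, dualCell v ⊆ Ω
  /-- the Dirichlet part of the boundary -/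
  ΓDir : Set Plane
  /-- the Neumann part of the boundary -/
  ΓN : Set Plane
  isClosed_ΓDir : IsClosed ΓDir
  isClosed_ΓN : IsClosed ΓN
  ΓDir_union_ΓN : ΓDir ∪ ΓN = frontier Ω
  ΓDir_inter_ΓN : ΓDir ∩ ΓN ⊆ Set.range vertex
  /-- the Dirichlet boundary has positive length -/
  ΓDir_pos : 0 < Measure.hausdorffMeasure 1 ΓDir

namespace DDFVMesh

variable {Cell IEdge BEdge Vert : Type*} (T : DDFVMesh Cell IEdge BEdge Vert)

/-- The degrees of freedom: primal cells, boundary edges, and vertices (i.e. dual cells). -/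
abbrev Dof (_ : DDFVMesh Cell IEdge BEdge Vert) : Type _ := (Cell ⊕ BEdge) ⊕ Vert

/-- The Dirichlet degrees of freedom. -/
def IsDir : T.Dof → Prop
  | Sum.inl (Sum.inl _) => False
  | Sum.inl (Sum.inr b) => T.center (Sum.inr b) ∈ T.ΓDir
  | Sum.inr v => T.vertex v ∈ T.ΓDir

/-- The degrees of freedom that carry an unknown and an equation. -/
abbrev FreeDof : Type _ := {A : T.Dof // ¬ T.IsDir A}

/-- Pairs `(p_g, p_w)` of discrete pressures with homogeneous Dirichlet values; the index `0` stands
for the gas phase `g` and `1` for the wetting phase `w`. -/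
abbrev State : Type _ := Fin 2 → T.FreeDof → ℝ

open scoped Classical in
/-- Extension of a discrete function by zero at the Dirichlet degrees of freedom. -/
def ext (u : T.FreeDof → ℝ) : T.Dof → ℝ := fun A => if h : T.IsDir A then 0 else u ⟨A, h⟩

/-- Primal degree of freedom `K` of the diamond of `e`, or `L` for the reversed labelling
`(L, K, L*, K*)` of the same diamond. -/
def src : (IEdge ⊕ BEdge) × Bool → T.Dof
  | (e, true) => Sum.inl (Sum.inl (T.left e))
  | (e, false) => Sum.inl (Sum.map T.right id e)

/-- Primal degree of freedom `L` of a labelled diamond. -/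
def tgt (d : (IEdge ⊕ BEdge) × Bool) : T.Dof := T.src (d.1, !d.2)

/-- Dual degree of freedom `K*` of a labelled diamond. -/
def dsrc : (IEdge ⊕ BEdge) × Bool → T.Dof
  | (e, true) => Sum.inr (T.tail e)
  | (e, false) => Sum.inr (T.head e)

/-- Dual degree of freedom `L*` of a labelled diamond. -/
def dtgt (d : (IEdge ⊕ BEdge) × Bool) : T.Dof := T.dsrc (d.1, !d.2)

/-- The vector `x_L - x_K` along the dual edge `σ*`. -/
def dualVec (e : IEdge ⊕ BEdge) : Plane :=
  T.center (Sum.map T.right id e) - T.center (Sum.inl (T.left e))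

/-- The vector `x_{L*} - x_{K*}` along the primal edge `σ`. -/
def edgeVec (e : IEdge ⊕ BEdge) : Plane := T.vertex (T.head e) - T.vertex (T.tail e)

/-- The length of the primal edge. -/
def mEdge (e : IEdge ⊕ BEdge) : ℝ := ‖T.edgeVec e‖

/-- The length of the dual edge. -/
def mDual (e : IEdge ⊕ BEdge) : ℝ := ‖T.dualVec e‖

/-- The sine of the angle between the lines `(x_K, x_L)` and `(x_{K*}, x_{L*})`. -/
def sinAngle (e : IEdge ⊕ BEdge) : ℝ :=
  Real.sin (InnerProductGeometry.angle (T.dualVec e) (T.edgeVec e))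

/-- The unit normal to `σ` pointing from `K` to `L`. -/
def nEdge (e : IEdge ⊕ BEdge) : Plane := (T.mEdge e)⁻¹ • perp (T.edgeVec e)

/-- The unit normal to `σ*` pointing from `K*` to `L*`. -/
def nDual (e : IEdge ⊕ BEdge) : Plane := -((T.mDual e)⁻¹ • perp (T.dualVec e))

/-- The diamond, as a closed set; for a boundary edge the second triangle is a segment. -/
def diamond (e : IEdge ⊕ BEdge) : Set Plane :=
  convexHull ℝ {T.center (Sum.inl (T.left e)), T.vertex (T.tail e), T.vertex (T.head e)} ∪
  convexHull ℝ {T.center (Sum.map T.right id e), T.vertex (T.tail e), T.vertex (T.head e)}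

end DDFVMesh

/-! ### Data of the two-phase flow model -/

/-- The data of the compressible two-phase Darcy flow in `Ω`. The index `0` stands for the gas phase
and `1` for the wetting phase. -/
structure FlowData (Ω : Set Plane) where
  /-- the capillary pressure, an increasing homeomorphism of the line -/
  pc : ℝ ≃o ℝ
  pc_zero : pc 0 = 0
  /-- the capillary pressure is piecewise `C¹` with bounded derivative -/
  pc_piecewise : ∃ S : Set ℝ, S.Countable ∧ IsClosed S ∧
    (∀ s ∉ S, DifferentiableAt ℝ pc s) ∧ ContinuousOn (deriv pc) Sᶜ ∧
    ∃ C : ℝ, ∀ s ∉ S, |deriv pc s| ≤ C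
  /-- the mobilities, extended by constants outside of `[0, 1]` -/
  M : Fin 2 → ℝ → ℝ
  M_continuous : ∀ α, Continuous (M α)
  M_monotone : ∀ α, Monotone (M α)
  M_of_nonpos : ∀ α, ∀ s ≤ 0, M α s = 0
  M_of_one_le : ∀ α, ∀ s, 1 ≤ s → M α s = M α 1
  /-- the total mobility is bounded below by a positive constant -/
  totalMobility_pos : ∃ m₀ > 0, ∀ s ∈ Set.Icc (0 : ℝ) 1, m₀ ≤ M 1 (1 - s) + M 0 s
  /-- the densities -/
  ρ : Fin 2 → ℝ → ℝ
  ρ_contDiff : ∀ α, ContDiff ℝ 1 (ρ α)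
  ρ_monotone : ∀ α, Monotone (ρ α)
  ρ_bounds : ∃ ρ₀ > 0, ∃ ρ₁, ∀ α p, ρ₀ ≤ ρ α p ∧ ρ α p ≤ ρ₁
  /-- the porosity -/
  φ : Plane → ℝ
  φ_measurable : AEStronglyMeasurable φ (volume.restrict Ω)
  φ_bounds : ∃ φ₀ > 0, ∃ φ₁, ∀ᵐ x ∂(volume.restrict Ω), φ₀ ≤ φ x ∧ φ x ≤ φ₁
  /-- the permeability tensor -/
  Λ : Plane → Matrix (Fin 2) (Fin 2) ℝ
  Λ_measurable : ∀ i j, AEStronglyMeasurable (fun x => Λ x i j) (volume.restrict Ω)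
  Λ_symm : ∀ᵐ x ∂(volume.restrict Ω), (Λ x).IsSymm
  Λ_elliptic : ∃ l > 0, ∃ L, ∀ᵐ x ∂(volume.restrict Ω), ∀ v : Plane,
    l * ‖v‖ ^ 2 ≤ ∑ i, ∑ j, Λ x i j * v j * v i ∧ ∑ i, ∑ j, Λ x i j * v j * v i ≤ L * ‖v‖ ^ 2

namespace FlowData

variable {Ω : Set Plane} (D : FlowData Ω)

/-- The saturation of the phase `α` as a function of the phase pressures `(p_g, p_w)`. -/
def sat (α : Fin 2) (pg pw : ℝ) : ℝ :=
  ![D.pc.symm (pg - pw), 1 - D.pc.symm (pg - pw)] α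

/-- The `ε`-regularized mobilities. -/
def regMobility (ε : ℝ) (α : Fin 2) (s : ℝ) : ℝ := ε + D.M α s

/-- The total mobility as a function of the gas saturation. -/
def totalMobility (s : ℝ) : ℝ := D.M 1 (1 - s) + D.M 0 s

/-- The corrective pressures `p̂_g` and `p̂_w` as functions of the gas saturation. -/
def corrective (α : Fin 2) (s : ℝ) : ℝ :=
  ∫ u in (0 : ℝ)..s, ![D.M 1 (1 - u), D.M 0 u] α / D.totalMobility u * deriv D.pc u

/-- The global pressure, written with either of the phases: `p_g - p̂_g(s_g)` for `α = 0`
and `p_w + p̂_w(s_g)` for `α = 1`. -/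
def globalPressure (α : Fin 2) (pg pw : ℝ) : ℝ :=
  ![pg, pw] α - (-1) ^ (α : ℕ) * D.corrective α (D.sat 0 pg pw)

/-- The interface density `ρ_{α,AB}` for the pressures `a = p_{α,A}` and `b = p_{α,B}`. -/
def interfaceDensity (α : Fin 2) (a b : ℝ) : ℝ :=
  (if a = b then 1 / D.ρ α a else 1 / (b - a) * ∫ z in a..b, 1 / D.ρ α z)⁻¹

/-- The mean value of the porosity on `A`. -/
def meanPorosity (A : Set Plane) : ℝ := 1 / volume.real A * ∫ x in A, D.φ x

/-- The mean value of the permeability on `A`. -/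
def meanPermeability (A : Set Plane) : Matrix (Fin 2) (Fin 2) ℝ :=
  Matrix.of fun i j => 1 / volume.real A * ∫ x in A, D.Λ x i j

end FlowData

/-! ### The schemes -/

/-- The bilinear form `⟨A u, v⟩`. -/
def matForm (A : Matrix (Fin 2) (Fin 2) ℝ) (u v : Plane) : ℝ := ∑ i, ∑ j, A i j * u j * v i

/-- The truncation to `[0, 1]`. -/
def trunc (s : ℝ) : ℝ := if s < 0 then 0 else if s ≤ 1 then s else 1

/-- The upwind mobility `M_{AB}^{up}`, for the pressures `pA`, `pB` and saturations `sA`, `sB`. -/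
def upwind (M : ℝ → ℝ) (pA pB sA sB : ℝ) : ℝ := if 0 ≤ pB - pA then M sB else M sA

namespace DDFVMesh

variable {Cell IEdge BEdge Vert : Type*} (T : DDFVMesh Cell IEdge BEdge Vert) (D : FlowData T.Ω)

/-- The transmissibility `τ_{KL}`. -/
def tau (e : IEdge ⊕ BEdge) : ℝ :=
  T.mEdge e / T.mDual e *
    (matForm (D.meanPermeability (T.diamond e)) (T.nEdge e) (T.nEdge e) / T.sinAngle e)

/-- The transmissibility `τ_{K*L*}`. -/
def tauDual (e : IEdge ⊕ BEdge) : ℝ :=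
  T.mDual e / T.mEdge e *
    (matForm (D.meanPermeability (T.diamond e)) (T.nDual e) (T.nDual e) / T.sinAngle e)

/-- The transmissibility `η_𝒟`. -/
def etaD (e : IEdge ⊕ BEdge) : ℝ :=
  matForm (D.meanPermeability (T.diamond e)) (T.nEdge e) (T.nDual e) / T.sinAngle e

/-- The discrete norm `‖u‖_{𝒯,τ}` of a discrete function with values at all degrees of freedom. -/
def normTau [Fintype IEdge] [Fintype BEdge] (u : T.Dof → ℝ) : ℝ :=
  Real.sqrt (∑ e : IEdge ⊕ BEdge,
    (T.tau D e * (u (T.tgt (e, true)) - u (T.src (e, true))) ^ 2 +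
      T.tauDual D e * (u (T.dtgt (e, true)) - u (T.dsrc (e, true))) ^ 2))

/-- The discrete pressures at all degrees of freedom. -/
def pressure (p : T.State) (α : Fin 2) (A : T.Dof) : ℝ := T.ext (p α) A

/-- The discrete saturations at all degrees of freedom. -/
def saturation (p : T.State) (α : Fin 2) (A : T.Dof) : ℝ :=
  D.sat α (T.pressure p 0 A) (T.pressure p 1 A)

/-- The discrete global pressure at all degrees of freedom, written with the phase `α`. -/
def discreteGlobalPressure (p : T.State) (α : Fin 2) (A : T.Dof) : ℝ :=
  D.globalPressure α (T.pressure p 0 A) (T.pressure p 1 A)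

/-- The discrete saturations obey their physical bounds. -/
def MaxPrinciple (p : T.State) : Prop :=
  ∀ α A, 0 ≤ T.saturation D p α A ∧ T.saturation D p α A ≤ 1

/-- The interface density `ρ_{α,AB}`. -/
def density (p : T.State) (α : Fin 2) (A B : T.Dof) : ℝ :=
  D.interfaceDensity α (T.pressure p α A) (T.pressure p α B)

/-- The upwind mobility `M_{α,AB}^{up}` for the mobility functions `M`. -/
def mobUp (M : Fin 2 → ℝ → ℝ) (p : T.State) (α : Fin 2) (A B : T.Dof) : ℝ :=
  upwind (M α) (T.pressure p α A) (T.pressure p α B) (T.saturation D p α A) (T.saturation D p α B)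

/-- The minimal mobility `M_{α,AB}^{min}` for the mobility functions `M`. -/
def mobMin (M : Fin 2 → ℝ → ℝ) (p : T.State) (α : Fin 2) (A B : T.Dof) : ℝ :=
  min (M α (T.saturation D p α A)) (M α (T.saturation D p α B))

/-- The projected velocity `V_{KL}^α` of a labelled diamond for the mobility functions `M`. -/
def velocity (M : Fin 2 → ℝ → ℝ) (p : T.State) (α : Fin 2) (d : (IEdge ⊕ BEdge) × Bool) : ℝ :=
  T.mobUp D M p α (T.src d) (T.tgt d) * T.tau D d.1 *
      (T.pressure p α (T.tgt d) - T.pressure p α (T.src d)) +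
    Real.sqrt (T.mobMin D M p α (T.src d) (T.tgt d)) *
      Real.sqrt (T.mobUp D M p α (T.dsrc d) (T.dtgt d)) * T.etaD D d.1 *
      (T.pressure p α (T.dtgt d) - T.pressure p α (T.dsrc d))

/-- The projected velocity `V_{K*L*}^α` of a labelled diamond for the mobility functions `M`. -/
def velocityDual (M : Fin 2 → ℝ → ℝ) (p : T.State) (α : Fin 2) (d : (IEdge ⊕ BEdge) × Bool) : ℝ :=
  T.mobUp D M p α (T.dsrc d) (T.dtgt d) * T.tauDual D d.1 *
      (T.pressure p α (T.dtgt d) - T.pressure p α (T.dsrc d)) +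
    Real.sqrt (T.mobMin D M p α (T.dsrc d) (T.dtgt d)) *
      Real.sqrt (T.mobUp D M p α (T.src d) (T.tgt d)) * T.etaD D d.1 *
      (T.pressure p α (T.tgt d) - T.pressure p α (T.src d))

/-- The capillary flow `p_{c,KL}` of a labelled diamond. -/
def capFlow (p : T.State) (d : (IEdge ⊕ BEdge) × Bool) : ℝ :=
  T.tau D d.1 * ((T.pressure p 0 (T.tgt d) - T.pressure p 1 (T.tgt d)) -
    (T.pressure p 0 (T.src d) - T.pressure p 1 (T.src d)))

/-- The capillary flow `p_{c,K*L*}` of a labelled diamond. -/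
def capFlowDual (p : T.State) (d : (IEdge ⊕ BEdge) × Bool) : ℝ :=
  T.tauDual D d.1 * ((T.pressure p 0 (T.dtgt d) - T.pressure p 1 (T.dtgt d)) -
    (T.pressure p 0 (T.dsrc d) - T.pressure p 1 (T.dsrc d)))

/-- The accumulation term on the control volume `S` of the degree of freedom `A`; `pn` is the
discrete solution at the previous time step. -/
def accumulation (p pn : T.State) (α : Fin 2) (A : T.Dof) (S : Set Plane) : ℝ :=
  volume.real S * D.meanPorosity S *
    (D.ρ α (T.pressure p α A) * trunc (T.saturation D p α A) -
      D.ρ α (T.pressure pn α A) * T.saturation D pn α A)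

/-- The sum of `f` over the primal edges `σ = A|B`, each one labelled from the primal cell `A`. -/
def sumEdges [Fintype IEdge] [Fintype BEdge] (A : T.Dof) (f : (IEdge ⊕ BEdge) × Bool → ℝ) : ℝ :=
  open scoped Classical in ∑ d : (IEdge ⊕ BEdge) × Bool, if T.src d = A then f d else 0

/-- The sum of `f` over the dual edges `σ* = A|B`, each one labelled from the dual cell `A`. -/
def sumDualEdges [Fintype IEdge] [Fintype BEdge] (A : T.Dof)
    (f : (IEdge ⊕ BEdge) × Bool → ℝ) : ℝ :=
  open scoped Classical in ∑ d : (IEdge ⊕ BEdge) × Bool, if T.dsrc d = A then f d else 0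

variable [Fintype IEdge] [Fintype BEdge]

/-- The left-hand side of the positivity-preserving DDFV scheme with time step `dt`, for the phase
`α`, at the degree of freedom `A`. -/
def ppRow (dt : ℝ) (p pn : T.State) (α : Fin 2) : T.Dof → ℝ
  | Sum.inl (Sum.inl K) =>
      T.accumulation D p pn α (Sum.inl (Sum.inl K)) (T.cell K) -
        dt * T.sumEdges (Sum.inl (Sum.inl K)) (fun d =>
          T.density D p α (T.src d) (T.tgt d) * T.velocity D D.M p α d)
  | Sum.inl (Sum.inr b) =>
      -dt * (T.density D p α (T.src (Sum.inr b, false)) (T.tgt (Sum.inr b, false)) *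
        T.velocity D D.M p α (Sum.inr b, false))
  | Sum.inr v =>
      T.accumulation D p pn α (Sum.inr v) (T.dualCell v) -
        dt * T.sumDualEdges (Sum.inr v) (fun d =>
          T.density D p α (T.dsrc d) (T.dtgt d) * T.velocityDual D D.M p α d)

/-- The positivity-preserving DDFV scheme `ℱ(p, pn)`; the scheme is `ppScheme = 0`. -/
def ppScheme (dt : ℝ) (p pn : T.State) : T.State := fun α A => T.ppRow D dt p pn α A

/-- The left-hand side of the `(ε, η)`-regularized scheme with time step `dt`, for the phase `α`, at
the degree of freedom `A`. -/
def regRow (dt ε η : ℝ) (p pn : T.State) (α : Fin 2) : T.Dof → ℝ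
  | Sum.inl (Sum.inl K) =>
      T.accumulation D p pn α (Sum.inl (Sum.inl K)) (T.cell K) -
        dt * T.sumEdges (Sum.inl (Sum.inl K)) (fun d =>
          T.density D p α (T.src d) (T.tgt d) * T.velocity D (D.regMobility ε) p α d) -
        dt * η * (-1) ^ (α : ℕ) * T.sumEdges (Sum.inl (Sum.inl K)) (fun d =>
          T.density D p α (T.src d) (T.tgt d) * T.capFlow D p d)
  | Sum.inl (Sum.inr b) =>
      -dt * (T.density D p α (T.src (Sum.inr b, false)) (T.tgt (Sum.inr b, false)) *
          T.velocity D (D.regMobility ε) p α (Sum.inr b, false) +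
        η * (-1) ^ (α : ℕ) *
          (T.density D p α (T.src (Sum.inr b, false)) (T.tgt (Sum.inr b, false)) *
            T.capFlow D p (Sum.inr b, false)))
  | Sum.inr v =>
      T.accumulation D p pn α (Sum.inr v) (T.dualCell v) -
        dt * T.sumDualEdges (Sum.inr v) (fun d =>
          T.density D p α (T.dsrc d) (T.dtgt d) * T.velocityDual D (D.regMobility ε) p α d) -
        dt * η * (-1) ^ (α : ℕ) * T.sumDualEdges (Sum.inr v) (fun d =>
          T.density D p α (T.dsrc d) (T.dtgt d) * T.capFlowDual D p d)

/-- The regularized scheme `ℱ^{ε,η}(p, pn)`; the scheme is `regScheme = 0`. -/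
def regScheme (dt ε η : ℝ) (p pn : T.State) : T.State := fun α A => T.regRow D dt ε η p pn α A

end DDFVMesh

end

/-! Everything rests on one energy inequality. The equation of the phase α is tested with g_α(p_α),
where g_α is the primitive of 1/ρ_α. The interface densities are made for this: ρ_{α,AB} times the
jump of g_α is the jump of p_α (`interfaceDensity_mul_potential_sub`), so discrete integration by
parts frees the flux terms from the densities. Concavity of g_α frees the accumulation term from
them, and adding the two phases leaves (Z(s_g) - s_g^n) p_c(s_g) up to constants, which is bounded
below thanks to the truncation. On each diamond, a strict Cauchy–Schwarz inequality for the
permeability absorbs the cross terms (`upwind_flux_coercive`), and the upwind mobilities control the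
jump of the global pressure (`upwind_weighted_sq_ge`). The result, `exists_energy_ge`, holds for
every discrete state, with constants independent of ε and η.

Existence for ε > 0: in the unknowns x = g(p), the inner product of the scheme with x is the energy.
Its ε-term and a discrete Poincaré inequality (`exists_abs_le_mul_normTau`) make it nonnegative on a
large sphere, so a consequence of the no-retraction theorem,
`exists_zero_of_continuous_of_inner_nonneg`, gives a zero. The Poincaré inequality expresses that
the primal and the dual mesh are both connected and both reach the Dirichlet boundary.

Two compactness limits follow. As ε → 0 with η fixed, the capillary term bounds p_g - p_w; together
with the global pressure this bounds both pressures. For ε = 0, upwinding forbids a phase to leave a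
place where its saturation is nonpositive, and the capillary flow propagates a negative minimum up
to the Dirichlet boundary, which is absurd: this is the maximum principle. It bounds p_g - p_w by
p_c(1) uniformly in η, so that η → 0 is possible as well. -/

/-! ### No-retraction theorem and zeros of outward-pointing fields. -/

-- In s, det(1 + sA) is a polynomial of degree at most dim E, so Lagrange interpolation at dim E + 1
-- nodes in (0, t₀] recovers its value at s = 1, with coefficients that do not depend on A.
open Polynomial in
theorem exists_det_extrapolation (E : Type*) [NormedAddCommGroup E] [NormedSpace ℝ E]
    [FiniteDimensional ℝ E] {t₀ : ℝ} (ht₀ : 0 < t₀) :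
    ∃ (n : ℕ) (c t : Fin n → ℝ), (∀ i, t i ∈ Ioc 0 t₀) ∧
      ∀ A : E →L[ℝ] E, (1 + A).det = ∑ i, c i * (1 + t i • A).det := by
  classical
  set m := Module.finrank ℝ E with hm
  let t : Fin (m + 1) → ℝ := fun i => t₀ * ((i + 1 : ℝ) / (m + 1))
  have hm0 : (0 : ℝ) < m + 1 := by positivity
  have htinj : Function.Injective t := by
    intro i j h
    have h1 := mul_left_cancel₀ ht₀.ne' h
    rw [div_left_inj' hm0.ne'] at h1
    exact Fin.ext (by exact_mod_cast add_right_cancel h1)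
  refine ⟨m + 1, fun i => (Lagrange.basis Finset.univ t i).eval 1, t, fun i => ⟨by positivity, ?_⟩,
    fun A => ?_⟩
  · have : (i + 1 : ℝ) / (m + 1) ≤ 1 := by
      rw [div_le_one hm0]
      exact_mod_cast i.2
    exact mul_le_of_le_one_right ht₀.le this
  · let b := Module.finBasis ℝ E
    let N : Matrix (Fin m) (Fin m) ℝ := LinearMap.toMatrix b b (A : E →ₗ[ℝ] E)
    let P : ℝ[X] := Matrix.det ((X : ℝ[X]) • N.map C + (1 : Matrix (Fin m) (Fin m) ℝ).map C)
    have hP : ∀ s : ℝ, P.eval s = (1 + s • A).det := by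
      intro s
      have h1 : (1 + s • A).det = Matrix.det (s • N + 1) := by
        change LinearMap.det ((1 + s • A : E →L[ℝ] E) : E →ₗ[ℝ] E) = _
        rw [← LinearMap.det_toMatrix b]
        congr 1
        have : ((1 + s • A : E →L[ℝ] E) : E →ₗ[ℝ] E) = LinearMap.id + s • (A : E →ₗ[ℝ] E) := rfl
        rw [this, map_add, map_smul, LinearMap.toMatrix_id, add_comm]
      rw [h1]
      change (Polynomial.evalRingHom s) (Matrix.det _) = _
      rw [RingHom.map_det]
      congr 1
      ext i j
      by_cases hij : i = j
      · subst hij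
        simp [mul_comm s]
      · simp [Matrix.one_apply_ne hij, mul_comm s]
    have hdeg : P.degree < (Finset.univ : Finset (Fin (m + 1))).card := by
      refine (Polynomial.degree_le_of_natDegree_le
        (Polynomial.natDegree_det_X_add_C_le N 1)).trans_lt ?_
      simp only [Fintype.card_fin, Finset.card_univ]
      exact_mod_cast Nat.lt_succ_self m
    have h2 := Lagrange.eq_interpolate (f := P) (htinj.injOn) hdeg
    have h3 := congrArg (Polynomial.eval 1) h2
    rw [hP, one_smul] at h3
    rw [h3, Lagrange.interpolate_apply, Polynomial.eval_finsetSum]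
    refine Finset.sum_congr rfl fun i _ => ?_
    rw [Polynomial.eval_mul, Polynomial.eval_C, hP, mul_comm]

section Retraction

variable {E : Type*} [NormedAddCommGroup E] [InnerProductSpace ℝ E]

/-- Extension by zero keeps the Lipschitz constant: a segment leaving the ball crosses the sphere,
where g vanishes. -/
theorem norm_indicator_sub_le_of_eq_zero_on_sphere {R L : ℝ} (hL : 0 ≤ L) {g : E → E}
    (hg : ∀ x ∈ Metric.closedBall (0 : E) R, ∀ y ∈ Metric.closedBall (0 : E) R,
      ‖g x - g y‖ ≤ L * ‖x - y‖)
    (h0 : ∀ x, ‖x‖ = R → g x = 0) (x y : E) :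
    ‖(Metric.closedBall (0 : E) R).indicator g x - (Metric.closedBall (0 : E) R).indicator g y‖
      ≤ L * ‖x - y‖ := by
  have key : ∀ x ∈ Metric.closedBall (0 : E) R, ∀ y ∉ Metric.closedBall (0 : E) R,
      ‖g x‖ ≤ L * ‖x - y‖ := by
    intro x hx y hy
    rw [mem_closedBall_zero_iff] at hx hy
    have hcont : ContinuousOn (fun s : ℝ => ‖AffineMap.lineMap x y s‖) (Icc 0 1) := by
      fun_prop
    obtain ⟨s, hs, hsR⟩ := intermediate_value_Icc zero_le_one hcont
      (show R ∈ Icc _ _ by simpa using ⟨hx, (not_le.1 hy).le⟩)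
    have hz : AffineMap.lineMap x y s ∈ Metric.closedBall (0 : E) R := by
      rw [mem_closedBall_zero_iff]; exact hsR.le
    have h := hg x (by rwa [mem_closedBall_zero_iff]) _ hz
    rw [h0 _ hsR, sub_zero] at h
    refine h.trans (mul_le_mul_of_nonneg_left ?_ hL)
    rw [← dist_eq_norm, ← dist_eq_norm, dist_left_lineMap]
    refine mul_le_of_le_one_left dist_nonneg ?_
    rw [Real.norm_eq_abs, abs_of_nonneg hs.1]
    exact hs.2
  by_cases hx : x ∈ Metric.closedBall (0 : E) R <;> by_cases hy : y ∈ Metric.closedBall (0 : E) R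
  · simpa [indicator_of_mem hx, indicator_of_mem hy] using hg x hx y hy
  · simpa [indicator_of_mem hx, indicator_of_notMem hy] using key x hx y hy
  · simpa [indicator_of_notMem hx, indicator_of_mem hy, norm_sub_rev x y] using key y hy x hx
  · simpa [indicator_of_notMem hx, indicator_of_notMem hy] using mul_nonneg hL (norm_nonneg _)

variable [FiniteDimensional ℝ E]

/-- Injectivity: t g is a strict contraction. The ball is preserved because x + t g(x) is a convex
combination of x and x + g(x). Surjectivity: a preimage of y is a fixed point of x ↦ y - t g(x),
with g extended by zero; a fixed point outside the ball would equal y, which is inside. -/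
theorem image_id_add_smul_closedBall {R L t : ℝ} (hL : 0 ≤ L) {g : E → E}
    (hg : ∀ x ∈ Metric.closedBall (0 : E) R, ∀ y ∈ Metric.closedBall (0 : E) R,
      ‖g x - g y‖ ≤ L * ‖x - y‖)
    (h0 : ∀ x, ‖x‖ = R → g x = 0) (h1 : ∀ x, ‖x‖ ≤ R → ‖x + g x‖ ≤ R)
    (ht0 : 0 ≤ t) (ht1 : t ≤ 1) (htL : t * L < 1) :
    InjOn (fun x => x + t • g x) (Metric.closedBall 0 R) ∧
      (fun x => x + t • g x) '' Metric.closedBall 0 R = Metric.closedBall 0 R := by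
  refine ⟨?_, Subset.antisymm ?_ ?_⟩
  · intro x hx y hy hxy
    have h2 : x - y = t • (g y - g x) := by
      rw [smul_sub, sub_eq_sub_iff_add_eq_add, add_comm (t • g y)]
      simpa using hxy
    have h3 : ‖x - y‖ ≤ t * L * ‖x - y‖ := by
      conv_lhs => rw [h2, norm_smul, Real.norm_eq_abs, abs_of_nonneg ht0, norm_sub_rev]
      rw [mul_assoc]
      exact mul_le_mul_of_nonneg_left (hg x hx y hy) ht0
    have h4 : ‖x - y‖ = 0 := by nlinarith [norm_nonneg (x - y)]
    exact sub_eq_zero.1 (norm_eq_zero.1 h4)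
  · rintro _ ⟨x, hx, rfl⟩
    rw [mem_closedBall_zero_iff] at hx ⊢
    have : x + t • g x = (1 - t) • x + t • (x + g x) := by module
    change ‖x + t • g x‖ ≤ R
    rw [this]
    refine (norm_add_le _ _).trans ?_
    rw [norm_smul, norm_smul, Real.norm_eq_abs, Real.norm_eq_abs, abs_of_nonneg ht0,
      abs_of_nonneg (by linarith)]
    nlinarith [h1 x hx]
  · intro y hy
    have hcontr : ContractingWith (Real.toNNReal (t * L))
        (fun x => y - t • (Metric.closedBall (0 : E) R).indicator g x) := by
      refine ⟨by rw [← NNReal.coe_lt_coe, Real.coe_toNNReal _ (by positivity)]; simpa using htL, ?_⟩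
      refine LipschitzWith.of_dist_le_mul fun a b => ?_
      rw [Real.coe_toNNReal _ (by positivity), dist_eq_norm, dist_eq_norm, sub_sub_sub_cancel_left,
        ← smul_sub, norm_smul, Real.norm_eq_abs, abs_of_nonneg ht0, mul_assoc, norm_sub_rev a b]
      exact mul_le_mul_of_nonneg_left
        (norm_indicator_sub_le_of_eq_zero_on_sphere hL hg h0 b a) ht0
    have hfix := hcontr.fixedPoint_isFixedPt
    set x := ContractingWith.fixedPoint _ hcontr
    have hx : y - t • (Metric.closedBall (0 : E) R).indicator g x = x := hfix
    by_cases hxB : x ∈ Metric.closedBall (0 : E) R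
    · refine ⟨x, hxB, ?_⟩
      rw [indicator_of_mem hxB] at hx
      change x + t • g x = y
      exact (sub_eq_iff_eq_add.1 hx).symm
    · rw [indicator_of_notMem hxB, smul_zero, sub_zero] at hx
      exact absurd (hx ▸ hy) hxB

/-- There is no `C¹` retraction of a ball onto its sphere. -/
theorem not_exists_contDiff_retraction {R : ℝ} (hR : 0 < R) {U : Set E} (hU : IsOpen U)
    (hBU : Metric.closedBall 0 R ⊆ U) {g : E → E} (hg : ContDiffOn ℝ 1 g U)
    (h0 : ∀ x, ‖x‖ = R → g x = 0) (h1 : ∀ x ∈ U, ‖x + g x‖ = R) : False := by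
  let _ : MeasurableSpace E := borel E
  have _ : BorelSpace E := ⟨rfl⟩
  have hd : ∀ x ∈ U, HasFDerivAt g (fderiv ℝ g x) x := fun x hx =>
    ((hg.differentiableOn one_ne_zero).differentiableAt (hU.mem_nhds hx)).hasFDerivAt
  have hc : ContinuousOn (fderiv ℝ g) (Metric.closedBall 0 R) :=
    (hg.continuousOn_fderiv_of_isOpen hU le_rfl).mono hBU
  have hB : IsCompact (Metric.closedBall (0 : E) R) := isCompact_closedBall _ _
  obtain ⟨L, hL⟩ := hB.exists_bound_of_continuousOn hc
  have hL0 : 0 ≤ L := (norm_nonneg _).trans (hL 0 (Metric.mem_closedBall_self hR.le))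
  have hlip : ∀ x ∈ Metric.closedBall (0 : E) R, ∀ y ∈ Metric.closedBall (0 : E) R,
      ‖g x - g y‖ ≤ L * ‖x - y‖ := fun x hx y hy =>
    (convex_closedBall (0 : E) R).norm_image_sub_le_of_norm_hasFDerivWithin_le
      (fun z hz => (hd z (hBU hz)).hasFDerivWithinAt) hL hy hx
  have hdet : ∀ᶠ A in 𝓝 (1 : E →L[ℝ] E), 0 < A.det := by
    refine ContinuousLinearMap.continuous_det.continuousAt.eventually (lt_mem_nhds ?_)
    change 0 < LinearMap.det (LinearMap.id : E →ₗ[ℝ] E)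
    simp
  obtain ⟨δ, hδ, hdet⟩ := Metric.eventually_nhds_iff.1 hdet
  obtain ⟨t₀, ht₀, ht₁, htL, htδ⟩ : ∃ t₀ : ℝ, 0 < t₀ ∧ t₀ ≤ 1 ∧ t₀ * L < 1 ∧ t₀ * L < δ := by
    refine ⟨min 1 (min 1 δ / (2 * (L + 1))), by positivity, min_le_left _ _, ?_⟩
    have h : min 1 (min 1 δ / (2 * (L + 1))) * L ≤ min 1 δ / 2 := by
      calc _ ≤ (min 1 δ / (2 * (L + 1))) * (L + 1) := by gcongr; exacts [min_le_right _ _, by simp]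
        _ = min 1 δ / 2 := by field_simp
    have := min_le_left 1 δ
    have := min_le_right 1 δ
    have : 0 < min 1 δ := by positivity
    constructor <;> linarith
  have hcontdet : ∀ t : ℝ, ContinuousOn (fun x => (1 + t • fderiv ℝ g x).det)
      (Metric.closedBall 0 R) := fun t =>
    ContinuousLinearMap.continuous_det.comp_continuousOn
      (continuousOn_const.add (hc.const_smul t))
  have hint : ∀ t : ℝ, IntegrableOn (fun x => (1 + t • fderiv ℝ g x).det)
      (Metric.closedBall 0 R) volume := fun t => (hcontdet t).integrableOn_compact hB
  -- For small t the map x + t g(x) is a bijection of the ball with positive Jacobian, so the change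
  -- of variables formula gives the volume of the ball.
  have hvol : ∀ t ∈ Ioc 0 t₀, ∫ x in Metric.closedBall 0 R, (1 + t • fderiv ℝ g x).det =
      volume.real (Metric.closedBall (0 : E) R) := by
    intro t ht
    have hpos : ∀ x ∈ Metric.closedBall (0 : E) R, 0 < (1 + t • fderiv ℝ g x).det := by
      intro x hx
      refine hdet ?_
      rw [dist_eq_norm, add_sub_cancel_left, norm_smul, Real.norm_eq_abs, abs_of_pos ht.1]
      calc t * ‖fderiv ℝ g x‖ ≤ t₀ * L :=
            mul_le_mul ht.2 (hL x hx) (norm_nonneg _) ht₀.le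
        _ < δ := htδ
    obtain ⟨hinj, himg⟩ := image_id_add_smul_closedBall (t := t) hL0 hlip h0
      (fun x hx => (h1 x (hBU (by simpa using hx))).le) ht.1.le (ht.2.trans ht₁)
      ((mul_le_mul_of_nonneg_right ht.2 hL0).trans_lt htL)
    have hder : ∀ x ∈ Metric.closedBall (0 : E) R,
        HasFDerivWithinAt (fun x => x + t • g x) (1 + t • fderiv ℝ g x)
          (Metric.closedBall 0 R) x := fun x hx =>
      ((hasFDerivAt_id x).add ((hd x (hBU hx)).const_smul t)).hasFDerivWithinAt
    have h3 := lintegral_abs_det_fderiv_eq_addHaar_image volume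
      Metric.isClosed_closedBall.measurableSet hder hinj
    rw [himg] at h3
    rw [Measure.real, ← h3, integral_eq_lintegral_of_nonneg_ae]
    · congr 1
      refine setLIntegral_congr_fun Metric.isClosed_closedBall.measurableSet fun x hx => ?_
      rw [abs_of_pos (hpos x hx)]
    · exact (ae_restrict_iff' Metric.isClosed_closedBall.measurableSet).2
        (Eventually.of_forall fun x hx => (hpos x hx).le)
    · exact (hint t).aestronglyMeasurable
  -- Differentiating ‖x + g(x)‖² = R² shows that x + g(x) is orthogonal to the range of the
  -- derivative; if this were onto, x + g(x) would be 0.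
  have hzero : ∀ x ∈ Metric.closedBall (0 : E) R, (1 + fderiv ℝ g x).det = 0 := by
    intro x hx
    have hxU := hBU hx
    by_contra hne
    have hder : HasFDerivAt (fun y => y + g y) (1 + fderiv ℝ g x) x :=
      (hasFDerivAt_id x).add (hd x hxU)
    have hder2 := hder.norm_sq
    have hconst : (fun y => ‖y + g y‖ ^ 2) =ᶠ[𝓝 x] fun _ => R ^ 2 := by
      filter_upwards [hU.mem_nhds hxU] with y hy
      rw [h1 y hy]
    have h4 := (hder2.congr_of_eventuallyEq hconst.symm).unique (hasFDerivAt_const _ _)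
    have hsurj : Function.Surjective (1 + fderiv ℝ g x : E →L[ℝ] E) :=
      (LinearMap.equivOfDetNeZero (((1 + fderiv ℝ g x : E →L[ℝ] E)) : E →ₗ[ℝ] E) hne).surjective
    obtain ⟨v, hv⟩ := hsurj (x + g x)
    have h5 := congrArg (fun A : E →L[ℝ] ℝ => A v) h4
    rw [zero_apply] at h5
    have h6 : (2 : ℝ) * inner ℝ (x + g x) ((1 + fderiv ℝ g x : E →L[ℝ] E) v) = 0 := by
      rw [← h5, two_mul, two_smul]
      rfl
    rw [hv, real_inner_self_eq_norm_sq, h1 x hxU] at h6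
    nlinarith
  -- The integral of det(1 + s Dg) is a polynomial in s that is constant for small s > 0. Its value
  -- at s = 1 is thus the volume of the ball, although the integrand vanishes there.
  obtain ⟨n, c, t, ht, hdetc⟩ := exists_det_extrapolation E ht₀
  have hsum : ∑ i, c i = 1 := by
    have h := hdetc 0
    have h2 : (1 : E →L[ℝ] E).det = 1 := by
      change LinearMap.det (LinearMap.id : E →ₗ[ℝ] E) = 1
      simp
    have h3 : ∀ s : ℝ, s • (0 : E →L[ℝ] E) = 0 := fun s => smul_zero s
    rw [add_zero, h2] at h
    rw [h]
    refine Finset.sum_congr rfl fun i _ => ?_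
    rw [h3, add_zero, h2, mul_one]
  have hfinal : ∫ x in Metric.closedBall 0 R, (1 + fderiv ℝ g x).det =
      volume.real (Metric.closedBall (0 : E) R) := by
    rw [integral_congr_ae (Eventually.of_forall fun x => hdetc (fderiv ℝ g x))]
    rw [integral_finsetSum _ fun i _ => (hint (t i)).const_mul (c i)]
    simp_rw [integral_const_mul, hvol _ (ht _)]
    rw [← Finset.sum_mul, hsum, one_mul]
  rw [setIntegral_congr_fun Metric.isClosed_closedBall.measurableSet hzero] at hfinal
  have hpos : 0 < volume.real (Metric.closedBall (0 : E) R) :=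
    ENNReal.toReal_pos (Metric.measure_closedBall_pos volume _ hR).ne' hB.measure_lt_top.ne
  simp at hfinal
  linarith

/-- A `C¹` field that points outwards on a sphere vanishes somewhere in the ball: otherwise,
following the direction of the field up to the sphere gives a `C¹` retraction. -/
theorem exists_zero_of_contDiff_of_inner_pos {R : ℝ} (hR : 0 < R) {G : E → E} (hG : ContDiff ℝ 1 G)
    (hpos : ∀ x, ‖x‖ = R → 0 < inner ℝ (G x) x) : ∃ x, ‖x‖ ≤ R ∧ G x = 0 := by
  by_contra! hne
  -- `disc` is a quarter of the discriminant of ‖x + λ G(x)‖² = R², a quadratic equation in λ, and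
  -- `lam` is its larger root. On the sphere, ⟨G(x), x⟩ > 0 makes this root 0, so the retraction
  -- fixes the sphere; on the ball the discriminant is positive, so the root is C¹ nearby.
  let disc : E → ℝ := fun x => (inner ℝ (G x) x) ^ 2 + ‖G x‖ ^ 2 * (R ^ 2 - ‖x‖ ^ 2)
  let lam : E → ℝ := fun x => (-(inner ℝ (G x) x) + Real.sqrt (disc x)) / ‖G x‖ ^ 2
  have hdiscC : ContDiff ℝ 1 disc := by
    have h1 : ContDiff ℝ 1 fun x => inner ℝ (G x) x := hG.inner ℝ contDiff_id
    have h2 : ContDiff ℝ 1 fun x => ‖G x‖ ^ 2 := hG.norm_sq ℝ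
    have h3 : ContDiff ℝ 1 fun x : E => ‖x‖ ^ 2 := contDiff_id.norm_sq ℝ
    exact (h1.pow 2).add (h2.mul (contDiff_const.sub h3))
  let U : Set E := {x | G x ≠ 0} ∩ {x | 0 < disc x}
  have hU : IsOpen U := (isOpen_ne_fun hG.continuous continuous_const).inter
    (isOpen_lt continuous_const hdiscC.continuous)
  have hBU : Metric.closedBall 0 R ⊆ U := by
    intro x hx
    rw [mem_closedBall_zero_iff] at hx
    have hGx := hne x hx
    refine ⟨hGx, ?_⟩
    have hGn : 0 < ‖G x‖ ^ 2 := by positivity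
    rcases hx.lt_or_eq with h | h
    · have : 0 < R ^ 2 - ‖x‖ ^ 2 := by nlinarith [norm_nonneg x]
      have := mul_pos hGn this
      show 0 < disc x
      positivity
    · show 0 < disc x
      simp only [disc]
      rw [h, sub_self, mul_zero, add_zero]
      exact pow_pos (hpos x h) 2
  refine not_exists_contDiff_retraction hR hU hBU (g := fun x => lam x • G x) ?_ ?_ ?_
  · refine ContDiffOn.smul ?_ hG.contDiffOn
    refine ContDiffOn.div ?_ (hG.norm_sq ℝ).contDiffOn fun x hx => by
      have := hx.1
      simpa using this
    refine ContDiffOn.add (hG.inner ℝ contDiff_id).neg.contDiffOn ?_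
    exact ContDiffOn.sqrt hdiscC.contDiffOn fun x hx => (ne_of_gt hx.2)
  · intro x hx
    have : lam x = 0 := by
      simp only [lam, disc]
      rw [hx, sub_self, mul_zero, add_zero, Real.sqrt_sq (hpos x hx).le]
      simp
    simp [this]
  · intro x hx
    have hGn : ‖G x‖ ^ 2 ≠ 0 := by have := hx.1; simpa using this
    have hl : ‖G x‖ ^ 2 * lam x = -(inner ℝ (G x) x) + Real.sqrt (disc x) := by
      exact mul_div_cancel₀ _ hGn
    have hs : Real.sqrt (disc x) ^ 2 = disc x := Real.sq_sqrt (le_of_lt hx.2)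
    have h1 : ‖x + lam x • G x‖ ^ 2 = ‖x‖ ^ 2 + 2 * lam x * inner ℝ (G x) x
        + lam x ^ 2 * ‖G x‖ ^ 2 := by
      rw [norm_add_sq_real, real_inner_smul_right, norm_smul, mul_pow, Real.norm_eq_abs, sq_abs,
        real_inner_comm]
      ring
    have h2 : ‖G x‖ ^ 2 * (‖x + lam x • G x‖ ^ 2 - R ^ 2) = 0 := by
      have h3 : Real.sqrt (disc x) = ‖G x‖ ^ 2 * lam x + inner ℝ (G x) x := by linarith
      rw [h3] at hs
      simp only [disc] at hs
      rw [h1]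
      linear_combination hs
    have h4 : ‖x + lam x • G x‖ ^ 2 = R ^ 2 := by
      have := (mul_eq_zero.1 h2).resolve_left hGn
      linarith
    exact (sq_eq_sq₀ (norm_nonneg _) hR.le).1 h4

/-- A continuous field that points outwards on a sphere vanishes somewhere in the ball. -/
theorem exists_zero_of_continuous_of_inner_nonneg {R : ℝ} (hR : 0 < R) {F : E → E}
    (hF : Continuous F) (hpos : ∀ x, ‖x‖ = R → 0 ≤ inner ℝ (F x) x) :
    ∃ x, ‖x‖ ≤ R ∧ F x = 0 := by
  by_contra! hne
  have hB : IsCompact (Metric.closedBall (0 : E) R) := isCompact_closedBall _ _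
  obtain ⟨x₀, hx₀, hmin⟩ := hB.exists_isMinOn ⟨0, Metric.mem_closedBall_self hR.le⟩
    hF.norm.continuousOn
  set m := ‖F x₀‖
  have hm : 0 < m := norm_pos_iff.2 (hne x₀ (by simpa using hx₀))
  -- The perturbation (m / 3R) x contributes m R / 3 on the sphere, more than the approximation
  -- error m R / 4. At a zero of the perturbed field, ‖F x‖ ≤ m/4 + m/3 < m, against the minimality
  -- of m.
  obtain ⟨P, hP, hPF, -⟩ := hF.exists_contDiff_approx 1 (continuous_const (y := m / 4))
    (fun _ => by positivity)
  obtain ⟨x, hx, hx0⟩ := exists_zero_of_contDiff_of_inner_pos hR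
    (G := fun x => P x + (m / (3 * R)) • x) (hP.add (contDiff_id.const_smul _)) (by
      intro x hx
      have h1 : inner ℝ (P x - F x) x ≥ -(m / 4 * R) := by
        have h2 := abs_real_inner_le_norm (P x - F x) x
        have h3 := (hPF x).le
        rw [dist_eq_norm] at h3
        have h4 := (abs_le.1 h2).1
        rw [hx] at h4
        nlinarith
      rw [inner_sub_left] at h1
      rw [inner_add_left, real_inner_smul_left, real_inner_self_eq_norm_sq, hx]
      have h5 : m / (3 * R) * R ^ 2 = m / 3 * R := by field_simp
      rw [h5]
      nlinarith [hpos x hx, mul_pos hm hR])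
  have h1 : m ≤ ‖F x‖ := hmin (by simpa using hx)
  have h2 := (hPF x).le
  rw [dist_eq_norm, norm_sub_rev] at h2
  have h3 : ‖F x‖ ≤ ‖F x - P x‖ + ‖P x‖ := by
    simpa using norm_add_le (F x - P x) (P x)
  have h4 : ‖P x‖ ≤ m / 3 := by
    rw [eq_neg_of_add_eq_zero_left hx0, norm_neg, norm_smul, Real.norm_eq_abs,
      abs_of_pos (by positivity)]
    calc m / (3 * R) * ‖x‖ ≤ m / (3 * R) * R := by gcongr
      _ = m / 3 := by field_simp
  linarith

end Retraction

/-! ### Connectedness of a planar domain deprived of finitely many points. -/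

theorem isPreconnected_ball_diff_center {E : Type*} [NormedAddCommGroup E] [InnerProductSpace ℝ E]
    (hE : 1 < Module.rank ℝ E) (x : E) {r : ℝ} (hr : 0 < r) :
    IsPreconnected (Metric.ball x r \ {x}) := by
  have h := (isConnected_compl_singleton_of_one_lt_rank hE (0 : E)).isPreconnected.image
    (OpenPartialHomeomorph.univBall x r) (OpenPartialHomeomorph.continuous_univBall x r).continuousOn
  convert h using 1
  ext y
  constructor
  · rintro ⟨hy, hyx⟩
    have hy' : y ∈ (OpenPartialHomeomorph.univBall x r).target := by
      rwa [OpenPartialHomeomorph.univBall_target x hr]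
    refine ⟨(OpenPartialHomeomorph.univBall x r).symm y, ?_,
      (OpenPartialHomeomorph.univBall x r).right_inv hy'⟩
    intro h0
    apply hyx
    rw [mem_singleton_iff] at h0 ⊢
    rw [← (OpenPartialHomeomorph.univBall x r).right_inv hy', h0,
      OpenPartialHomeomorph.univBall_apply_zero]
  · rintro ⟨z, hz, rfl⟩
    have hsrc : ∀ z, z ∈ (OpenPartialHomeomorph.univBall x r).source := fun z => by simp
    refine ⟨?_, ?_⟩
    · rw [← OpenPartialHomeomorph.univBall_target x hr]
      exact (OpenPartialHomeomorph.univBall x r).map_source (hsrc z)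
    · intro h0
      rw [mem_singleton_iff] at h0
      apply hz
      rw [mem_singleton_iff]
      refine (OpenPartialHomeomorph.univBall x r).injOn (hsrc _) (hsrc _) ?_
      rw [h0, OpenPartialHomeomorph.univBall_apply_zero]

/-- A small punctured ball around x is connected, so it lies in one of the two pieces of a
separation of U \ {x}. Returning x to that piece would separate U itself. -/
theorem IsPreconnected.diff_singleton_of_isOpen {E : Type*} [NormedAddCommGroup E]
    [InnerProductSpace ℝ E] (hE : 1 < Module.rank ℝ E) {U : Set E} (hU : IsOpen U)
    (hc : IsPreconnected U) (x : E) : IsPreconnected (U \ {x}) := by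
  by_cases hx : x ∈ U
  swap
  · rwa [sdiff_singleton_eq_self hx]
  obtain ⟨r, hr, hball⟩ := Metric.isOpen_iff.1 hU x hx
  have hP := isPreconnected_ball_diff_center hE x hr
  have hPU : Metric.ball x r \ {x} ⊆ U \ {x} := sdiff_subset_sdiff_left hball
  have key : ∀ u v : Set E, IsOpen u → IsOpen v → U \ {x} ⊆ u ∪ v → U \ {x} ∩ (u ∩ v) = ∅ →
      Metric.ball x r \ {x} ⊆ u → U \ {x} ⊆ u := by
    intro u v hu hv huv hdisj hPu
    have hsub := isPreconnected_iff_subset_of_disjoint.1 hc (u ∪ Metric.ball x r) (v \ {x})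
      (hu.union Metric.isOpen_ball) (hv.sdiff isClosed_singleton) (by
        intro y hy
        by_cases hyx : y = x
        · exact Or.inl (Or.inr (hyx ▸ Metric.mem_ball_self hr))
        · rcases huv ⟨hy, hyx⟩ with h | h
          · exact Or.inl (Or.inl h)
          · exact Or.inr ⟨h, hyx⟩) (by
        rw [eq_empty_iff_forall_notMem]
        rintro y ⟨hy, h1, h2, h3⟩
        have hyu : y ∈ u := by
          rcases h1 with h | h
          · exact h
          · exact hPu ⟨h, h3⟩
        exact (eq_empty_iff_forall_notMem.1 hdisj y) ⟨⟨hy, h3⟩, hyu, h2⟩)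
    rcases hsub with h | h
    · rintro y ⟨hy, hyx⟩
      rcases h hy with h1 | h1
      · exact h1
      · exact hPu ⟨h1, hyx⟩
    · exact absurd rfl (h hx).2
  rw [isPreconnected_iff_subset_of_disjoint]
  intro u v hu hv huv hdisj
  rcases isPreconnected_iff_subset_of_disjoint.1 hP u v hu hv (hPU.trans huv)
    (subset_empty_iff.1 (hdisj ▸ inter_subset_inter_left _ hPU)) with h | h
  · exact Or.inl (key u v hu hv huv hdisj h)
  · exact Or.inr (key v u hv hu (by rwa [union_comm]) (by rwa [inter_comm v u]) h)

theorem IsPreconnected.diff_finite_of_isOpen {E : Type*} [NormedAddCommGroup E]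
    [InnerProductSpace ℝ E] (hE : 1 < Module.rank ℝ E) {U : Set E} (hU : IsOpen U)
    (hc : IsPreconnected U) {s : Set E} (hs : s.Finite) : IsPreconnected (U \ s) := by
  induction s, hs using Set.Finite.induction_on with
  | empty => simpa
  | insert _ hs ih =>
    rename_i a s _
    have : U \ insert a s = (U \ s) \ {a} := by
      ext y; simp only [Set.mem_sdiff, mem_insert_iff, mem_singleton_iff]; tauto
    rw [this]
    exact ih.diff_singleton_of_isOpen hE (hU.sdiff hs.isClosed) a

theorem one_lt_rank_plane : 1 < Module.rank ℝ Plane := by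
  rw [← Module.finrank_eq_rank]
  simp

/-! ### Connectivity of the primal and dual meshes. -/

namespace DDFVMesh

variable {Cell IEdge BEdge Vert : Type*} (T : DDFVMesh Cell IEdge BEdge Vert)

/-- The edge `e` is a side of the primal cell `K`. -/
def IsSide (K : Cell) (e : IEdge ⊕ BEdge) : Prop :=
  T.left e = K ∨ ∃ i, e = Sum.inl i ∧ T.right i = K

theorem segment_eq_of_sym2_eq {a b c d : Plane} (h : s(a, b) = s(c, d)) :
    segment ℝ a b = segment ℝ c d := by
  rcases Sym2.eq_iff.1 h with ⟨rfl, rfl⟩ | ⟨rfl, rfl⟩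
  · rfl
  · exact segment_symm ℝ _ _

theorem exists_side_of_mem_frontier_cell {K : Cell} {x : Plane} (hx : x ∈ frontier (T.cell K))
    (hv : x ∉ range T.vertex) :
    ∃ e, T.IsSide K e ∧ x ∈ openSegment ℝ (T.vertex (T.tail e)) (T.vertex (T.head e)) := by
  obtain ⟨-, -, -, n, -, c, -, hsides, -, hfr⟩ := T.cell_polygon K
  rw [hfr, mem_iUnion] at hx
  obtain ⟨i, hi⟩ := hx
  have hmem : s(c i, c (i + 1)) ∈ range fun i => s(c i, c (i + 1)) := mem_range_self i
  rw [← hsides] at hmem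
  obtain ⟨e, he, hz⟩ := hmem
  rw [segment_eq_of_sym2_eq hz] at hi
  exact ⟨e, he, mem_openSegment_of_ne_left_right (fun h => hv ⟨_, h⟩) (fun h => hv ⟨_, h⟩) hi⟩

theorem eq_of_mem_openSegment {e e' : IEdge ⊕ BEdge} {x : Plane}
    (h : x ∈ openSegment ℝ (T.vertex (T.tail e)) (T.vertex (T.head e)))
    (h' : x ∈ openSegment ℝ (T.vertex (T.tail e')) (T.vertex (T.head e'))) : e = e' := by
  by_contra hne
  exact disjoint_left.1 (T.edge_disjoint e e' hne) h (openSegment_subset_segment ℝ _ _ h')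

theorem cell_nonempty (K : Cell) : (T.cell K).Nonempty := (T.cell_polygon K).2.1.nonempty

theorem isOpen_cell (K : Cell) : IsOpen (T.cell K) := (T.cell_polygon K).1

theorem mem_frontier_cell_of_mem_closure {K L : Cell} (hKL : K ≠ L) {x : Plane}
    (hK : x ∈ closure (T.cell K)) (hL : x ∈ closure (T.cell L)) : x ∈ frontier (T.cell K) := by
  rw [(T.isOpen_cell K).frontier_eq]
  refine ⟨hK, fun hx => ?_⟩
  obtain ⟨y, hy1, hy2⟩ := mem_closure_iff.1 hL _ (T.isOpen_cell K) hx
  exact disjoint_left.1 (T.cell_disjoint K L hKL) hy1 hy2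

/-- Ω without the vertices is connected and is covered by two closed sets: the closed cells carrying
the value w K, and the others. If both sets occur they meet at a point that is not a vertex. This
point is interior to a side of a cell of each kind, and edges are disjoint, so the two cells share
that edge and w agrees on them. -/
theorem eq_of_forall_left_eq_right [Finite Cell] [Finite Vert] (w : Cell → ℝ)
    (hw : ∀ i, w (T.left (Sum.inl i)) = w (T.right i)) (K L : Cell) : w L = w K := by
  by_contra hne
  have hfin : (range T.vertex).Finite := finite_range _
  have hW := T.isConnected_Ω.isPreconnected.diff_finite_of_isOpen one_lt_rank_plane
    T.isOpen_Ω hfin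
  have hpt : ∀ K, ∃ x ∈ T.cell K, x ∉ range T.vertex := fun K =>
    (hfin.countable.dense_compl ℝ).inter_open_nonempty _ (T.isOpen_cell K) (T.cell_nonempty K)
  have hclosed : ∀ p : Cell → Prop, IsClosed (⋃ M ∈ {M | p M}, closure (T.cell M)) := fun p =>
    (toFinite _).isClosed_biUnion fun _ _ => isClosed_closure
  obtain ⟨x, ⟨hxΩ, hxv⟩, hxA, hxB⟩ := isPreconnected_closed_iff.1 hW _ _
    (hclosed fun M => w M = w K) (hclosed fun M => w M ≠ w K)
    (by
      rintro x ⟨hx, -⟩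
      have h1 := subset_closure hx
      rw [← T.iUnion_closure_cell, mem_iUnion] at h1
      obtain ⟨M, hM⟩ := h1
      by_cases h : w M = w K
      · exact Or.inl (mem_biUnion (show M ∈ {M | w M = w K} from h) hM)
      · exact Or.inr (mem_biUnion (show M ∈ {M | w M ≠ w K} from h) hM))
    (by
      obtain ⟨x, hx, hxv⟩ := hpt K
      exact ⟨x, ⟨T.cell_subset K hx, hxv⟩,
        mem_biUnion (show K ∈ {M | w M = w K} from rfl) (subset_closure hx)⟩)
    (by
      obtain ⟨x, hx, hxv⟩ := hpt L
      exact ⟨x, ⟨T.cell_subset L hx, hxv⟩,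
        mem_biUnion (show L ∈ {M | w M ≠ w K} from hne) (subset_closure hx)⟩)
  simp only [mem_iUnion, exists_prop] at hxA hxB
  obtain ⟨A, hA, hxA⟩ := hxA
  obtain ⟨B, hB, hxB⟩ := hxB
  replace hA : w A = w K := hA
  replace hB : w B ≠ w K := hB
  have hAB : A ≠ B := fun h => hB (h ▸ hA)
  obtain ⟨e, he, hxe⟩ := T.exists_side_of_mem_frontier_cell
    (T.mem_frontier_cell_of_mem_closure hAB hxA hxB) hxv
  obtain ⟨e', he', hxe'⟩ := T.exists_side_of_mem_frontier_cell
    (T.mem_frontier_cell_of_mem_closure hAB.symm hxB hxA) hxv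
  obtain rfl := T.eq_of_mem_openSegment hxe hxe'
  rcases he with he | ⟨i, rfl, he⟩ <;> rcases he' with he' | ⟨j, hj, he'⟩
  · exact hAB (he.symm.trans he')
  · subst hj
    exact hB (by rw [← he', ← hw, he, hA])
  · exact hB (by rw [← he', hw, he, hA])
  · exact hAB (by rw [← he, ← he', Sum.inl.inj hj])

theorem exists_edge_of_vert (v : Vert) : ∃ e, T.tail e = v ∨ T.head e = v := by
  obtain ⟨-, -, -, n, -, c, -, hsides, -⟩ := T.dualCell_polygon v
  have hmem : s(c 0, c (0 + 1)) ∈ range fun i => s(c i, c (i + 1)) := mem_range_self 0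
  rw [← hsides] at hmem
  rcases hmem with ⟨e, he, -⟩ | ⟨b, hb, -⟩
  exacts [⟨e, he⟩, ⟨_, hb⟩]

/-- The corners of the polygon are visited one after the other; each side keeps the value of u,
since its two end points are joined by an edge. -/
theorem exists_value_on_sides (u : Vert → ℝ) (hu : ∀ e, u (T.head e) = u (T.tail e)) (K : Cell) :
    ∃ r, ∀ e, T.IsSide K e → u (T.tail e) = r := by
  obtain ⟨-, -, -, n, hn, c, -, hsides, -⟩ := T.cell_polygon K
  have : NeZero n := ⟨by omega⟩
  have hstep : ∀ i, ∃ e, s(c i, c (i + 1)) = s(T.vertex (T.tail e), T.vertex (T.head e)) := by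
    intro i
    have hmem : s(c i, c (i + 1)) ∈ range fun i => s(c i, c (i + 1)) := mem_range_self i
    rw [← hsides] at hmem
    obtain ⟨e, -, hz⟩ := hmem
    exact ⟨e, hz⟩
  obtain ⟨v₀, hv₀⟩ : ∃ v₀, T.vertex v₀ = c 0 := by
    obtain ⟨e, he⟩ := hstep 0
    rcases Sym2.eq_iff.1 he with ⟨h, -⟩ | ⟨h, -⟩ <;> exact ⟨_, h.symm⟩
  have hall : ∀ k : ℕ, ∃ v, T.vertex v = c k ∧ u v = u v₀ := by
    intro k
    induction k with
    | zero => exact ⟨v₀, by simpa using hv₀, rfl⟩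
    | succ k ih =>
      obtain ⟨v, hv, hvu⟩ := ih
      obtain ⟨e, he⟩ := hstep k
      push_cast
      rcases Sym2.eq_iff.1 he with ⟨h, h'⟩ | ⟨h, h'⟩
      · have := T.vertex_injective (hv.trans h)
        exact ⟨T.head e, h'.symm, by rw [hu, ← this, hvu]⟩
      · have := T.vertex_injective (hv.trans h)
        exact ⟨T.tail e, h'.symm, by rw [← hu, ← this, hvu]⟩
  refine ⟨u v₀, fun e he => ?_⟩
  have hmem : s(T.vertex (T.tail e), T.vertex (T.head e)) ∈ range fun i => s(c i, c (i + 1)) := by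
    rw [← hsides]
    exact ⟨e, he, rfl⟩
  obtain ⟨i, hi⟩ := hmem
  obtain ⟨k, rfl⟩ := ZMod.natCast_zmod_surjective i
  obtain ⟨v, hv, hvu⟩ := hall k
  rcases Sym2.eq_iff.1 hi with ⟨h, -⟩ | ⟨h, -⟩
  · rw [← T.vertex_injective (hv.trans h), hvu]
  · rw [← hu, ← T.vertex_injective (hv.trans h), hvu]

/-- The common value of u around a cell defines a function on cells that agrees across interior
edges, which reduces the dual statement to the primal one. -/
theorem eq_of_forall_tail_eq_head [Finite Cell] [Finite Vert] (u : Vert → ℝ)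
    (hu : ∀ e, u (T.head e) = u (T.tail e)) (v v' : Vert) : u v = u v' := by
  choose w hw using T.exists_value_on_sides u hu
  have hconst := T.eq_of_forall_left_eq_right w fun i => by
    rw [← hw _ (Sum.inl i) (Or.inl rfl), ← hw _ (Sum.inl i) (Or.inr ⟨i, rfl, rfl⟩)]
  have key : ∀ v, ∃ K, u v = w K := by
    intro v
    obtain ⟨e, he⟩ := T.exists_edge_of_vert v
    refine ⟨T.left e, ?_⟩
    rw [← hw _ e (Or.inl rfl)]
    rcases he with rfl | rfl
    exacts [rfl, hu e]
  obtain ⟨K, hK⟩ := key v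
  obtain ⟨L, hL⟩ := key v'
  rw [hK, hL, hconst L K]

theorem edgeVec_ne_zero (e : IEdge ⊕ BEdge) : T.edgeVec e ≠ 0 := by
  intro h
  have := T.center_left e
  rw [edgeVec] at h
  rw [h] at this
  simp [cross] at this

theorem vertex_notMem_openSegment (e : IEdge ⊕ BEdge) (v : Vert) :
    T.vertex v ∉ openSegment ℝ (T.vertex (T.tail e)) (T.vertex (T.head e)) := by
  intro hv
  have hne : T.vertex (T.tail e) ≠ T.vertex (T.head e) := fun h =>
    T.edgeVec_ne_zero e (sub_eq_zero.2 h.symm)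
  obtain ⟨e', he'⟩ := T.exists_edge_of_vert v
  by_cases h : e = e'
  · subst h
    rcases he' with rfl | rfl
    · exact hne (left_mem_openSegment_iff.1 hv)
    · exact hne (right_mem_openSegment_iff.1 hv)
  · refine disjoint_left.1 (T.edge_disjoint e e' h) hv ?_
    rcases he' with rfl | rfl
    exacts [left_mem_segment ℝ _ _, right_mem_segment ℝ _ _]

/-- A set of positive length is not contained in the finitely many vertices, so some boundary edge
contains a Dirichlet point in its interior. The open edge is connected and covered by the closed
sets `ΓDir` and `ΓN`, which meet only at vertices; so it lies in `ΓDir`, and so do its end points.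
-/
theorem exists_dirichlet_edge [Finite BEdge] [Finite Vert] :
    ∃ b, T.IsDir (Sum.inl (Sum.inr b)) ∧ T.IsDir (Sum.inr (T.tail (Sum.inr b))) := by
  have hnot : ¬ T.ΓDir ⊆ range T.vertex := by
    intro h
    have h0 : Measure.hausdorffMeasure (X := Plane) 1 T.ΓDir = 0 := by
      have := Measure.nullSingletonClass_hausdorff Plane (d := 1) one_pos
      exact ((finite_range T.vertex).subset h).measure_zero _
    exact T.ΓDir_pos.ne' h0
  obtain ⟨x, hxD, hxv⟩ := not_subset.1 hnot
  have hxF : x ∈ frontier T.Ω := T.ΓDir_union_ΓN ▸ Or.inl hxD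
  rw [T.boundary_edge, mem_iUnion] at hxF
  obtain ⟨b, hb⟩ := hxF
  have hxb : x ∈ openSegment ℝ (T.vertex (T.tail (Sum.inr b))) (T.vertex (T.head (Sum.inr b))) :=
    mem_openSegment_of_ne_left_right (fun h => hxv ⟨_, h⟩) (fun h => hxv ⟨_, h⟩) hb
  have hsub : openSegment ℝ (T.vertex (T.tail (Sum.inr b))) (T.vertex (T.head (Sum.inr b))) ⊆
      T.ΓDir := by
    have hpre : IsPreconnected
        (openSegment ℝ (T.vertex (T.tail (Sum.inr b))) (T.vertex (T.head (Sum.inr b)))) :=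
      (convex_openSegment _ _).isPreconnected
    refine (isPreconnected_iff_subset_of_disjoint_closed.1 hpre T.ΓDir T.ΓN
      T.isClosed_ΓDir T.isClosed_ΓN ?_ ?_).resolve_right ?_
    · rw [T.ΓDir_union_ΓN, T.boundary_edge]
      exact (openSegment_subset_segment ℝ _ _).trans (subset_iUnion_of_subset b subset_rfl)
    · rw [eq_empty_iff_forall_notMem]
      rintro y ⟨hy, hy2⟩
      obtain ⟨v, rfl⟩ := T.ΓDir_inter_ΓN hy2
      exact T.vertex_notMem_openSegment _ v hy
    · intro h
      exact hxv (T.ΓDir_inter_ΓN ⟨hxD, h hxb⟩)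
  refine ⟨b, hsub (T.center_boundary b), ?_⟩
  refine (T.isClosed_ΓDir.closure_subset_iff.2 hsub) ?_
  rw [closure_openSegment]
  exact left_mem_segment ℝ _ _

/-- The primal and dual unknowns form two separate connected graphs, and each one must be anchored.
The edge of `exists_dirichlet_edge` anchors both. This is the kernel statement behind the discrete
Poincaré inequality and behind the maximum principle. -/
theorem eq_zero_of_forall_edge [Finite Cell] [Finite BEdge] [Finite Vert] (u : T.Dof → ℝ)
    (hp : ∀ e, u (T.tgt (e, true)) = u (T.src (e, true)))
    (hd : ∀ e, u (T.dtgt (e, true)) = u (T.dsrc (e, true)))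
    (h0 : ∀ A, T.IsDir A → u A = 0) (A : T.Dof) : u A = 0 := by
  obtain ⟨b, hb, hbv⟩ := T.exists_dirichlet_edge
  have hcell : ∀ K, u (Sum.inl (Sum.inl K)) = 0 := by
    intro K
    rw [T.eq_of_forall_left_eq_right (fun K => u (Sum.inl (Sum.inl K)))
      (fun i => (hp (Sum.inl i)).symm) (T.left (Sum.inr b)) K]
    exact (hp (Sum.inr b)).symm.trans (h0 _ hb)
  rcases A with (K | b') | v
  · exact hcell K
  · exact (hp (Sum.inr b')).trans (hcell _)
  · rw [T.eq_of_forall_tail_eq_head (fun v => u (Sum.inr v)) hd v (T.tail (Sum.inr b))]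
    exact h0 _ hbv

end DDFVMesh

/-! ### Geometry of diamonds and positivity of the transmissibilities. -/

theorem inner_plane (x y : Plane) : inner ℝ x y = x 0 * y 0 + x 1 * y 1 := by
  simp [PiLp.inner_apply, Fin.sum_univ_two, mul_comm]

theorem norm_sq_plane (x : Plane) : ‖x‖ ^ 2 = x 0 ^ 2 + x 1 ^ 2 := by
  rw [← real_inner_self_eq_norm_sq, inner_plane]; ring

theorem sin_angle_mul_norm_mul_norm_eq_abs_cross (x y : Plane) :
    Real.sin (InnerProductGeometry.angle x y) * (‖x‖ * ‖y‖) = |cross x y| := by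
  rw [InnerProductGeometry.sin_angle_mul_norm_mul_norm, ← Real.sqrt_sq_eq_abs]
  congr 1
  rw [inner_plane, inner_plane, inner_plane, cross]
  ring

theorem matForm_eq (A : Matrix (Fin 2) (Fin 2) ℝ) (u v : Plane) :
    matForm A u v = A 0 0 * u 0 * v 0 + A 0 1 * u 1 * v 0 + A 1 0 * u 0 * v 1
      + A 1 1 * u 1 * v 1 := by
  simp [matForm, Fin.sum_univ_two]
  ring

/-- Strict Cauchy–Schwarz by Lagrange's identity: the defect is det A · (u × v)². -/
theorem matForm_sq_lt_of_cross_ne_zero {A : Matrix (Fin 2) (Fin 2) ℝ} (hA : A 0 1 = A 1 0)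
    {l : ℝ} (hl : 0 < l) (hpos : ∀ v : Plane, l * ‖v‖ ^ 2 ≤ matForm A v v) {u v : Plane}
    (huv : cross u v ≠ 0) : matForm A u v ^ 2 < matForm A u u * matForm A v v := by
  have h0 : 0 < A 0 0 := by
    have := hpos !₂[1, 0]
    rw [matForm_eq, norm_sq_plane] at this
    simp at this
    linarith
  -- The test vector (-A₁₀, A₀₀) gives the quadratic form the value A₀₀ det A.
  have h1 : 0 < A 0 0 * (A 0 0 * A 1 1 - A 1 0 ^ 2) := by
    have := hpos !₂[-A 1 0, A 0 0]
    rw [matForm_eq, norm_sq_plane, hA] at this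
    simp at this
    have h3 : 0 < l * (A 1 0 ^ 2 + A 0 0 ^ 2) := by positivity
    nlinarith
  have h2 := pos_of_mul_pos_right h1 h0.le
  have h4 : matForm A u u * matForm A v v - matForm A u v ^ 2 =
      (A 0 0 * A 1 1 - A 1 0 ^ 2) * cross u v ^ 2 := by
    rw [matForm_eq, matForm_eq, matForm_eq, cross, hA]; ring
  have h5 : 0 < (A 0 0 * A 1 1 - A 1 0 ^ 2) * cross u v ^ 2 := by positivity
  linarith

theorem volume_segment_plane (a b : Plane) : volume (segment ℝ a b) = 0 := by
  have hne : (affineSpan ℝ {a, b} : AffineSubspace ℝ Plane) ≠ ⊤ := by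
    intro h
    have h1 := (AffineSubspace.direction_top ℝ Plane Plane)
    rw [← h, direction_affineSpan] at h1
    have h2 : Module.finrank ℝ (vectorSpan ℝ ({a, b} : Set Plane)) ≤ 1 :=
      collinear_iff_finrank_le_one.1 (collinear_pair ℝ a b)
    rw [h1, finrank_top] at h2
    simp at h2
  refine measure_mono_null ?_ (Measure.addHaar_affineSubspace volume _ hne)
  rw [segment_eq_image_lineMap]
  rintro _ ⟨t, -, rfl⟩
  exact AffineMap.lineMap_mem_affineSpan_pair t a b

theorem volume_triangle_pos {a b c : Plane} (h : cross (c - b) (a - b) ≠ 0) :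
    0 < volume (convexHull ℝ {a, b, c}) := by
  have hspan : affineSpan ℝ ({a, b, c} : Set Plane) = ⊤ := by
    rw [eq_top_iff]
    intro p _
    set S := affineSpan ℝ ({a, b, c} : Set Plane)
    have ha : a ∈ S := subset_affineSpan ℝ _ (by simp)
    have hb : b ∈ S := subset_affineSpan ℝ _ (by simp)
    have hc : c ∈ S := subset_affineSpan ℝ _ (by simp)
    set d := cross (c - b) (a - b) with hd
    -- Cramer's rule: these are the coordinates of p - b in the basis (c - b, a - b).
    have h1 : (cross (c - b) (p - b) / d) • (a - b) + b ∈ S := S.smul_vsub_vadd_mem _ ha hb hb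
    have h2 : (cross (p - b) (a - b) / d) • (c - b) + ((cross (c - b) (p - b) / d) • (a - b) + b)
      ∈ S := S.smul_vsub_vadd_mem _ hc hb h1
    convert h2 using 1
    ext i
    simp only [PiLp.add_apply, PiLp.smul_apply, PiLp.sub_apply, smul_eq_mul]
    field_simp
    rw [hd]
    fin_cases i <;> simp [cross] <;> ring
  have hint := interior_convexHull_nonempty_iff_affineSpan_eq_top.2 hspan
  exact (isOpen_interior.measure_pos volume hint).trans_le (measure_mono interior_subset)

namespace DDFVMesh

variable {Cell IEdge BEdge Vert : Type*} (T : DDFVMesh Cell IEdge BEdge Vert)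

theorem volume_frontier_eq_zero [Finite BEdge] : volume (frontier T.Ω) = 0 := by
  rw [T.boundary_edge]
  exact measure_iUnion_null fun b => volume_segment_plane _ _

/-- Diamonds may touch the boundary, whereas the data are controlled a.e. in Ω only; the boundary, a
finite union of segments, is negligible. -/
theorem restrict_closure_eq [Finite BEdge] :
    volume.restrict (closure T.Ω) = volume.restrict T.Ω := by
  refine Measure.restrict_congr_set ?_
  rw [closure_eq_self_union_frontier]
  exact union_ae_eq_left_of_ae_eq_empty (ae_eq_empty.2 T.volume_frontier_eq_zero)

/-- The left center is strictly to the left of the edge and the other one is to its right or on it,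
so the dual edge crosses transversally. The positivity of the lengths of dual edges and of
`sinAngle` comes from here. -/
theorem cross_edgeVec_dualVec_neg (e : IEdge ⊕ BEdge) :
    cross (T.edgeVec e) (T.dualVec e) < 0 := by
  have h1 := T.center_left e
  have h2 : cross (T.vertex (T.head e) - T.vertex (T.tail e))
      (T.center (Sum.map T.right id e) - T.vertex (T.tail e)) ≤ 0 := by
    rcases e with i | b
    · exact (T.center_right i).le
    · obtain ⟨s, t, -, -, hst, hx⟩ := T.center_boundary b
      have : T.center (Sum.map T.right id (Sum.inr b)) = T.center (Sum.inr b) := rfl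
      rw [this, ← hx, ← eq_sub_iff_add_eq'.2 hst |>.symm]
      simp only [cross, PiLp.sub_apply, PiLp.add_apply, PiLp.smul_apply, smul_eq_mul]
      apply le_of_eq
      ring
  have h3 : cross (T.edgeVec e) (T.dualVec e) =
      cross (T.vertex (T.head e) - T.vertex (T.tail e))
        (T.center (Sum.map T.right id e) - T.vertex (T.tail e)) -
      cross (T.vertex (T.head e) - T.vertex (T.tail e))
        (T.center (Sum.inl (T.left e)) - T.vertex (T.tail e)) := by
    simp only [cross, edgeVec, dualVec, PiLp.sub_apply]
    ring
  linarith

theorem dualVec_ne_zero (e : IEdge ⊕ BEdge) : T.dualVec e ≠ 0 := by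
  intro h
  have := T.cross_edgeVec_dualVec_neg e
  rw [h] at this
  simp [cross] at this

theorem mEdge_pos (e : IEdge ⊕ BEdge) : 0 < T.mEdge e := norm_pos_iff.2 (T.edgeVec_ne_zero e)

theorem mDual_pos (e : IEdge ⊕ BEdge) : 0 < T.mDual e := norm_pos_iff.2 (T.dualVec_ne_zero e)

theorem sinAngle_pos (e : IEdge ⊕ BEdge) : 0 < T.sinAngle e := by
  have h := sin_angle_mul_norm_mul_norm_eq_abs_cross (T.dualVec e) (T.edgeVec e)
  have h1 : cross (T.dualVec e) (T.edgeVec e) = - cross (T.edgeVec e) (T.dualVec e) := by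
    simp only [cross]; ring
  have h2 : 0 < |cross (T.dualVec e) (T.edgeVec e)| := by
    rw [h1, abs_neg]
    exact abs_pos.2 (T.cross_edgeVec_dualVec_neg e).ne
  rw [← h] at h2
  exact pos_of_mul_pos_left h2 (mul_pos (T.mDual_pos e) (T.mEdge_pos e)).le

theorem cross_nEdge_nDual_ne_zero (e : IEdge ⊕ BEdge) : cross (T.nEdge e) (T.nDual e) ≠ 0 := by
  have h : cross (T.nEdge e) (T.nDual e) =
      -((T.mEdge e)⁻¹ * (T.mDual e)⁻¹ * cross (T.edgeVec e) (T.dualVec e)) := by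
    simp only [cross, nEdge, nDual, perp, PiLp.smul_apply, PiLp.neg_apply, smul_eq_mul]
    simp
    ring
  rw [h]
  have := T.cross_edgeVec_dualVec_neg e
  have := T.mEdge_pos e
  have := T.mDual_pos e
  exact neg_ne_zero.2 (mul_ne_zero (by positivity) (by linarith))

theorem isCompact_diamond (e : IEdge ⊕ BEdge) : IsCompact (T.diamond e) :=
  ((Set.toFinite _).isCompact_convexHull ℝ).union ((Set.toFinite _).isCompact_convexHull ℝ)

theorem diamond_subset (e : IEdge ⊕ BEdge) : T.diamond e ⊆ closure T.Ω := by
  refine union_subset (T.diamond_left_subset e) ?_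
  rcases e with i | b
  · exact T.diamond_right_subset i
  · have h : T.center (Sum.map T.right id (Sum.inr b)) = T.center (Sum.inr b) := rfl
    have hsub : segment ℝ (T.vertex (T.tail (Sum.inr b))) (T.vertex (T.head (Sum.inr b))) ⊆
        closure T.Ω := by
      refine Subset.trans ?_ frontier_subset_closure
      rw [T.boundary_edge]
      exact subset_iUnion_of_subset b subset_rfl
    refine Subset.trans (convexHull_min ?_ (convex_segment _ _)) hsub
    rw [h]
    rintro x (rfl | rfl | rfl)
    exacts [openSegment_subset_segment ℝ _ _ (T.center_boundary b), left_mem_segment ℝ _ _,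
      right_mem_segment ℝ _ _]

theorem volume_diamond_pos (e : IEdge ⊕ BEdge) : 0 < volume (T.diamond e) :=
  (volume_triangle_pos (T.center_left e).ne').trans_le (measure_mono subset_union_left)

end DDFVMesh

namespace FlowData

theorem restrict_le_of_subset_closure {Cell IEdge BEdge Vert : Type*}
    (T : DDFVMesh Cell IEdge BEdge Vert) [Finite BEdge] {A : Set Plane} (hA : A ⊆ closure T.Ω) :
    volume.restrict A ≤ volume.restrict T.Ω := by
  rw [← T.restrict_closure_eq]
  exact Measure.restrict_mono_set volume hA

variable {Ω : Set Plane} (D : FlowData Ω)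

theorem meanPermeability_symm {A : Set Plane} (hA : volume.restrict A ≤ volume.restrict Ω) :
    D.meanPermeability A 0 1 = D.meanPermeability A 1 0 := by
  simp only [meanPermeability, Matrix.of_apply]
  congr 1
  refine integral_congr_ae ?_
  filter_upwards [ae_mono hA D.Λ_symm] with x hx
  exact hx.apply 1 0

/-- The ellipticity bounds at (1,0), (0,1) and (1,1) bound all entries, by polarization and
symmetry. -/
theorem integrable_permeability {A : Set Plane} (hA : volume.restrict A ≤ volume.restrict Ω)
    (hfin : volume A < ⊤) (i j : Fin 2) : IntegrableOn (fun x => D.Λ x i j) A := by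
  obtain ⟨l, hl, L, hΛ⟩ := D.Λ_elliptic
  have : IsFiniteMeasure (volume.restrict A) := ⟨by simpa using hfin⟩
  refine Integrable.of_bound ((D.Λ_measurable i j).mono_measure hA) (4 * (|L| + |l|)) ?_
  filter_upwards [ae_mono hA D.Λ_symm, ae_mono hA hΛ] with x hs hx
  have h01 := hs.apply 1 0
  have e0 := hx !₂[1, 0]
  have e1 := hx !₂[0, 1]
  have e2 := hx !₂[1, 1]
  simp only [norm_sq_plane, Fin.sum_univ_two] at e0 e1 e2
  simp at e0 e1 e2
  have := le_abs_self L
  have := le_abs_self l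
  have := neg_abs_le L
  have := neg_abs_le l
  rw [Real.norm_eq_abs, abs_le]
  fin_cases i <;> fin_cases j <;> simp <;> constructor <;> linarith [e0.1, e0.2, e1.1, e1.2, e2.1, e2.2]

theorem exists_matForm_meanPermeability_ge {A : Set Plane}
    (hA : volume.restrict A ≤ volume.restrict Ω) (hfin : volume A < ⊤) (hpos : 0 < volume A) :
    ∃ l > 0, ∀ v : Plane, l * ‖v‖ ^ 2 ≤ matForm (D.meanPermeability A) v v := by
  obtain ⟨l, hl, L, hΛ⟩ := D.Λ_elliptic
  refine ⟨l, hl, fun v => ?_⟩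
  have hm : 0 < volume.real A := ENNReal.toReal_pos hpos.ne' hfin.ne
  have hint := D.integrable_permeability hA hfin
  have h1 : matForm (D.meanPermeability A) v v =
      1 / volume.real A * ∫ x in A, ∑ i, ∑ j, D.Λ x i j * v j * v i := by
    rw [integral_finsetSum _ fun i _ => integrable_finsetSum _ fun j _ =>
      ((hint i j).mul_const _).mul_const _]
    simp_rw [matForm, Finset.mul_sum]
    refine Finset.sum_congr rfl fun i _ => ?_
    rw [integral_finsetSum _ fun j _ => ((hint i j).mul_const _).mul_const _, Finset.mul_sum]
    refine Finset.sum_congr rfl fun j _ => ?_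
    rw [integral_mul_const, integral_mul_const]
    simp only [meanPermeability, Matrix.of_apply]
    ring
  have h2 : volume.real A * (l * ‖v‖ ^ 2) ≤ ∫ x in A, ∑ i, ∑ j, D.Λ x i j * v j * v i := by
    have h3 : ∫ _ in A, l * ‖v‖ ^ 2 = volume.real A * (l * ‖v‖ ^ 2) := by
      rw [setIntegral_const, smul_eq_mul]
    rw [← h3]
    refine integral_mono_ae (integrableOn_const hfin.ne) (integrable_finsetSum _ fun i _ =>
      integrable_finsetSum _ fun j _ => ((hint i j).mul_const _).mul_const _) ?_
    filter_upwards [ae_mono hA hΛ] with x hx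
    exact (hx v).1
  rw [h1, div_mul_eq_mul_div, one_mul, le_div_iff₀ hm]
  linarith

theorem volume_mul_meanPorosity_pos {A : Set Plane} (hA : A ⊆ Ω) (hbdd : Bornology.IsBounded A)
    (ho : IsOpen A) (hne : A.Nonempty) : 0 < volume.real A * D.meanPorosity A := by
  have hfin : volume A < ⊤ := hbdd.measure_lt_top
  have hm : 0 < volume.real A := ENNReal.toReal_pos (ho.measure_pos volume hne).ne' hfin.ne
  have hle : volume.restrict A ≤ volume.restrict Ω := Measure.restrict_mono_set volume hA
  obtain ⟨φ₀, hφ₀, φ₁, hφ⟩ := D.φ_bounds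
  rw [meanPorosity, one_div, mul_inv_cancel_left₀ hm.ne']
  have hint : IntegrableOn D.φ A := by
    have : IsFiniteMeasure (volume.restrict A) := ⟨by simpa using hfin⟩
    refine Integrable.of_bound (D.φ_measurable.mono_measure hle) φ₁ ?_
    filter_upwards [ae_mono hle hφ] with x hx
    rw [Real.norm_eq_abs, abs_of_nonneg (hφ₀.le.trans hx.1)]
    exact hx.2
  have h3 : ∫ _ in A, φ₀ = volume.real A * φ₀ := by
    rw [setIntegral_const, smul_eq_mul]
  refine (mul_pos hm hφ₀).trans_le ?_
  rw [← h3]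
  refine integral_mono_ae (integrableOn_const hfin.ne) hint ?_
  filter_upwards [ae_mono hle hφ] with x hx
  exact hx.1

end FlowData

namespace DDFVMesh

variable {Cell IEdge BEdge Vert : Type*} (T : DDFVMesh Cell IEdge BEdge Vert) (D : FlowData T.Ω)
  [Finite BEdge]

theorem exists_matForm_diamond_ge (e : IEdge ⊕ BEdge) :
    ∃ l > 0, ∀ v : Plane, l * ‖v‖ ^ 2 ≤ matForm (D.meanPermeability (T.diamond e)) v v :=
  D.exists_matForm_meanPermeability_ge
    (FlowData.restrict_le_of_subset_closure T (T.diamond_subset e))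
    (T.isCompact_diamond e).measure_lt_top (T.volume_diamond_pos e)

theorem matForm_diamond_pos (e : IEdge ⊕ BEdge) {v : Plane} (hv : v ≠ 0) :
    0 < matForm (D.meanPermeability (T.diamond e)) v v := by
  obtain ⟨l, hl, h⟩ := T.exists_matForm_diamond_ge D e
  have : 0 < ‖v‖ := norm_pos_iff.2 hv
  exact (by positivity : 0 < l * ‖v‖ ^ 2).trans_le (h v)

theorem tau_pos (e : IEdge ⊕ BEdge) : 0 < T.tau D e := by
  have h1 := T.mEdge_pos e
  have h2 := T.mDual_pos e
  have h3 := T.sinAngle_pos e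
  have h4 := T.matForm_diamond_pos D e (v := T.nEdge e) fun h => by
    have := T.cross_nEdge_nDual_ne_zero e
    simp [h, cross] at this
  rw [tau]
  positivity

theorem tauDual_pos (e : IEdge ⊕ BEdge) : 0 < T.tauDual D e := by
  have h1 := T.mEdge_pos e
  have h2 := T.mDual_pos e
  have h3 := T.sinAngle_pos e
  have h4 := T.matForm_diamond_pos D e (v := T.nDual e) fun h => by
    have := T.cross_nEdge_nDual_ne_zero e
    simp [h, cross] at this
  rw [tauDual]
  positivity

/-- The length ratios cancel in the product, and the two normals are not parallel. Strictness is
what leaves some coercivity after the cross terms are absorbed. -/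
theorem etaD_sq_lt (e : IEdge ⊕ BEdge) : T.etaD D e ^ 2 < T.tau D e * T.tauDual D e := by
  have h1 := T.mEdge_pos e
  have h2 := T.mDual_pos e
  have h3 := T.sinAngle_pos e
  obtain ⟨l, hl, h⟩ := T.exists_matForm_diamond_ge D e
  have h4 := matForm_sq_lt_of_cross_ne_zero (D.meanPermeability_symm
    (FlowData.restrict_le_of_subset_closure T (T.diamond_subset e))) hl h
    (T.cross_nEdge_nDual_ne_zero e)
  have h5 : T.tau D e * T.tauDual D e =
      matForm (D.meanPermeability (T.diamond e)) (T.nEdge e) (T.nEdge e) *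
        matForm (D.meanPermeability (T.diamond e)) (T.nDual e) (T.nDual e) / T.sinAngle e ^ 2 := by
    rw [tau, tauDual]
    field_simp
  rw [h5, etaD, div_pow]
  gcongr

end DDFVMesh

/-! ### Densities and their potentials. -/

namespace FlowData

variable {Ω : Set Plane} (D : FlowData Ω)

theorem ρ_pos (α : Fin 2) (p : ℝ) : 0 < D.ρ α p := by
  obtain ⟨ρ₀, h0, ρ₁, h⟩ := D.ρ_bounds
  exact h0.trans_le (h α p).1

theorem ρ_continuous (α : Fin 2) : Continuous (D.ρ α) := (D.ρ_contDiff α).continuous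

theorem continuous_one_div_ρ (α : Fin 2) : Continuous fun z => 1 / D.ρ α z :=
  continuous_const.div (D.ρ_continuous α) fun z => (D.ρ_pos α z).ne'

/-- The primitive of `1 / ρ` that vanishes at `0`. -/
noncomputable def potential (α : Fin 2) (p : ℝ) : ℝ := ∫ z in (0 : ℝ)..p, 1 / D.ρ α z

theorem potential_zero (α : Fin 2) : D.potential α 0 = 0 := intervalIntegral.integral_same

theorem potential_sub (α : Fin 2) (a b : ℝ) :
    D.potential α b - D.potential α a = ∫ z in a..b, 1 / D.ρ α z :=
  intervalIntegral.integral_interval_sub_left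
    ((D.continuous_one_div_ρ α).intervalIntegrable _ _)
    ((D.continuous_one_div_ρ α).intervalIntegrable _ _)

/-- A formula without case distinction, from which continuity at a = b is visible. -/
theorem interfaceDensity_eq (α : Fin 2) (a b : ℝ) :
    D.interfaceDensity α a b = (∫ t in (0 : ℝ)..1, 1 / D.ρ α (a + (b - a) * t))⁻¹ := by
  unfold interfaceDensity
  congr 1
  split_ifs with h
  · simp [h]
  · have hba : b - a ≠ 0 := sub_ne_zero.2 (Ne.symm h)
    have h1 := intervalIntegral.smul_integral_comp_add_mul (fun z => 1 / D.ρ α z) (b - a) a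
      (a := 0) (b := 1)
    simp only [mul_zero, add_zero, mul_one, add_sub_cancel, smul_eq_mul] at h1
    rw [← h1]
    field_simp

theorem integral_one_div_ρ_pos (α : Fin 2) (a b : ℝ) :
    0 < ∫ t in (0 : ℝ)..1, 1 / D.ρ α (a + (b - a) * t) :=
  intervalIntegral.intervalIntegral_pos_of_pos
    (((D.continuous_one_div_ρ α).comp (by fun_prop :
      Continuous fun t => a + (b - a) * t)).intervalIntegrable _ _)
    (fun t => one_div_pos.2 (D.ρ_pos α _)) one_pos

theorem interfaceDensity_pos (α : Fin 2) (a b : ℝ) : 0 < D.interfaceDensity α a b := by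
  rw [interfaceDensity_eq]
  exact inv_pos.2 (D.integral_one_div_ρ_pos α a b)

theorem continuous_interfaceDensity (α : Fin 2) :
    Continuous fun q : ℝ × ℝ => D.interfaceDensity α q.1 q.2 := by
  simp_rw [interfaceDensity_eq]
  refine Continuous.inv₀ ?_ fun q => (D.integral_one_div_ρ_pos α _ _).ne'
  refine intervalIntegral.continuous_parametric_intervalIntegral_of_continuous' ?_ 0 1
  exact (D.continuous_one_div_ρ α).comp
    (by fun_prop : Continuous fun r : (ℝ × ℝ) × ℝ => r.1.1 + (r.1.2 - r.1.1) * r.2)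

/-- The reason for the choice of the interface density: tested with `potential`, a mass flux becomes
a volumetric flux tested with the pressure. -/
theorem interfaceDensity_mul_potential_sub (α : Fin 2) (a b : ℝ) :
    D.interfaceDensity α a b * (D.potential α b - D.potential α a) = b - a := by
  have h1 := intervalIntegral.smul_integral_comp_add_mul (fun z => 1 / D.ρ α z) (b - a) a
    (a := 0) (b := 1)
  simp only [mul_zero, add_zero, mul_one, add_sub_cancel, smul_eq_mul] at h1
  rw [potential_sub, ← h1, interfaceDensity_eq, mul_comm, mul_assoc,
    mul_inv_cancel₀ (D.integral_one_div_ρ_pos α a b).ne', mul_one]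

theorem interfaceDensity_comm (α : Fin 2) (a b : ℝ) :
    D.interfaceDensity α a b = D.interfaceDensity α b a := by
  by_cases h : a = b
  · rw [h]
  · have hba : b - a ≠ 0 := sub_ne_zero.2 (Ne.symm h)
    have h1 := D.interfaceDensity_mul_potential_sub α a b
    have h2 := D.interfaceDensity_mul_potential_sub α b a
    have h3 : D.potential α b - D.potential α a ≠ 0 := fun h0 => by
      rw [h0, mul_zero] at h1
      exact hba h1.symm
    refine mul_right_cancel₀ h3 ?_
    linarith

/-- Tangent inequality at a for `potential`, which is concave because ρ is nondecreasing. -/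
theorem ρ_mul_potential_sub_le (α : Fin 2) (a b : ℝ) :
    D.ρ α a * (D.potential α b - D.potential α a) ≤ b - a := by
  have key : ∀ a b, a ≤ b → (b - a) * (1 / D.ρ α b) ≤ D.potential α b - D.potential α a ∧
      D.potential α b - D.potential α a ≤ (b - a) * (1 / D.ρ α a) := by
    intro a b hab
    have hc : ∀ c : ℝ, ∫ _ in a..b, c = (b - a) * c := fun c => by
      rw [intervalIntegral.integral_const, smul_eq_mul]
    rw [potential_sub, ← hc, ← hc]
    constructor
    · exact intervalIntegral.integral_mono_on hab intervalIntegrable_const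
        ((D.continuous_one_div_ρ α).intervalIntegrable _ _) fun z hz =>
        one_div_le_one_div_of_le (D.ρ_pos α z) (D.ρ_monotone α hz.2)
    · exact intervalIntegral.integral_mono_on hab
        ((D.continuous_one_div_ρ α).intervalIntegrable _ _) intervalIntegrable_const fun z hz =>
        one_div_le_one_div_of_le (D.ρ_pos α a) (D.ρ_monotone α hz.1)
  have hρ := D.ρ_pos α a
  rcases le_total a b with h | h
  · have := (key a b h).2
    rw [mul_one_div, le_div_iff₀ hρ] at this
    linarith
  · have := (key b a h).1
    rw [mul_one_div, div_le_iff₀ hρ] at this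
    linarith

theorem potential_sub_bounds {ρ₀ ρ₁ : ℝ}
    (h : ∀ α p, ρ₀ ≤ D.ρ α p ∧ D.ρ α p ≤ ρ₁) (α : Fin 2) {a b : ℝ} (hab : a ≤ b) :
    (b - a) ≤ ρ₁ * (D.potential α b - D.potential α a) ∧
      ρ₀ * (D.potential α b - D.potential α a) ≤ b - a := by
  have h1 := D.ρ_mul_potential_sub_le α a b
  have h2 := D.ρ_mul_potential_sub_le α b a
  have hb := D.ρ_pos α b
  have h3 : 0 ≤ D.potential α b - D.potential α a := by
    by_contra hneg
    have h4 : D.ρ α b * (D.potential α b - D.potential α a) < 0 :=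
      mul_neg_of_pos_of_neg hb (not_le.1 hneg)
    linarith
  constructor
  · nlinarith [mul_le_mul_of_nonneg_right (h α b).2 h3]
  · nlinarith [mul_le_mul_of_nonneg_right (h α a).1 h3]

theorem potential_strictMono (α : Fin 2) : StrictMono (D.potential α) := by
  intro a b hab
  obtain ⟨ρ₀, h0, ρ₁, h⟩ := D.ρ_bounds
  have h1 := (D.potential_sub_bounds h α hab.le).1
  have h2 : 0 < ρ₁ := h0.trans_le ((h α 0).1.trans (h α 0).2)
  by_contra hle
  nlinarith [mul_nonneg h2.le (sub_nonneg.2 (not_lt.1 hle))]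

theorem potential_continuous (α : Fin 2) : Continuous (D.potential α) :=
  intervalIntegral.continuous_primitive
    (fun _ _ => (D.continuous_one_div_ρ α).intervalIntegrable _ _) 0

/-- The slope is at least 1/ρ₁. Surjectivity allows the potentials to serve as unknowns in the
existence proof. -/
theorem potential_surjective (α : Fin 2) : Function.Surjective (D.potential α) := by
  obtain ⟨ρ₀, h0, ρ₁, h⟩ := D.ρ_bounds
  have h2 : 0 < ρ₁ := h0.trans_le ((h α 0).1.trans (h α 0).2)
  refine (D.potential_continuous α).surjective ?_ ?_
  · refine tendsto_atTop_mono' _ (f₁ := fun x => x / ρ₁) ?_ (tendsto_id.atTop_div_const h2)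
    filter_upwards [eventually_ge_atTop 0] with x hx
    have := (D.potential_sub_bounds h α hx).1
    rw [potential_zero, sub_zero, sub_zero] at this
    rw [div_le_iff₀ h2]
    linarith
  · refine tendsto_atBot_mono' _ ?_ ((tendsto_id (α := ℝ)).atBot_div_const h2)
    filter_upwards [eventually_le_atBot 0] with x hx
    have := (D.potential_sub_bounds h α hx).1
    rw [potential_zero] at this
    change _ ≤ x / ρ₁
    rw [le_div_iff₀ h2]
    linarith

/-- `potential` as an order isomorphism. -/
noncomputable def potentialIso (α : Fin 2) : ℝ ≃o ℝ :=
  (D.potential_strictMono α).orderIsoOfSurjective _ (D.potential_surjective α)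

theorem potential_potentialIso_symm (α : Fin 2) (x : ℝ) :
    D.potential α ((D.potentialIso α).symm x) = x :=
  (D.potentialIso α).apply_symm_apply x

theorem exists_abs_potential_le : ∃ c > 0, ∀ α p, c * |D.potential α p| ≤ |p| := by
  obtain ⟨ρ₀, h0, ρ₁, h⟩ := D.ρ_bounds
  refine ⟨ρ₀, h0, fun α p => ?_⟩
  rcases le_total 0 p with hp | hp
  · have h1 := (D.potential_sub_bounds h α hp).2
    have h2 := (D.potential_strictMono α).monotone hp
    rw [potential_zero] at h1 h2
    rw [abs_of_nonneg h2, abs_of_nonneg hp]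
    linarith
  · have h1 := (D.potential_sub_bounds h α hp).2
    have h2 := (D.potential_strictMono α).monotone hp
    rw [potential_zero] at h1 h2
    rw [abs_of_nonpos h2, abs_of_nonpos hp]
    linarith

/-- The tangent inequality at p compared with 0 is weighted by s, the one at q compared with p by
sn. The densities disappear, except from a term that depends on the previous state only. -/
theorem accumulation_mul_potential_ge (α : Fin 2) {p q s sn : ℝ} (hs : 0 ≤ s) (hsn : 0 ≤ sn) :
    (s - sn) * p - (D.ρ α q * D.potential α q - q) * sn ≤
      (D.ρ α p * s - D.ρ α q * sn) * D.potential α p := by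
  have h1 := D.ρ_mul_potential_sub_le α p 0
  have h2 := D.ρ_mul_potential_sub_le α q p
  rw [potential_zero] at h1
  nlinarith [mul_le_mul_of_nonneg_left h1 hs, mul_le_mul_of_nonneg_left h2 hsn]

end FlowData

/-! ### Truncation, capillary pressure and global pressure. -/

theorem trunc_eq (s : ℝ) : trunc s = max 0 (min s 1) := by
  unfold trunc
  split_ifs with h1 h2
  · rw [min_eq_left (by linarith), max_eq_left h1.le]
  · rw [min_eq_left h2, max_eq_right (not_lt.1 h1)]
  · rw [min_eq_right (not_le.1 h2).le, max_eq_right zero_le_one]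

theorem continuous_trunc : Continuous trunc := by
  have : trunc = fun s => max 0 (min s 1) := funext trunc_eq
  rw [this]
  fun_prop

theorem trunc_nonneg (s : ℝ) : 0 ≤ trunc s := by
  rw [trunc_eq]; exact le_max_left _ _

theorem trunc_of_nonpos {s : ℝ} (h : s ≤ 0) : trunc s = 0 := by
  rw [trunc_eq, min_eq_left (by linarith), max_eq_left h]

theorem trunc_one_sub (s : ℝ) : trunc (1 - s) = 1 - trunc s := by
  unfold trunc
  split_ifs <;> linarith

namespace FlowData

variable {Ω : Set Plane} (D : FlowData Ω)

/-- Outside [0, 1] the truncation gives both factors the same sign; inside, `pc s` lies between 0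
and `pc 1`. -/
theorem trunc_sub_mul_pc_ge {sn : ℝ} (h0 : 0 ≤ sn) (h1 : sn ≤ 1) (s : ℝ) :
    -D.pc 1 ≤ (trunc s - sn) * D.pc s := by
  have hpc1 : 0 ≤ D.pc 1 := by
    rw [← D.pc_zero]; exact D.pc.monotone zero_le_one
  unfold trunc
  split_ifs with h2 h3
  · have : D.pc s ≤ 0 := by rw [← D.pc_zero]; exact D.pc.monotone h2.le
    nlinarith
  · have ha : 0 ≤ D.pc s := by rw [← D.pc_zero]; exact D.pc.monotone (not_lt.1 h2)
    have hb : D.pc s ≤ D.pc 1 := D.pc.monotone h3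
    nlinarith
  · have : 0 ≤ D.pc s := by rw [← D.pc_zero]; exact D.pc.monotone (not_lt.1 h2)
    nlinarith

theorem M_nonneg (α : Fin 2) (s : ℝ) : 0 ≤ D.M α s := by
  rcases le_total s 0 with h | h
  · rw [D.M_of_nonpos α s h]
  · rw [← D.M_of_nonpos α 0 le_rfl]
    exact D.M_monotone α h

theorem exists_totalMobility_ge : ∃ m₀ > 0, ∀ s, m₀ ≤ D.totalMobility s := by
  obtain ⟨m₀, hm, h⟩ := D.totalMobility_pos
  refine ⟨m₀, hm, fun s => ?_⟩
  unfold totalMobility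
  rcases lt_or_ge s 0 with hs | hs
  · have := h 0 ⟨le_rfl, zero_le_one⟩
    rw [sub_zero] at this
    rwa [D.M_of_nonpos 0 s hs.le, D.M_of_one_le 1 (1 - s) (by linarith),
      ← D.M_of_nonpos 0 0 le_rfl]
  · rcases le_or_gt s 1 with hs1 | hs1
    · exact h s ⟨hs, hs1⟩
    · have := h 1 ⟨zero_le_one, le_rfl⟩
      rw [sub_self, D.M_of_nonpos 1 0 le_rfl] at this
      rwa [D.M_of_nonpos 1 (1 - s) (by linarith), D.M_of_one_le 0 s hs1.le]

theorem totalMobility_pos' (s : ℝ) : 0 < D.totalMobility s := by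
  obtain ⟨m₀, hm, h⟩ := D.exists_totalMobility_ge
  exact hm.trans_le (h s)

theorem continuous_totalMobility : Continuous D.totalMobility :=
  ((D.M_continuous 1).comp (continuous_const.sub continuous_id)).add (D.M_continuous 0)

theorem pc_symm_continuous : Continuous D.pc.symm := D.pc.symm.continuous

theorem intervalIntegrable_deriv_pc (a b : ℝ) : IntervalIntegrable (deriv D.pc) volume a b := by
  obtain ⟨S, hS, -, -, -, C, hC⟩ := D.pc_piecewise
  rw [intervalIntegrable_iff]
  have : IsFiniteMeasure (volume.restrict (uIoc a b)) := ⟨by simp⟩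
  refine Integrable.of_bound (measurable_deriv _).aestronglyMeasurable C ?_
  refine ae_restrict_of_ae ?_
  filter_upwards [compl_mem_ae_iff.2 (hS.measure_zero volume)] with s hs
  exact hC s hs

theorem integral_deriv_pc (a b : ℝ) : ∫ u in a..b, deriv D.pc u = D.pc b - D.pc a := by
  obtain ⟨S, hS, -, hd, -⟩ := D.pc_piecewise
  exact integral_eq_of_hasDerivAt_off_countable D.pc (deriv D.pc) hS
    D.pc.continuous.continuousOn (fun x hx => (hd x hx.2).hasDerivAt)
    (D.intervalIntegrable_deriv_pc a b)

theorem deriv_pc_nonneg (s : ℝ) : 0 ≤ deriv D.pc s := D.pc.monotone.deriv_nonneg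

theorem continuous_weight (α : Fin 2) :
    Continuous fun u => ![D.M 1 (1 - u), D.M 0 u] α / D.totalMobility u := by
  refine Continuous.div ?_ D.continuous_totalMobility fun u => (D.totalMobility_pos' u).ne'
  fin_cases α
  · exact (D.M_continuous 1).comp (continuous_const.sub continuous_id)
  · exact D.M_continuous 0

theorem intervalIntegrable_weight (α : Fin 2) (a b : ℝ) :
    IntervalIntegrable (fun u => ![D.M 1 (1 - u), D.M 0 u] α / D.totalMobility u * deriv D.pc u)
      volume a b :=
  (D.intervalIntegrable_deriv_pc a b).continuousOn_mul (D.continuous_weight α).continuousOn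

/-- The two weights add up to 1. Hence the two expressions of the global pressure coincide, see
`globalPressure_eq`. -/
theorem corrective_add (s : ℝ) : D.corrective 0 s + D.corrective 1 s = D.pc s := by
  unfold corrective
  rw [← intervalIntegral.integral_add (D.intervalIntegrable_weight 0 0 s)
    (D.intervalIntegrable_weight 1 0 s)]
  have h := D.integral_deriv_pc 0 s
  rw [D.pc_zero, sub_zero] at h
  rw [← h]
  refine intervalIntegral.integral_congr fun u _ => ?_
  have := (D.totalMobility_pos' u).ne'
  simp only [Matrix.cons_val_zero, Matrix.cons_val_one]
  rw [← add_mul, ← add_div]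
  change D.totalMobility u / D.totalMobility u * deriv D.pc u = deriv D.pc u
  rw [div_self this, one_mul]

theorem continuous_corrective (α : Fin 2) : Continuous (D.corrective α) :=
  intervalIntegral.continuous_primitive (D.intervalIntegrable_weight α) 0

theorem fractionalFlow_monotone : Monotone fun u => D.M 0 u / D.totalMobility u := by
  intro a b hab
  have h1 := D.M_monotone 0 hab
  have h2 := D.M_monotone 1 (show 1 - b ≤ 1 - a by linarith)
  simp only
  rw [div_le_div_iff₀ (D.totalMobility_pos' a) (D.totalMobility_pos' b)]
  unfold totalMobility
  nlinarith [mul_le_mul h1 h2 (D.M_nonneg 1 _) (D.M_nonneg 0 _)]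

/-- The fractional flow is monotone, so its end values bound it under the integral. Exchanging a and
b reverses the inequalities and the signs of the jumps together; hence no order of a and b is
needed. -/
theorem corrective_one_sub_bounds (a b : ℝ) :
    D.M 0 a / D.totalMobility a * (D.pc b - D.pc a) ≤ D.corrective 1 b - D.corrective 1 a ∧
      D.corrective 1 b - D.corrective 1 a ≤
        D.M 0 b / D.totalMobility b * (D.pc b - D.pc a) := by
  have key : ∀ a b, a ≤ b →
      D.M 0 a / D.totalMobility a * (D.pc b - D.pc a) ≤ D.corrective 1 b - D.corrective 1 a ∧
      D.corrective 1 b - D.corrective 1 a ≤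
        D.M 0 b / D.totalMobility b * (D.pc b - D.pc a) := by
    intro a b hab
    have h : D.corrective 1 b - D.corrective 1 a =
        ∫ u in a..b, D.M 0 u / D.totalMobility u * deriv D.pc u :=
      intervalIntegral.integral_interval_sub_left (D.intervalIntegrable_weight 1 _ _)
        (D.intervalIntegrable_weight 1 _ _)
    rw [h, ← D.integral_deriv_pc a b, ← intervalIntegral.integral_const_mul,
      ← intervalIntegral.integral_const_mul]
    constructor
    · exact intervalIntegral.integral_mono_on hab
        ((D.intervalIntegrable_deriv_pc a b).const_mul _) (D.intervalIntegrable_weight 1 a b)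
        fun u hu => mul_le_mul_of_nonneg_right (D.fractionalFlow_monotone hu.1)
          (D.deriv_pc_nonneg u)
    · exact intervalIntegral.integral_mono_on hab (D.intervalIntegrable_weight 1 a b)
        ((D.intervalIntegrable_deriv_pc a b).const_mul _)
        fun u hu => mul_le_mul_of_nonneg_right (D.fractionalFlow_monotone hu.2)
          (D.deriv_pc_nonneg u)
  rcases le_total a b with h | h
  · exact key a b h
  · obtain ⟨h1, h2⟩ := key b a h
    constructor <;> linarith

theorem globalPressure_eq (α : Fin 2) (pg pw : ℝ) :
    D.globalPressure α pg pw = pw + D.corrective 1 (D.pc.symm (pg - pw)) := by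
  have h := D.corrective_add (D.pc.symm (pg - pw))
  rw [D.pc.apply_symm_apply] at h
  fin_cases α
  · simp [globalPressure, sat]
    linarith
  · simp [globalPressure, sat]

/-- Here x, y, z stand for the jumps of p_g, p_w and the global pressure, and F for the fractional
flow. For z ≥ 0 the upper bound is used, for z ≤ 0 the lower one. If x and y have the same sign,
both mobilities are taken at the end point of that bound, and convexity of the square suffices. If
the signs differ, the term of the wrong sign is dropped and the remaining phase is upwinded at the
right end. -/
theorem upwind_weighted_sq_ge {m Fa Fb ga gb wa wb x y z : ℝ} (hm : 0 < m)
    (a0 : 0 ≤ Fa) (a1 : Fa ≤ 1) (a2 : m * Fa ≤ ga) (a3 : m * (1 - Fa) ≤ wa)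
    (b0 : 0 ≤ Fb) (b1 : Fb ≤ 1) (b2 : m * Fb ≤ gb) (b3 : m * (1 - Fb) ≤ wb)
    (hl : (1 - Fa) * y + Fa * x ≤ z) (hu : z ≤ (1 - Fb) * y + Fb * x) :
    m * z ^ 2 ≤ (if 0 ≤ x then gb else ga) * x ^ 2 + (if 0 ≤ y then wb else wa) * y ^ 2 := by
  have a1' : 0 ≤ 1 - Fa := sub_nonneg.2 a1
  have b1' : 0 ≤ 1 - Fb := sub_nonneg.2 b1
  have hxx := sq_nonneg x
  have hyy := sq_nonneg y
  have hga : 0 ≤ ga := (mul_nonneg hm.le a0).trans a2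
  have hgb : 0 ≤ gb := (mul_nonneg hm.le b0).trans b2
  have hwa : 0 ≤ wa := (mul_nonneg hm.le a1').trans a3
  have hwb : 0 ≤ wb := (mul_nonneg hm.le b1').trans b3
  have conv_sq : ∀ F, 0 ≤ F → F ≤ 1 →
      ((1 - F) * y + F * x) ^ 2 ≤ (1 - F) * y ^ 2 + F * x ^ 2 := by
    intro F h0 h1
    have := mul_nonneg (mul_nonneg h0 (sub_nonneg.2 h1)) (sq_nonneg (x - y))
    linarith
  have sq_le : ∀ F t : ℝ, 0 ≤ F → F ≤ 1 → (F * t) ^ 2 ≤ F * t ^ 2 := by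
    intro F t h0 h1
    rw [mul_pow]
    exact mul_le_mul_of_nonneg_right (by rw [sq]; exact mul_le_of_le_one_left h0 h1) (sq_nonneg t)
  have both : ∀ F G W : ℝ, z ^ 2 ≤ (1 - F) * y ^ 2 + F * x ^ 2 → m * F ≤ G → m * (1 - F) ≤ W →
      m * z ^ 2 ≤ G * x ^ 2 + W * y ^ 2 := by
    intro F G W h1 h2 h3
    have e1 := mul_le_mul_of_nonneg_left h1 hm.le
    have e2 := mul_le_mul_of_nonneg_right h2 hxx
    have e3 := mul_le_mul_of_nonneg_right h3 hyy
    linarith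
  have single : ∀ F G t r W : ℝ, z ^ 2 ≤ F * t ^ 2 → m * F ≤ G → 0 ≤ W →
      m * z ^ 2 ≤ G * t ^ 2 + W * r ^ 2 := by
    intro F G t r W h1 h2 h3
    have e1 := mul_le_mul_of_nonneg_left h1 hm.le
    have e2 := mul_le_mul_of_nonneg_right h2 (sq_nonneg t)
    have e3 := mul_nonneg h3 (sq_nonneg r)
    linarith
  have sq_neg_le : ∀ t, z ≤ 0 → t ≤ z → z ^ 2 ≤ t ^ 2 := by
    intro t h1 h2
    have := pow_le_pow_left₀ (neg_nonneg.2 h1) (neg_le_neg h2) 2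
    rwa [neg_sq, neg_sq] at this
  split_ifs with h1 h2 h2
  · have hz0 : 0 ≤ z := le_trans (add_nonneg (mul_nonneg a1' h2) (mul_nonneg a0 h1)) hl
    exact both Fb _ _ ((pow_le_pow_left₀ hz0 hu 2).trans (conv_sq Fb b0 b1)) b2 b3
  · have e1 := mul_nonpos_of_nonneg_of_nonpos b1' (not_le.1 h2).le
    have e2 := mul_nonneg a0 h1
    rcases le_total 0 z with hz0 | hz0
    · exact single Fb _ x y _
        ((pow_le_pow_left₀ hz0 (by linarith) 2).trans (sq_le Fb x b0 b1)) b2 hwa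
    · rw [add_comm]
      exact single (1 - Fa) _ y x _
        ((sq_neg_le ((1 - Fa) * y) hz0 (by linarith)).trans (sq_le _ y a1' (by linarith))) a3 hgb
  · have e1 := mul_nonpos_of_nonneg_of_nonpos b0 (not_le.1 h1).le
    have e2 := mul_nonneg a1' h2
    rcases le_total 0 z with hz0 | hz0
    · rw [add_comm]
      exact single (1 - Fb) _ y x _
        ((pow_le_pow_left₀ hz0 (by linarith) 2).trans (sq_le _ y b1' (by linarith))) b3 hga
    · exact single Fa _ x y _
        ((sq_neg_le (Fa * x) hz0 (by linarith)).trans (sq_le _ x a0 a1)) a2 hwb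
  · have e1 := mul_nonpos_of_nonneg_of_nonpos b0 (not_le.1 h1).le
    have e2 := mul_nonpos_of_nonneg_of_nonpos b1' (not_le.1 h2).le
    exact both Fa _ _ ((sq_neg_le _ (by linarith) hl).trans (conv_sq Fa a0 a1)) a2 a3

theorem fractionalFlow_bounds {m₀ : ℝ} (hM : ∀ s, m₀ ≤ D.totalMobility s) (s : ℝ) :
    0 ≤ D.M 0 s / D.totalMobility s ∧ D.M 0 s / D.totalMobility s ≤ 1 ∧
      m₀ * (D.M 0 s / D.totalMobility s) ≤ D.M 0 s ∧
      m₀ * (1 - D.M 0 s / D.totalMobility s) ≤ D.M 1 (1 - s) := by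
  have hp := D.totalMobility_pos' s
  have h0 := D.M_nonneg 0 s
  have h1 := D.M_nonneg 1 (1 - s)
  have hs : D.totalMobility s = D.M 1 (1 - s) + D.M 0 s := rfl
  have e0 : D.totalMobility s * (D.M 0 s / D.totalMobility s) = D.M 0 s :=
    mul_div_cancel₀ _ hp.ne'
  have hF0 : 0 ≤ D.M 0 s / D.totalMobility s := by positivity
  have hF1 : D.M 0 s / D.totalMobility s ≤ 1 := by
    rw [div_le_one hp]; linarith
  refine ⟨hF0, hF1, ?_, ?_⟩
  · have := mul_le_mul_of_nonneg_right (hM s) hF0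
    linarith
  · have := mul_le_mul_of_nonneg_right (hM s) (sub_nonneg.2 hF1)
    linarith

theorem globalPressure_sub_sq_le {m₀ : ℝ} (hm : 0 < m₀) (hM : ∀ s, m₀ ≤ D.totalMobility s)
    (α : Fin 2) (gA wA gB wB : ℝ) :
    m₀ * (D.globalPressure α gB wB - D.globalPressure α gA wA) ^ 2 ≤
      upwind (D.M 0) gA gB (D.sat 0 gA wA) (D.sat 0 gB wB) * (gB - gA) ^ 2 +
      upwind (D.M 1) wA wB (D.sat 1 gA wA) (D.sat 1 gB wB) * (wB - wA) ^ 2 := by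
  rw [globalPressure_eq, globalPressure_eq]
  obtain ⟨hlow, hup⟩ := D.corrective_one_sub_bounds (D.pc.symm (gA - wA)) (D.pc.symm (gB - wB))
  rw [D.pc.apply_symm_apply, D.pc.apply_symm_apply] at hlow hup
  obtain ⟨a0, a1, a2, a3⟩ := D.fractionalFlow_bounds hM (D.pc.symm (gA - wA))
  obtain ⟨b0, b1, b2, b3⟩ := D.fractionalFlow_bounds hM (D.pc.symm (gB - wB))
  exact upwind_weighted_sq_ge hm a0 a1 a2 a3 b0 b1 b2 b3 (by linarith) (by linarith)

theorem regMobility_zero : D.regMobility 0 = D.M := by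
  funext α s; simp [regMobility]

theorem exists_globalPressure_eq :
    ∃ k : ℝ → ℝ, Continuous k ∧ ∀ α pg pw, D.globalPressure α pg pw = pw + k (pg - pw) :=
  ⟨_, (D.continuous_corrective 1).comp D.pc_symm_continuous, D.globalPressure_eq⟩

end FlowData

/-! ### Upwind fluxes on one diamond. -/

/-- The upwind value may jump where the pressures agree, but there it multiplies 0: splitting the
pressure difference into positive and negative parts removes the case distinction. -/
theorem continuous_upwind_comp_mul {X : Type*} [TopologicalSpace X] {M : X → ℝ → ℝ}
    (hM : Continuous fun q : X × ℝ => M q.1 q.2) {pA pB sA sB : X → ℝ} (hpA : Continuous pA)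
    (hpB : Continuous pB) (hsA : Continuous sA) (hsB : Continuous sB) {h : ℝ → ℝ}
    (hh : Continuous h) :
    Continuous fun x => h (upwind (M x) (pA x) (pB x) (sA x) (sB x)) * (pB x - pA x) := by
  have heq : (fun x => h (upwind (M x) (pA x) (pB x) (sA x) (sB x)) * (pB x - pA x)) = fun x =>
      h (M x (sB x)) * max (pB x - pA x) 0 + h (M x (sA x)) * min (pB x - pA x) 0 := by
    funext x
    unfold upwind
    split_ifs with h0
    · rw [max_eq_left h0, min_eq_right h0, mul_zero, add_zero]
    · rw [max_eq_right (not_le.1 h0).le, min_eq_left (not_le.1 h0).le, mul_zero, zero_add]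
  rw [heq]
  have h1 : Continuous fun x => M x (sB x) := hM.comp (continuous_id.prodMk hsB)
  have h2 : Continuous fun x => M x (sA x) := hM.comp (continuous_id.prodMk hsA)
  fun_prop

theorem upwind_nonneg {M : ℝ → ℝ} (hM : ∀ s, 0 ≤ M s) (pA pB sA sB : ℝ) :
    0 ≤ upwind M pA pB sA sB := by
  unfold upwind; split_ifs <;> apply hM

theorem min_le_upwind (M : ℝ → ℝ) (pA pB sA sB : ℝ) :
    min (M sA) (M sB) ≤ upwind M pA pB sA sB := by
  unfold upwind; split_ifs
  exacts [min_le_right _ _, min_le_left _ _]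

theorem upwind_mul_comm {h : ℝ → ℝ} (M : ℝ → ℝ) (pA pB sA sB : ℝ) :
    h (upwind M pB pA sB sA) * (pA - pB) = -(h (upwind M pA pB sA sB) * (pB - pA)) := by
  unfold upwind
  rcases lt_trichotomy pA pB with hlt | heq | hgt
  · rw [if_neg (by linarith), if_pos (by linarith)]; ring
  · rw [heq]; ring
  · rw [if_pos (by linarith), if_neg (by linarith)]; ring

/-- Coercivity of the upwind fluxes on a diamond. -/
theorem upwind_flux_coercive {τ τ' η θ U U' m m' : ℝ} (hτ : 0 ≤ τ) (hτ' : 0 ≤ τ')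
    (hθ : 0 ≤ θ) (hη : |η| ≤ θ * Real.sqrt (τ * τ')) (hU : 0 ≤ U) (hU' : 0 ≤ U')
    (hm : m ≤ U) (hm' : m' ≤ U') (x y : ℝ) :
    (1 - θ) * (U * τ * x ^ 2 + U' * τ' * y ^ 2) ≤
      x * (U * τ * x + Real.sqrt m * Real.sqrt U' * η * y) +
        y * (U' * τ' * y + Real.sqrt m' * Real.sqrt U * η * x) := by
  set P := Real.sqrt U * Real.sqrt τ * |x| with hP
  set R := Real.sqrt U' * Real.sqrt τ' * |y| with hR
  have hP2 : P ^ 2 = U * τ * x ^ 2 := by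
    rw [hP, mul_pow, mul_pow, Real.sq_sqrt hU, Real.sq_sqrt hτ, sq_abs]
  have hR2 : R ^ 2 = U' * τ' * y ^ 2 := by
    rw [hR, mul_pow, mul_pow, Real.sq_sqrt hU', Real.sq_sqrt hτ', sq_abs]
  have hs : Real.sqrt (τ * τ') = Real.sqrt τ * Real.sqrt τ' := Real.sqrt_mul hτ _
  -- Both cross terms are at least -θ P R, since m ≤ U and m' ≤ U' under the roots; then 2 P R ≤ P²
  -- + R².
  have cross_le : ∀ a b : ℝ, 0 ≤ a → a ≤ Real.sqrt U * Real.sqrt U' → b = a * η * (x * y) →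
      -(θ * (P * R)) ≤ b := by
    intro a b ha hab hb
    have h1 : |b| ≤ θ * (P * R) := by
      rw [hb, abs_mul, abs_mul, abs_of_nonneg ha, abs_mul]
      calc a * |η| * (|x| * |y|) ≤
          (Real.sqrt U * Real.sqrt U') * (θ * Real.sqrt (τ * τ')) * (|x| * |y|) := by gcongr
        _ = θ * (P * R) := by rw [hs, hP, hR]; ring
    exact (abs_le.1 h1).1
  have h1 := cross_le (Real.sqrt m * Real.sqrt U') (x * (Real.sqrt m * Real.sqrt U' * η * y))
    (by positivity) (by gcongr) (by ring)
  have h2 := cross_le (Real.sqrt m' * Real.sqrt U) (y * (Real.sqrt m' * Real.sqrt U * η * x))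
    (by positivity) (by rw [mul_comm (Real.sqrt U)]; gcongr) (by ring)
  rw [← hP2, ← hR2]
  have h3 := mul_nonneg hθ (sq_nonneg (P - R))
  nlinarith

/-! ### Conservative form of the scheme and discrete integration by parts. -/

namespace DDFVMesh

variable {Cell IEdge BEdge Vert : Type*} (T : DDFVMesh Cell IEdge BEdge Vert) (D : FlowData T.Ω)

theorem tgt_flip (e : IEdge ⊕ BEdge) (b : Bool) : T.tgt (e, !b) = T.src (e, b) := by
  simp [tgt]

theorem dtgt_flip (e : IEdge ⊕ BEdge) (b : Bool) : T.dtgt (e, !b) = T.dsrc (e, b) := by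
  simp [dtgt]

theorem pressure_of_isDir (p : T.State) (α : Fin 2) {A : T.Dof} (h : T.IsDir A) :
    T.pressure p α A = 0 := by
  simp [pressure, ext, h]

theorem pressure_free (p : T.State) (α : Fin 2) (A : T.FreeDof) : T.pressure p α A = p α A := by
  simp [pressure, ext, A.2]

theorem saturation_zero (p : T.State) (A : T.Dof) :
    T.saturation D p 0 A = D.pc.symm (T.pressure p 0 A - T.pressure p 1 A) := rfl

theorem saturation_one (p : T.State) (A : T.Dof) :
    T.saturation D p 1 A = 1 - T.saturation D p 0 A := rfl

theorem saturation_nonneg_of_isDir (p : T.State) (α : Fin 2) {A : T.Dof} (h : T.IsDir A) :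
    0 ≤ T.saturation D p α A := by
  have h0 : T.saturation D p 0 A = 0 := by
    rw [saturation_zero, T.pressure_of_isDir p 0 h, T.pressure_of_isDir p 1 h, sub_zero,
      OrderIso.symm_apply_eq, D.pc_zero]
  fin_cases α
  · exact h0.ge
  · change 0 ≤ T.saturation D p 1 A
    rw [saturation_one, h0]
    norm_num

/-- The flux of the regularized scheme through a primal edge. -/
noncomputable def regFlux (ε η : ℝ) (p : T.State) (α : Fin 2) (d : (IEdge ⊕ BEdge) × Bool) : ℝ :=
  T.density D p α (T.src d) (T.tgt d) *
    (T.velocity D (D.regMobility ε) p α d + η * (-1) ^ (α : ℕ) * T.capFlow D p d)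

/-- The flux of the regularized scheme through a dual edge. -/
noncomputable def regFluxDual (ε η : ℝ) (p : T.State) (α : Fin 2)
    (d : (IEdge ⊕ BEdge) × Bool) : ℝ :=
  T.density D p α (T.dsrc d) (T.dtgt d) *
    (T.velocityDual D (D.regMobility ε) p α d + η * (-1) ^ (α : ℕ) * T.capFlowDual D p d)

/-- The pore volume of a degree of freedom. -/
noncomputable def poreVolume : T.Dof → ℝ
  | Sum.inl (Sum.inl K) => volume.real (T.cell K) * D.meanPorosity (T.cell K)
  | Sum.inl (Sum.inr _) => 0
  | Sum.inr v => volume.real (T.dualCell v) * D.meanPorosity (T.dualCell v)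

theorem poreVolume_nonneg (A : T.Dof) : 0 ≤ T.poreVolume D A := by
  rcases A with (K | b) | v
  · exact (D.volume_mul_meanPorosity_pos (T.cell_subset K) (T.cell_polygon K).2.2.1
      (T.cell_polygon K).1 (T.cell_polygon K).2.1.nonempty).le
  · exact le_rfl
  · exact (D.volume_mul_meanPorosity_pos (T.dualCell_subset v) (T.dualCell_polygon v).2.2.1
      (T.dualCell_polygon v).1 (T.dualCell_polygon v).2.1.nonempty).le

theorem density_comm (p : T.State) (α : Fin 2) (A B : T.Dof) :
    T.density D p α A B = T.density D p α B A := D.interfaceDensity_comm α _ _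

theorem mobMin_comm (M : Fin 2 → ℝ → ℝ) (p : T.State) (α : Fin 2) (A B : T.Dof) :
    T.mobMin D M p α A B = T.mobMin D M p α B A := min_comm _ _

theorem velocity_flip (M : Fin 2 → ℝ → ℝ) (p : T.State) (α : Fin 2) (e : IEdge ⊕ BEdge) (b : Bool) :
    T.velocity D M p α (e, !b) = -T.velocity D M p α (e, b) := by
  have h1 := upwind_mul_comm (h := id) (M α) (T.pressure p α (T.src (e, b)))
    (T.pressure p α (T.tgt (e, b))) (T.saturation D p α (T.src (e, b)))
    (T.saturation D p α (T.tgt (e, b)))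
  have h2 := upwind_mul_comm (h := Real.sqrt) (M α) (T.pressure p α (T.dsrc (e, b)))
    (T.pressure p α (T.dtgt (e, b))) (T.saturation D p α (T.dsrc (e, b)))
    (T.saturation D p α (T.dtgt (e, b)))
  simp only [id] at h1
  unfold velocity
  rw [tgt_flip, dtgt_flip, mobMin_comm]
  change T.mobUp D M p α (T.tgt (e, b)) (T.src (e, b)) * T.tau D e *
      (T.pressure p α (T.src (e, b)) - T.pressure p α (T.tgt (e, b))) +
    Real.sqrt (T.mobMin D M p α (T.src (e, b)) (T.tgt (e, b))) *
      Real.sqrt (T.mobUp D M p α (T.dtgt (e, b)) (T.dsrc (e, b))) * T.etaD D e *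
      (T.pressure p α (T.dsrc (e, b)) - T.pressure p α (T.dtgt (e, b))) = _
  unfold mobUp
  linear_combination T.tau D e * h1 +
    Real.sqrt (T.mobMin D M p α (T.src (e, b)) (T.tgt (e, b))) * T.etaD D e * h2

theorem velocityDual_flip (M : Fin 2 → ℝ → ℝ) (p : T.State) (α : Fin 2) (e : IEdge ⊕ BEdge)
    (b : Bool) : T.velocityDual D M p α (e, !b) = -T.velocityDual D M p α (e, b) := by
  have h1 := upwind_mul_comm (h := Real.sqrt) (M α) (T.pressure p α (T.src (e, b)))
    (T.pressure p α (T.tgt (e, b))) (T.saturation D p α (T.src (e, b)))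
    (T.saturation D p α (T.tgt (e, b)))
  have h2 := upwind_mul_comm (h := id) (M α) (T.pressure p α (T.dsrc (e, b)))
    (T.pressure p α (T.dtgt (e, b))) (T.saturation D p α (T.dsrc (e, b)))
    (T.saturation D p α (T.dtgt (e, b)))
  simp only [id] at h2
  unfold velocityDual
  rw [tgt_flip, dtgt_flip, mobMin_comm]
  change T.mobUp D M p α (T.dtgt (e, b)) (T.dsrc (e, b)) * T.tauDual D e *
      (T.pressure p α (T.dsrc (e, b)) - T.pressure p α (T.dtgt (e, b))) +
    Real.sqrt (T.mobMin D M p α (T.dsrc (e, b)) (T.dtgt (e, b))) *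
      Real.sqrt (T.mobUp D M p α (T.tgt (e, b)) (T.src (e, b))) * T.etaD D e *
      (T.pressure p α (T.src (e, b)) - T.pressure p α (T.tgt (e, b))) = _
  unfold mobUp
  linear_combination T.tauDual D e * h2 +
    Real.sqrt (T.mobMin D M p α (T.dsrc (e, b)) (T.dtgt (e, b))) * T.etaD D e * h1

theorem regFlux_flip (ε η : ℝ) (p : T.State) (α : Fin 2) (e : IEdge ⊕ BEdge) (b : Bool) :
    T.regFlux D ε η p α (e, !b) = -T.regFlux D ε η p α (e, b) := by
  unfold regFlux
  rw [velocity_flip, density_comm, tgt_flip]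
  change T.density D p α (T.src (e, b)) (T.tgt (e, b)) * _ = _
  unfold capFlow
  rw [tgt_flip]
  change _ * (_ + _ * (T.tau D e * (_ - (T.pressure p 0 (T.tgt (e, b)) -
    T.pressure p 1 (T.tgt (e, b)))))) = _
  ring

theorem regFluxDual_flip (ε η : ℝ) (p : T.State) (α : Fin 2) (e : IEdge ⊕ BEdge) (b : Bool) :
    T.regFluxDual D ε η p α (e, !b) = -T.regFluxDual D ε η p α (e, b) := by
  unfold regFluxDual
  rw [velocityDual_flip, density_comm, dtgt_flip]
  change T.density D p α (T.dsrc (e, b)) (T.dtgt (e, b)) * _ = _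
  unfold capFlowDual
  rw [dtgt_flip]
  change _ * (_ + _ * (T.tauDual D e * (_ - (T.pressure p 0 (T.dtgt (e, b)) -
    T.pressure p 1 (T.dtgt (e, b)))))) = _
  ring

section Sums

variable [Fintype IEdge] [Fintype BEdge]

theorem sumEdges_vert (v : Vert) (f : (IEdge ⊕ BEdge) × Bool → ℝ) :
    T.sumEdges (Sum.inr v) f = 0 := by
  unfold sumEdges
  refine Finset.sum_eq_zero fun d _ => if_neg ?_
  rcases d with ⟨e, _ | _⟩ <;> simp [src]

theorem sumDualEdges_inl (A : Cell ⊕ BEdge) (f : (IEdge ⊕ BEdge) × Bool → ℝ) :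
    T.sumDualEdges (Sum.inl A) f = 0 := by
  unfold sumDualEdges
  refine Finset.sum_eq_zero fun d _ => if_neg ?_
  rcases d with ⟨e, _ | _⟩ <;> simp [dsrc]

theorem sumEdges_boundary (b : BEdge) (f : (IEdge ⊕ BEdge) × Bool → ℝ) :
    T.sumEdges (Sum.inl (Sum.inr b)) f = f (Sum.inr b, false) := by
  unfold sumEdges
  rw [Finset.sum_eq_single (Sum.inr b, false)]
  · simp [src]
  · rintro ⟨e | b', _ | _⟩ - hne
    all_goals refine if_neg ?_
    all_goals simp [src]
    rintro rfl
    exact hne rfl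
  · simp

theorem sumEdges_add_mul (A : T.Dof) (c : ℝ) (f g : (IEdge ⊕ BEdge) × Bool → ℝ) :
    T.sumEdges A (fun d => f d + c * g d) = T.sumEdges A f + c * T.sumEdges A g := by
  unfold sumEdges
  rw [Finset.mul_sum, ← Finset.sum_add_distrib]
  refine Finset.sum_congr rfl fun d _ => ?_
  split_ifs <;> ring

theorem sumDualEdges_add_mul (A : T.Dof) (c : ℝ) (f g : (IEdge ⊕ BEdge) × Bool → ℝ) :
    T.sumDualEdges A (fun d => f d + c * g d) = T.sumDualEdges A f + c * T.sumDualEdges A g := by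
  unfold sumDualEdges
  rw [Finset.mul_sum, ← Finset.sum_add_distrib]
  refine Finset.sum_congr rfl fun d _ => ?_
  split_ifs <;> ring

/-- One formula for the three kinds of rows: a boundary edge has no pore volume and one primal flux,
and for each kind the sum over foreign edges is empty. -/
theorem regRow_eq (dt ε η : ℝ) (p pn : T.State) (α : Fin 2) (A : T.Dof) :
    T.regRow D dt ε η p pn α A =
      T.poreVolume D A * (D.ρ α (T.pressure p α A) * trunc (T.saturation D p α A) -
        D.ρ α (T.pressure pn α A) * T.saturation D pn α A) -
      dt * (T.sumEdges A (T.regFlux D ε η p α) + T.sumDualEdges A (T.regFluxDual D ε η p α)) := by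
  have h1 : T.regFlux D ε η p α = fun d =>
      T.density D p α (T.src d) (T.tgt d) * T.velocity D (D.regMobility ε) p α d +
        η * (-1) ^ (α : ℕ) * (T.density D p α (T.src d) (T.tgt d) * T.capFlow D p d) := by
    funext d; unfold regFlux; ring
  have h2 : T.regFluxDual D ε η p α = fun d =>
      T.density D p α (T.dsrc d) (T.dtgt d) * T.velocityDual D (D.regMobility ε) p α d +
        η * (-1) ^ (α : ℕ) * (T.density D p α (T.dsrc d) (T.dtgt d) * T.capFlowDual D p d) := by
    funext d; unfold regFluxDual; ring
  rcases A with (K | b) | v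
  · rw [sumDualEdges_inl, h1, sumEdges_add_mul]
    simp only [regRow, accumulation, poreVolume]
    ring
  · rw [sumDualEdges_inl, sumEdges_boundary, h1]
    simp only [regRow, poreVolume]
    ring
  · rw [sumEdges_vert, h2, sumDualEdges_add_mul]
    simp only [regRow, accumulation, poreVolume]
    ring

theorem sum_mul_sum_fiber {X Y : Type*} [Fintype X] [Fintype Y] [DecidableEq X] (s : Y → X)
    (G : X → ℝ) (f : Y → ℝ) :
    ∑ A, G A * ∑ d, (if s d = A then f d else 0) = ∑ d, G (s d) * f d := by
  simp_rw [Finset.mul_sum]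
  rw [Finset.sum_comm]
  refine Finset.sum_congr rfl fun d _ => ?_
  rw [Finset.sum_eq_single (s d)]
  · rw [if_pos rfl]
  · intro A _ hA
    rw [if_neg (Ne.symm hA), mul_zero]
  · simp

variable [Fintype Cell] [Fintype Vert]

/-- Discrete integration by parts: the two labellings of a diamond carry opposite fluxes. -/
theorem sum_mul_sumEdges (G : T.Dof → ℝ) (f : (IEdge ⊕ BEdge) × Bool → ℝ)
    (hf : ∀ e b, f (e, !b) = -f (e, b)) :
    ∑ A, G A * T.sumEdges A f =
      -∑ e, (G (T.tgt (e, true)) - G (T.src (e, true))) * f (e, true) := by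
  classical
  have h := sum_mul_sum_fiber T.src G f
  have h2 : ∑ A, G A * T.sumEdges A f = ∑ d, G (T.src d) * f d := by
    rw [← h]
    refine Finset.sum_congr rfl fun A _ => ?_
    unfold sumEdges
    congr!
  rw [h2, Fintype.sum_prod_type, ← Finset.sum_neg_distrib]
  refine Finset.sum_congr rfl fun e _ => ?_
  rw [Fintype.sum_bool]
  have h3 := hf e true
  have h4 : T.src (e, false) = T.tgt (e, true) := rfl
  simp only [Bool.not_true] at h3
  rw [h3, h4]
  ring

theorem sum_mul_sumDualEdges (G : T.Dof → ℝ) (f : (IEdge ⊕ BEdge) × Bool → ℝ)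
    (hf : ∀ e b, f (e, !b) = -f (e, b)) :
    ∑ A, G A * T.sumDualEdges A f =
      -∑ e, (G (T.dtgt (e, true)) - G (T.dsrc (e, true))) * f (e, true) := by
  classical
  have h := sum_mul_sum_fiber T.dsrc G f
  have h2 : ∑ A, G A * T.sumDualEdges A f = ∑ d, G (T.dsrc d) * f d := by
    rw [← h]
    refine Finset.sum_congr rfl fun A _ => ?_
    unfold sumDualEdges
    congr!
  rw [h2, Fintype.sum_prod_type, ← Finset.sum_neg_distrib]
  refine Finset.sum_congr rfl fun e _ => ?_
  rw [Fintype.sum_bool]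
  have h3 := hf e true
  have h4 : T.dsrc (e, false) = T.dtgt (e, true) := rfl
  simp only [Bool.not_true] at h3
  rw [h3, h4]
  ring

end Sums

/-! ### Continuity -/

theorem continuous_pressure (α : Fin 2) (A : T.Dof) :
    Continuous fun p : T.State => T.pressure p α A := by
  unfold pressure ext
  split_ifs
  · exact continuous_const
  · fun_prop

theorem continuous_saturation (α : Fin 2) (A : T.Dof) :
    Continuous fun p : T.State => T.saturation D p α A := by
  have h : Continuous fun p : T.State => T.saturation D p 0 A :=
    D.pc_symm_continuous.comp ((T.continuous_pressure 0 A).sub (T.continuous_pressure 1 A))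
  fin_cases α
  · exact h
  · exact continuous_const.sub h

theorem continuous_density (α : Fin 2) (A B : T.Dof) :
    Continuous fun p : T.State => T.density D p α A B :=
  (D.continuous_interfaceDensity α).comp
    ((T.continuous_pressure α A).prodMk (T.continuous_pressure α B))

theorem continuous_regMobility (α : Fin 2) :
    Continuous fun q : (ℝ × T.State) × ℝ => D.regMobility q.1.1 α q.2 :=
  continuous_fst.fst.add ((D.M_continuous α).comp continuous_snd)

theorem continuous_comp_mobUp_mul (α : Fin 2) (A B : T.Dof) {h : ℝ → ℝ} (hh : Continuous h) :
    Continuous fun q : ℝ × T.State => h (T.mobUp D (D.regMobility q.1) q.2 α A B) *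
      (T.pressure q.2 α B - T.pressure q.2 α A) :=
  continuous_upwind_comp_mul (M := fun q s => D.regMobility q.1 α s)
    (T.continuous_regMobility D α)
    ((T.continuous_pressure α A).comp continuous_snd)
    ((T.continuous_pressure α B).comp continuous_snd)
    ((T.continuous_saturation D α A).comp continuous_snd)
    ((T.continuous_saturation D α B).comp continuous_snd) hh

theorem continuous_mobMin (α : Fin 2) (A B : T.Dof) :
    Continuous fun q : ℝ × T.State => T.mobMin D (D.regMobility q.1) q.2 α A B :=
  ((T.continuous_regMobility D α).comp (continuous_id.prodMk
    ((T.continuous_saturation D α A).comp continuous_snd))).min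
  ((T.continuous_regMobility D α).comp (continuous_id.prodMk
    ((T.continuous_saturation D α B).comp continuous_snd)))

theorem continuous_velocity (α : Fin 2) (d : (IEdge ⊕ BEdge) × Bool) :
    Continuous fun q : ℝ × T.State => T.velocity D (D.regMobility q.1) q.2 α d := by
  have h1 := T.continuous_comp_mobUp_mul D α (T.src d) (T.tgt d) continuous_id
  have h2 := T.continuous_comp_mobUp_mul D α (T.dsrc d) (T.dtgt d) Real.continuous_sqrt
  have h3 := Real.continuous_sqrt.comp (T.continuous_mobMin D α (T.src d) (T.tgt d))
  have h := (h1.const_mul (T.tau D d.1)).add ((h3.mul h2).const_mul (T.etaD D d.1))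
  convert h using 2
  simp only [velocity, id, Function.comp, Pi.add_apply, Pi.mul_apply]
  ring

theorem continuous_velocityDual (α : Fin 2) (d : (IEdge ⊕ BEdge) × Bool) :
    Continuous fun q : ℝ × T.State => T.velocityDual D (D.regMobility q.1) q.2 α d := by
  have h1 := T.continuous_comp_mobUp_mul D α (T.dsrc d) (T.dtgt d) continuous_id
  have h2 := T.continuous_comp_mobUp_mul D α (T.src d) (T.tgt d) Real.continuous_sqrt
  have h3 := Real.continuous_sqrt.comp (T.continuous_mobMin D α (T.dsrc d) (T.dtgt d))
  have h := (h1.const_mul (T.tauDual D d.1)).add ((h3.mul h2).const_mul (T.etaD D d.1))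
  convert h using 2
  simp only [velocityDual, id, Function.comp, Pi.add_apply, Pi.mul_apply]
  ring

theorem continuous_capFlow (d : (IEdge ⊕ BEdge) × Bool) :
    Continuous fun p : T.State => T.capFlow D p d := by
  have h := T.continuous_pressure
  exact continuous_const.mul (((h 0 _).sub (h 1 _)).sub ((h 0 _).sub (h 1 _)))

theorem continuous_capFlowDual (d : (IEdge ⊕ BEdge) × Bool) :
    Continuous fun p : T.State => T.capFlowDual D p d := by
  have h := T.continuous_pressure
  exact continuous_const.mul (((h 0 _).sub (h 1 _)).sub ((h 0 _).sub (h 1 _)))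

theorem continuous_regFlux (α : Fin 2) (d : (IEdge ⊕ BEdge) × Bool) :
    Continuous fun q : ℝ × ℝ × T.State => T.regFlux D q.1 q.2.1 q.2.2 α d := by
  have h1 : Continuous fun q : ℝ × ℝ × T.State => (q.1, q.2.2) := by fun_prop
  have h2 : Continuous fun q : ℝ × ℝ × T.State => q.2.2 := by fun_prop
  have h3 : Continuous fun q : ℝ × ℝ × T.State => q.2.1 := by fun_prop
  exact ((T.continuous_density D α _ _).comp h2).mul (((T.continuous_velocity D α d).comp h1).add
    ((h3.mul continuous_const).mul ((T.continuous_capFlow D d).comp h2)))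

theorem continuous_regFluxDual (α : Fin 2) (d : (IEdge ⊕ BEdge) × Bool) :
    Continuous fun q : ℝ × ℝ × T.State => T.regFluxDual D q.1 q.2.1 q.2.2 α d := by
  have h1 : Continuous fun q : ℝ × ℝ × T.State => (q.1, q.2.2) := by fun_prop
  have h2 : Continuous fun q : ℝ × ℝ × T.State => q.2.2 := by fun_prop
  have h3 : Continuous fun q : ℝ × ℝ × T.State => q.2.1 := by fun_prop
  exact ((T.continuous_density D α _ _).comp h2).mul
    (((T.continuous_velocityDual D α d).comp h1).add
    ((h3.mul continuous_const).mul ((T.continuous_capFlowDual D d).comp h2)))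

variable [Fintype IEdge] [Fintype BEdge]

theorem continuous_regScheme (dt : ℝ) (pn : T.State) :
    Continuous fun q : ℝ × ℝ × T.State => T.regScheme D dt q.1 q.2.1 q.2.2 pn := by
  refine continuous_pi fun α => continuous_pi fun A => ?_
  simp only [regScheme, regRow_eq]
  have h2 : Continuous fun q : ℝ × ℝ × T.State => q.2.2 := by fun_prop
  have hp := (T.continuous_pressure α A.1).comp h2
  have hs := (T.continuous_saturation D α A.1).comp h2
  refine Continuous.sub (continuous_const.mul ((((D.ρ_continuous α).comp hp).mul
    (continuous_trunc.comp hs)).sub continuous_const)) (continuous_const.mul (Continuous.add ?_ ?_))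
  · refine continuous_finsetSum _ fun d _ => ?_
    split_ifs
    exacts [T.continuous_regFlux D α d, continuous_const]
  · refine continuous_finsetSum _ fun d _ => ?_
    split_ifs
    exacts [T.continuous_regFluxDual D α d, continuous_const]

theorem regScheme_zero_zero (dt : ℝ) (p pn : T.State) :
    T.regScheme D dt 0 0 p pn = T.ppScheme D dt p pn := by
  funext α A
  rcases A with ⟨(K | b) | v, hA⟩ <;> simp [regScheme, ppScheme, regRow, ppRow, D.regMobility_zero]

end DDFVMesh

namespace DDFVMesh

variable {Cell IEdge BEdge Vert : Type*} (T : DDFVMesh Cell IEdge BEdge Vert) (D : FlowData T.Ω)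

/-! ### The maximum principle -/

/-- Otherwise the indicator function of S would have no jumps and vanish at the Dirichlet elements,
hence vanish everywhere. -/
theorem isDir_of_forall_edge_mem [Finite Cell] [Finite BEdge] [Finite Vert] {S : Set T.Dof}
    (hp : ∀ e b, T.src (e, b) ∈ S → T.tgt (e, b) ∈ S)
    (hd : ∀ e b, T.dsrc (e, b) ∈ S → T.dtgt (e, b) ∈ S) (hne : S.Nonempty) :
    ∃ A ∈ S, T.IsDir A := by
  classical
  by_contra! hnot
  obtain ⟨A, hA⟩ := hne
  have hiff : ∀ e, T.tgt (e, true) ∈ S ↔ T.src (e, true) ∈ S := fun e =>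
    ⟨fun h => by simpa [tgt] using hp e false h, hp e true⟩
  have hiffd : ∀ e, T.dtgt (e, true) ∈ S ↔ T.dsrc (e, true) ∈ S := fun e =>
    ⟨fun h => by simpa [dtgt] using hd e false h, hd e true⟩
  have h := T.eq_zero_of_forall_edge (fun A => if A ∈ S then 1 else 0)
    (fun e => by simp only [hiff]) (fun e => by simp only [hiffd])
    (fun B hB => if_neg fun hBS => hnot B hBS hB) A
  simp [hA] at h

theorem capillary_jump_nonneg (p : T.State) (α : Fin 2) {A B : T.Dof}
    (h : T.saturation D p α A ≤ T.saturation D p α B) :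
    0 ≤ (-1) ^ (α : ℕ) * ((T.pressure p 0 B - T.pressure p 1 B) -
      (T.pressure p 0 A - T.pressure p 1 A)) := by
  fin_cases α
  · have h' : T.saturation D p 0 A ≤ T.saturation D p 0 B := h
    rw [saturation_zero, saturation_zero, D.pc.symm.le_iff_le] at h'
    simpa using h'
  · have h' : T.saturation D p 1 A ≤ T.saturation D p 1 B := h
    rw [saturation_one, saturation_one, sub_le_sub_iff_left, saturation_zero, saturation_zero,
      D.pc.symm.le_iff_le] at h'
    simp
    linarith

theorem saturation_eq_of_capillary_jump_eq_zero (p : T.State) (α : Fin 2) {A B : T.Dof}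
    (h : (T.pressure p 0 B - T.pressure p 1 B) - (T.pressure p 0 A - T.pressure p 1 A) = 0) :
    T.saturation D p α B = T.saturation D p α A := by
  have h0 : T.saturation D p 0 B = T.saturation D p 0 A := by
    rw [saturation_zero, saturation_zero, sub_eq_zero.1 h]
  fin_cases α
  · exact h0
  · change T.saturation D p 1 B = T.saturation D p 1 A
    rw [saturation_one, saturation_one, h0]

/-- A positive value is an inflow into A. An outflow would be upwinded at A, where the mobility is
0. -/
theorem mobUp_mul_nonneg (p : T.State) (α : Fin 2) {A : T.Dof}
    (hA : T.saturation D p α A ≤ 0) (B : T.Dof) :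
    0 ≤ T.mobUp D D.M p α A B * (T.pressure p α B - T.pressure p α A) := by
  unfold mobUp upwind
  split_ifs with h
  · exact mul_nonneg (D.M_nonneg _ _) h
  · rw [D.M_of_nonpos α _ hA, zero_mul]

/-- The reason for the minimum in the scheme: it removes the cross term, which has no sign. -/
theorem mobMin_eq_zero (p : T.State) (α : Fin 2) {A : T.Dof}
    (hA : T.saturation D p α A ≤ 0) (B : T.Dof) : T.mobMin D D.M p α A B = 0 := by
  unfold mobMin
  rw [D.M_of_nonpos α _ hA, min_eq_left (D.M_nonneg _ _)]

/-- At a nonpositive minimum the Darcy part is an inflow without cross term, and the capillary part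
is an inflow proportional to the capillary jump. As η > 0, a vanishing flux forces this jump to be
0. -/
theorem regFlux_nonneg_of_minimal [Finite BEdge] {η : ℝ} (hη : 0 < η) (p : T.State) (α : Fin 2)
    (d : (IEdge ⊕ BEdge) × Bool) (h0 : T.saturation D p α (T.src d) ≤ 0)
    (hmin : T.saturation D p α (T.src d) ≤ T.saturation D p α (T.tgt d)) :
    0 ≤ T.regFlux D 0 η p α d ∧ (T.regFlux D 0 η p α d = 0 →
      T.saturation D p α (T.tgt d) = T.saturation D p α (T.src d)) := by
  have hρ : 0 < T.density D p α (T.src d) (T.tgt d) := D.interfaceDensity_pos α _ _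
  have hτ := T.tau_pos D d.1
  have hV : 0 ≤ T.velocity D (D.regMobility 0) p α d := by
    unfold velocity
    rw [D.regMobility_zero, T.mobMin_eq_zero D p α h0, Real.sqrt_zero, zero_mul, zero_mul,
      zero_mul, add_zero, mul_right_comm]
    exact mul_nonneg (T.mobUp_mul_nonneg D p α h0 _) hτ.le
  have hj := T.capillary_jump_nonneg D p α hmin
  have hc : η * (-1) ^ (α : ℕ) * T.capFlow D p d = η * T.tau D d.1 * ((-1) ^ (α : ℕ) *
      ((T.pressure p 0 (T.tgt d) - T.pressure p 1 (T.tgt d)) -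
      (T.pressure p 0 (T.src d) - T.pressure p 1 (T.src d)))) := by
    unfold capFlow; ring
  have hcn := mul_nonneg (mul_pos hη hτ).le hj
  rw [regFlux, hc]
  refine ⟨mul_nonneg hρ.le (add_nonneg hV hcn), fun h => ?_⟩
  refine T.saturation_eq_of_capillary_jump_eq_zero D p α ?_
  have h1 := (mul_eq_zero.1 h).resolve_left hρ.ne'
  have h2 := (mul_eq_zero.1 ((add_eq_zero_iff_of_nonneg hV hcn).1 h1).2).resolve_left
    (mul_pos hη hτ).ne'
  exact (mul_eq_zero.1 h2).resolve_left (by simp)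

theorem regFluxDual_nonneg_of_minimal [Finite BEdge] {η : ℝ} (hη : 0 < η) (p : T.State)
    (α : Fin 2) (d : (IEdge ⊕ BEdge) × Bool) (h0 : T.saturation D p α (T.dsrc d) ≤ 0)
    (hmin : T.saturation D p α (T.dsrc d) ≤ T.saturation D p α (T.dtgt d)) :
    0 ≤ T.regFluxDual D 0 η p α d ∧ (T.regFluxDual D 0 η p α d = 0 →
      T.saturation D p α (T.dtgt d) = T.saturation D p α (T.dsrc d)) := by
  have hρ : 0 < T.density D p α (T.dsrc d) (T.dtgt d) := D.interfaceDensity_pos α _ _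
  have hτ := T.tauDual_pos D d.1
  have hV : 0 ≤ T.velocityDual D (D.regMobility 0) p α d := by
    unfold velocityDual
    rw [D.regMobility_zero, T.mobMin_eq_zero D p α h0, Real.sqrt_zero, zero_mul, zero_mul,
      zero_mul, add_zero, mul_right_comm]
    exact mul_nonneg (T.mobUp_mul_nonneg D p α h0 _) hτ.le
  have hj := T.capillary_jump_nonneg D p α hmin
  have hc : η * (-1) ^ (α : ℕ) * T.capFlowDual D p d = η * T.tauDual D d.1 * ((-1) ^ (α : ℕ) *
      ((T.pressure p 0 (T.dtgt d) - T.pressure p 1 (T.dtgt d)) -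
      (T.pressure p 0 (T.dsrc d) - T.pressure p 1 (T.dsrc d)))) := by
    unfold capFlowDual; ring
  have hcn := mul_nonneg (mul_pos hη hτ).le hj
  rw [regFluxDual, hc]
  refine ⟨mul_nonneg hρ.le (add_nonneg hV hcn), fun h => ?_⟩
  refine T.saturation_eq_of_capillary_jump_eq_zero D p α ?_
  have h1 := (mul_eq_zero.1 h).resolve_left hρ.ne'
  have h2 := (mul_eq_zero.1 ((add_eq_zero_iff_of_nonneg hV hcn).1 h1).2).resolve_left
    (mul_pos hη hτ).ne'
  exact (mul_eq_zero.1 h2).resolve_left (by simp)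

section Fintype

variable [Fintype Cell] [Fintype IEdge] [Fintype BEdge] [Fintype Vert]

omit [Fintype Cell] [Fintype Vert] in
theorem sumEdges_nonneg {A : T.Dof} {f : (IEdge ⊕ BEdge) × Bool → ℝ}
    (hf : ∀ d, T.src d = A → 0 ≤ f d) :
    0 ≤ T.sumEdges A f ∧ (T.sumEdges A f = 0 → ∀ d, T.src d = A → f d = 0) := by
  classical
  unfold sumEdges
  have hnn : ∀ d ∈ Finset.univ, 0 ≤ if T.src d = A then f d else 0 := by
    intro d _
    split_ifs with h
    exacts [hf d h, le_rfl]
  refine ⟨Finset.sum_nonneg (by convert hnn), fun h0 d hd => ?_⟩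
  have := (Finset.sum_eq_zero_iff_of_nonneg (by convert hnn)).1 h0 d (Finset.mem_univ d)
  rwa [if_pos hd] at this

omit [Fintype Cell] [Fintype Vert] in
theorem sumDualEdges_nonneg {A : T.Dof} {f : (IEdge ⊕ BEdge) × Bool → ℝ}
    (hf : ∀ d, T.dsrc d = A → 0 ≤ f d) :
    0 ≤ T.sumDualEdges A f ∧ (T.sumDualEdges A f = 0 → ∀ d, T.dsrc d = A → f d = 0) := by
  classical
  unfold sumDualEdges
  have hnn : ∀ d ∈ Finset.univ, 0 ≤ if T.dsrc d = A then f d else 0 := by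
    intro d _
    split_ifs with h
    exacts [hf d h, le_rfl]
  refine ⟨Finset.sum_nonneg (by convert hnn), fun h0 d hd => ?_⟩
  have := (Finset.sum_eq_zero_iff_of_nonneg (by convert hnn)).1 h0 d (Finset.mem_univ d)
  rwa [if_pos hd] at this

/-- Strong maximum principle: where a negative minimum is attained all fluxes vanish, so the
neighbours attain it too, and it spreads to a Dirichlet element, where no saturation is negative. -/
theorem saturation_nonneg_of_regScheme_eq_zero {dt η : ℝ} (hdt : 0 < dt) (hη : 0 < η)
    {p pn : T.State} (hpn : T.MaxPrinciple D pn) (h : T.regScheme D dt 0 η p pn = 0)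
    (α : Fin 2) (A : T.Dof) : 0 ≤ T.saturation D p α A := by
  have hfin : Finite T.Dof := inferInstanceAs (Finite ((Cell ⊕ BEdge) ⊕ Vert))
  have : Nonempty T.Dof := ⟨A⟩
  obtain ⟨A₀, hA₀⟩ := Finite.exists_min (T.saturation D p α)
  by_contra hneg
  have hA₀neg : T.saturation D p α A₀ < 0 := (hA₀ A).trans_lt (not_le.1 hneg)
  have key : ∀ B, T.saturation D p α B = T.saturation D p α A₀ →
      (∀ d, T.src d = B → T.saturation D p α (T.tgt d) = T.saturation D p α B) ∧
      (∀ d, T.dsrc d = B → T.saturation D p α (T.dtgt d) = T.saturation D p α B) := by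
    intro B hB
    have hBneg : T.saturation D p α B < 0 := hB ▸ hA₀neg
    have hBfree : ¬ T.IsDir B := fun hd =>
      absurd (T.saturation_nonneg_of_isDir D p α hd) (not_le.2 hBneg)
    have hrow : T.regRow D dt 0 η p pn α B = 0 := congrFun (congrFun h α) ⟨B, hBfree⟩
    -- The truncated saturation is 0, so the accumulation is minus the previous mass and the sum of
    -- the inflows is nonpositive.
    rw [regRow_eq, trunc_of_nonpos hBneg.le, mul_zero, zero_sub] at hrow
    have hprim : ∀ d, T.src d = B → 0 ≤ T.regFlux D 0 η p α d ∧ (T.regFlux D 0 η p α d = 0 →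
        T.saturation D p α (T.tgt d) = T.saturation D p α B) := by
      rintro d rfl
      exact T.regFlux_nonneg_of_minimal D hη p α d hBneg.le (by rw [hB]; exact hA₀ _)
    have hdual : ∀ d, T.dsrc d = B → 0 ≤ T.regFluxDual D 0 η p α d ∧
        (T.regFluxDual D 0 η p α d = 0 →
        T.saturation D p α (T.dtgt d) = T.saturation D p α B) := by
      rintro d rfl
      exact T.regFluxDual_nonneg_of_minimal D hη p α d hBneg.le (by rw [hB]; exact hA₀ _)
    obtain ⟨s1, s2⟩ := T.sumEdges_nonneg fun d hd => (hprim d hd).1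
    obtain ⟨s3, s4⟩ := T.sumDualEdges_nonneg fun d hd => (hdual d hd).1
    have hacc : 0 ≤ T.poreVolume D B *
        (D.ρ α (T.pressure pn α B) * T.saturation D pn α B) :=
      mul_nonneg (T.poreVolume_nonneg D B) (mul_nonneg (D.ρ_pos _ _).le (hpn α B).1)
    have hsum : dt * (T.sumEdges B (T.regFlux D 0 η p α) +
        T.sumDualEdges B (T.regFluxDual D 0 η p α)) ≤ 0 := by linarith
    have hsum' := nonpos_of_mul_nonpos_right hsum hdt
    exact ⟨fun d hd => (hprim d hd).2 (s2 (by linarith) d hd),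
      fun d hd => (hdual d hd).2 (s4 (by linarith) d hd)⟩
  obtain ⟨B, hB, hBdir⟩ := T.isDir_of_forall_edge_mem
    (S := {B | T.saturation D p α B = T.saturation D p α A₀})
    (fun e b hB => ((key _ hB).1 _ rfl).trans hB) (fun e b hB => ((key _ hB).2 _ rfl).trans hB)
    ⟨A₀, rfl⟩
  have hB' : T.saturation D p α B = T.saturation D p α A₀ := hB
  exact absurd (T.saturation_nonneg_of_isDir D p α hBdir) (not_le.2 (hB' ▸ hA₀neg))

theorem maxPrinciple_of_regScheme_eq_zero {dt η : ℝ} (hdt : 0 < dt) (hη : 0 < η)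
    {p pn : T.State} (hpn : T.MaxPrinciple D pn) (h : T.regScheme D dt 0 η p pn = 0) :
    T.MaxPrinciple D p := by
  have hs := T.saturation_nonneg_of_regScheme_eq_zero D hdt hη hpn h
  intro α A
  refine ⟨hs α A, ?_⟩
  have h0 := hs 0 A
  have h1 := hs 1 A
  rw [saturation_one] at h1
  fin_cases α
  · change T.saturation D p 0 A ≤ 1
    linarith
  · change T.saturation D p 1 A ≤ 1
    rw [saturation_one]
    linarith

/-! ### The energy estimate -/

omit [Fintype Cell] [Fintype Vert] in
theorem exists_etaD_le :
    ∃ θ, 0 ≤ θ ∧ θ < 1 ∧ ∀ e, |T.etaD D e| ≤ θ * Real.sqrt (T.tau D e * T.tauDual D e) := by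
  have hlt : ∀ e, |T.etaD D e| / Real.sqrt (T.tau D e * T.tauDual D e) < 1 := by
    intro e
    have hpos := mul_pos (T.tau_pos D e) (T.tauDual_pos D e)
    rw [div_lt_one (Real.sqrt_pos.2 hpos), ← Real.sqrt_sq_eq_abs]
    exact Real.sqrt_lt_sqrt (sq_nonneg _) (T.etaD_sq_lt D e)
  have hle : ∀ θ e, |T.etaD D e| / Real.sqrt (T.tau D e * T.tauDual D e) ≤ θ →
      |T.etaD D e| ≤ θ * Real.sqrt (T.tau D e * T.tauDual D e) := fun θ e h =>
    (div_le_iff₀ (Real.sqrt_pos.2 (mul_pos (T.tau_pos D e) (T.tauDual_pos D e)))).1 h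
  rcases isEmpty_or_nonempty (IEdge ⊕ BEdge) with hE | hE
  · exact ⟨0, le_rfl, one_pos, fun e => (hE.false e).elim⟩
  · obtain ⟨e₀, he₀⟩ := Finite.exists_max
      fun e => |T.etaD D e| / Real.sqrt (T.tau D e * T.tauDual D e)
    exact ⟨_, by positivity, hlt e₀, fun e => hle _ e (he₀ e)⟩

omit [Fintype Cell] [Fintype Vert] in
theorem normTau_sq (u : T.Dof → ℝ) :
    T.normTau D u ^ 2 = ∑ e : IEdge ⊕ BEdge,
      (T.tau D e * (u (T.tgt (e, true)) - u (T.src (e, true))) ^ 2 +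
        T.tauDual D e * (u (T.dtgt (e, true)) - u (T.dsrc (e, true))) ^ 2) :=
  Real.sq_sqrt (Finset.sum_nonneg fun e _ =>
    add_nonneg (mul_nonneg (T.tau_pos D e).le (sq_nonneg _))
      (mul_nonneg (T.tauDual_pos D e).le (sq_nonneg _)))

/-- The energy of the scheme: the discrete equations are tested with the primitives of the
inverse densities. -/
noncomputable def energy (dt ε η : ℝ) (p pn : T.State) : ℝ :=
  ∑ α, ∑ A : T.Dof, D.potential α (T.pressure p α A) * T.regRow D dt ε η p pn α A

/-- Integration by parts produces jumps of the potential, which the interface densities turn into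
jumps of the pressure. -/
theorem sum_potential_mul_regRow (dt ε η : ℝ) (p pn : T.State) (α : Fin 2) :
    ∑ A : T.Dof, D.potential α (T.pressure p α A) * T.regRow D dt ε η p pn α A =
      (∑ A : T.Dof, T.poreVolume D A *
        ((D.ρ α (T.pressure p α A) * trunc (T.saturation D p α A) -
        D.ρ α (T.pressure pn α A) * T.saturation D pn α A) * D.potential α (T.pressure p α A))) +
      dt * ∑ e : IEdge ⊕ BEdge,
        ((T.pressure p α (T.tgt (e, true)) - T.pressure p α (T.src (e, true))) *
          (T.velocity D (D.regMobility ε) p α (e, true) +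
            η * (-1) ^ (α : ℕ) * T.capFlow D p (e, true)) +
        (T.pressure p α (T.dtgt (e, true)) - T.pressure p α (T.dsrc (e, true))) *
          (T.velocityDual D (D.regMobility ε) p α (e, true) +
            η * (-1) ^ (α : ℕ) * T.capFlowDual D p (e, true))) := by
  have h1 := T.sum_mul_sumEdges (fun A => D.potential α (T.pressure p α A))
    (T.regFlux D ε η p α) (T.regFlux_flip D ε η p α)
  have h2 := T.sum_mul_sumDualEdges (fun A => D.potential α (T.pressure p α A))
    (T.regFluxDual D ε η p α) (T.regFluxDual_flip D ε η p α)
  have h3 : ∀ e, (D.potential α (T.pressure p α (T.tgt (e, true))) -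
      D.potential α (T.pressure p α (T.src (e, true)))) * T.regFlux D ε η p α (e, true) =
      (T.pressure p α (T.tgt (e, true)) - T.pressure p α (T.src (e, true))) *
          (T.velocity D (D.regMobility ε) p α (e, true) +
            η * (-1) ^ (α : ℕ) * T.capFlow D p (e, true)) := by
    intro e
    rw [← D.interfaceDensity_mul_potential_sub α (T.pressure p α (T.src (e, true)))
      (T.pressure p α (T.tgt (e, true))), regFlux, density]
    ring
  have h4 : ∀ e, (D.potential α (T.pressure p α (T.dtgt (e, true))) -
      D.potential α (T.pressure p α (T.dsrc (e, true)))) * T.regFluxDual D ε η p α (e, true) =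
      (T.pressure p α (T.dtgt (e, true)) - T.pressure p α (T.dsrc (e, true))) *
          (T.velocityDual D (D.regMobility ε) p α (e, true) +
            η * (-1) ^ (α : ℕ) * T.capFlowDual D p (e, true)) := by
    intro e
    rw [← D.interfaceDensity_mul_potential_sub α (T.pressure p α (T.dsrc (e, true)))
      (T.pressure p α (T.dtgt (e, true))), regFluxDual, density]
    ring
  simp only [h3] at h1
  simp only [h4] at h2
  rw [Finset.sum_add_distrib, mul_add]
  have h5 : ∀ A : T.Dof, D.potential α (T.pressure p α A) * T.regRow D dt ε η p pn α A =
      T.poreVolume D A *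
        ((D.ρ α (T.pressure p α A) * trunc (T.saturation D p α A) -
        D.ρ α (T.pressure pn α A) * T.saturation D pn α A) * D.potential α (T.pressure p α A)) -
      dt * (D.potential α (T.pressure p α A) * T.sumEdges A (T.regFlux D ε η p α) +
        D.potential α (T.pressure p α A) * T.sumDualEdges A (T.regFluxDual D ε η p α)) := by
    intro A
    rw [regRow_eq]
    ring
  simp only [h5]
  rw [Finset.sum_sub_distrib, ← Finset.mul_sum, Finset.sum_add_distrib, h1, h2]
  ring

-- As s_w = 1 - s_g, the terms (s - s^n) p of the two phases add up to a saturation difference times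
-- p_g - p_w = p_c(s_g), which the truncation bounds below.
omit [Fintype Cell] [Fintype IEdge] [Fintype BEdge] [Fintype Vert] in
theorem accumulation_energy_ge (p : T.State) {pn : T.State} (hpn : T.MaxPrinciple D pn)
    (A : T.Dof) :
    -(D.pc 1 + ∑ α, (D.ρ α (T.pressure pn α A) * D.potential α (T.pressure pn α A) -
      T.pressure pn α A) * T.saturation D pn α A) ≤
    ∑ α, (D.ρ α (T.pressure p α A) * trunc (T.saturation D p α A) -
        D.ρ α (T.pressure pn α A) * T.saturation D pn α A) * D.potential α (T.pressure p α A) := by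
  have h0 := D.accumulation_mul_potential_ge 0 (p := T.pressure p 0 A) (q := T.pressure pn 0 A)
    (trunc_nonneg (T.saturation D p 0 A)) (hpn 0 A).1
  have h1 := D.accumulation_mul_potential_ge 1 (p := T.pressure p 1 A) (q := T.pressure pn 1 A)
    (trunc_nonneg (T.saturation D p 1 A)) (hpn 1 A).1
  have h2 := D.trunc_sub_mul_pc_ge (hpn 0 A).1 (hpn 0 A).2 (T.saturation D p 0 A)
  have h3 : D.pc (T.saturation D p 0 A) = T.pressure p 0 A - T.pressure p 1 A :=
    D.pc.apply_symm_apply _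
  rw [h3] at h2
  rw [Fin.sum_univ_two, Fin.sum_univ_two]
  rw [T.saturation_one D p, trunc_one_sub, T.saturation_one D pn] at h1 ⊢
  linarith

omit [Fintype Cell] [Fintype IEdge] [Fintype Vert] in
theorem velocity_energy_ge {θ ε : ℝ} (hθ : 0 ≤ θ) (hε : 0 ≤ ε) (e : IEdge ⊕ BEdge)
    (hη : |T.etaD D e| ≤ θ * Real.sqrt (T.tau D e * T.tauDual D e)) (p : T.State) (α : Fin 2) :
    (1 - θ) * ((ε + T.mobUp D D.M p α (T.src (e, true)) (T.tgt (e, true))) * T.tau D e *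
        (T.pressure p α (T.tgt (e, true)) - T.pressure p α (T.src (e, true))) ^ 2 +
      (ε + T.mobUp D D.M p α (T.dsrc (e, true)) (T.dtgt (e, true))) * T.tauDual D e *
        (T.pressure p α (T.dtgt (e, true)) - T.pressure p α (T.dsrc (e, true))) ^ 2) ≤
      (T.pressure p α (T.tgt (e, true)) - T.pressure p α (T.src (e, true))) *
          T.velocity D (D.regMobility ε) p α (e, true) +
        (T.pressure p α (T.dtgt (e, true)) - T.pressure p α (T.dsrc (e, true))) *
          T.velocityDual D (D.regMobility ε) p α (e, true) := by
  have hup : ∀ A B, T.mobUp D (D.regMobility ε) p α A B = ε + T.mobUp D D.M p α A B := by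
    intro A B
    unfold mobUp upwind FlowData.regMobility
    split_ifs <;> rfl
  have hnn : ∀ A B, 0 ≤ ε + T.mobUp D D.M p α A B := fun A B =>
    add_nonneg hε (upwind_nonneg (D.M_nonneg α) _ _ _ _)
  have hmin : ∀ A B, T.mobMin D (D.regMobility ε) p α A B ≤ ε + T.mobUp D D.M p α A B := by
    intro A B
    rw [← hup]
    exact min_le_upwind _ _ _ _ _
  unfold velocity velocityDual
  rw [hup, hup]
  exact upwind_flux_coercive (T.tau_pos D e).le (T.tauDual_pos D e).le hθ hη (hnn _ _) (hnn _ _)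
    (hmin _ _) (hmin _ _) _ _

omit [Fintype Cell] [Fintype IEdge] [Fintype BEdge] [Fintype Vert] in
theorem discreteGlobalPressure_sub_sq_le {m₀ : ℝ} (hm : 0 < m₀)
    (hM : ∀ s, m₀ ≤ D.totalMobility s) (p : T.State) (α : Fin 2) (A B : T.Dof) :
    m₀ * (T.discreteGlobalPressure D p α B - T.discreteGlobalPressure D p α A) ^ 2 ≤
      ∑ β, T.mobUp D D.M p β A B * (T.pressure p β B - T.pressure p β A) ^ 2 := by
  rw [Fin.sum_univ_two]
  exact D.globalPressure_sub_sq_le hm hM α _ _ _ _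

-- The mobility part of the energy is shared between the two expressions of the global pressure,
-- whence m₀ / 2. In `Fin 2`, `1 - α` is the other phase, so each capillary jump is counted twice,
-- whence η / 2.
omit [Fintype Cell] [Fintype IEdge] [Fintype Vert] in
theorem diamond_energy_ge {θ m₀ ε : ℝ} (hθ : 0 ≤ θ) (hθ1 : θ < 1) (hm : 0 < m₀)
    (hM : ∀ s, m₀ ≤ D.totalMobility s) (hε : 0 ≤ ε) (η : ℝ) (e : IEdge ⊕ BEdge)
    (hη : |T.etaD D e| ≤ θ * Real.sqrt (T.tau D e * T.tauDual D e)) (p : T.State) :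
    (1 - θ) * (m₀ / 2) * ∑ α, (T.tau D e * (T.discreteGlobalPressure D p α (T.tgt (e, true)) -
          T.discreteGlobalPressure D p α (T.src (e, true))) ^ 2 +
        T.tauDual D e * (T.discreteGlobalPressure D p α (T.dtgt (e, true)) -
          T.discreteGlobalPressure D p α (T.dsrc (e, true))) ^ 2) +
      (1 - θ) * ε * ∑ α, (T.tau D e * (T.pressure p α (T.tgt (e, true)) -
          T.pressure p α (T.src (e, true))) ^ 2 +
        T.tauDual D e * (T.pressure p α (T.dtgt (e, true)) -
          T.pressure p α (T.dsrc (e, true))) ^ 2) +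
      η / 2 * ∑ α, (T.tau D e * ((T.pressure p α - T.pressure p (1 - α)) (T.tgt (e, true)) -
          (T.pressure p α - T.pressure p (1 - α)) (T.src (e, true))) ^ 2 +
        T.tauDual D e * ((T.pressure p α - T.pressure p (1 - α)) (T.dtgt (e, true)) -
          (T.pressure p α - T.pressure p (1 - α)) (T.dsrc (e, true))) ^ 2) ≤
    ∑ α : Fin 2, ((T.pressure p α (T.tgt (e, true)) - T.pressure p α (T.src (e, true))) *
          (T.velocity D (D.regMobility ε) p α (e, true) +
            η * (-1) ^ (α : ℕ) * T.capFlow D p (e, true)) +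
        (T.pressure p α (T.dtgt (e, true)) - T.pressure p α (T.dsrc (e, true))) *
          (T.velocityDual D (D.regMobility ε) p α (e, true) +
            η * (-1) ^ (α : ℕ) * T.capFlowDual D p (e, true))) := by
  have hτ := (T.tau_pos D e).le
  have hτ' := (T.tauDual_pos D e).le
  have v0 := T.velocity_energy_ge D hθ hε e hη p 0
  have v1 := T.velocity_energy_ge D hθ hε e hη p 1
  have k1 : 0 ≤ (1 - θ) * T.tau D e / 2 := by
    have : 0 < 1 - θ := sub_pos.2 hθ1
    positivity
  have k2 : 0 ≤ (1 - θ) * T.tauDual D e / 2 := by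
    have : 0 < 1 - θ := sub_pos.2 hθ1
    positivity
  have g := fun α A B => T.discreteGlobalPressure_sub_sq_le D hm hM p α A B
  simp only [Fin.sum_univ_two] at g
  have g0 := mul_le_mul_of_nonneg_left (g 0 (T.src (e, true)) (T.tgt (e, true))) k1
  have g1 := mul_le_mul_of_nonneg_left (g 1 (T.src (e, true)) (T.tgt (e, true))) k1
  have g2 := mul_le_mul_of_nonneg_left (g 0 (T.dsrc (e, true)) (T.dtgt (e, true))) k2
  have g3 := mul_le_mul_of_nonneg_left (g 1 (T.dsrc (e, true)) (T.dtgt (e, true))) k2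
  have c1 : T.capFlow D p (e, true) = T.tau D e *
    ((T.pressure p 0 (T.tgt (e, true)) - T.pressure p 1 (T.tgt (e, true))) -
      (T.pressure p 0 (T.src (e, true)) - T.pressure p 1 (T.src (e, true)))) := rfl
  have c2 : T.capFlowDual D p (e, true) = T.tauDual D e *
    ((T.pressure p 0 (T.dtgt (e, true)) - T.pressure p 1 (T.dtgt (e, true))) -
      (T.pressure p 0 (T.dsrc (e, true)) - T.pressure p 1 (T.dsrc (e, true)))) := rfl
  rw [c1, c2]
  simp only [Fin.sum_univ_two, Pi.sub_apply, sub_zero, sub_self, Fin.val_zero, Fin.val_one,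
    pow_zero, pow_one]
  linarith

/-- Arbitrary states p are allowed, not only solutions, because the existence proof needs the sign
of the energy on a whole sphere. -/
theorem exists_energy_ge {dt : ℝ} (hdt : 0 < dt) {pn : T.State} (hpn : T.MaxPrinciple D pn) :
    ∃ κ > 0, ∃ C, ∀ ε η : ℝ, 0 ≤ ε → 0 ≤ η → ∀ p : T.State,
      κ * (∑ α, T.normTau D (T.discreteGlobalPressure D p α) ^ 2 +
            ε * ∑ α, T.normTau D (T.pressure p α) ^ 2 +
            η * ∑ α, T.normTau D (T.pressure p α - T.pressure p (1 - α)) ^ 2) ≤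
        C + T.energy D dt ε η p pn := by
  obtain ⟨θ, hθ, hθ1, hη⟩ := T.exists_etaD_le D
  obtain ⟨m₀, hm, hM⟩ := D.exists_totalMobility_ge
  have h1θ : 0 < 1 - θ := sub_pos.2 hθ1
  obtain ⟨κ, hκ, hκ1, hκ2, hκ3⟩ : ∃ κ > 0, κ ≤ dt * ((1 - θ) * (m₀ / 2)) ∧ κ ≤ dt * (1 - θ) ∧
      κ ≤ dt / 2 :=
    ⟨min (dt * ((1 - θ) * (m₀ / 2))) (min (dt * (1 - θ)) (dt / 2)), by positivity,
      min_le_left _ _, (min_le_right _ _).trans (min_le_left _ _),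
      (min_le_right _ _).trans (min_le_right _ _)⟩
  refine ⟨κ, hκ, ∑ A : T.Dof, T.poreVolume D A * (D.pc 1 + ∑ α,
    (D.ρ α (T.pressure pn α A) * D.potential α (T.pressure pn α A) -
      T.pressure pn α A) * T.saturation D pn α A), fun ε η hε hη0 p => ?_⟩
  have hacc : -(∑ A : T.Dof, T.poreVolume D A * (D.pc 1 + ∑ α,
      (D.ρ α (T.pressure pn α A) * D.potential α (T.pressure pn α A) -
      T.pressure pn α A) * T.saturation D pn α A)) ≤
      ∑ α, ∑ A : T.Dof, T.poreVolume D A *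
        ((D.ρ α (T.pressure p α A) * trunc (T.saturation D p α A) -
        D.ρ α (T.pressure pn α A) * T.saturation D pn α A) * D.potential α (T.pressure p α A)) := by
    rw [Finset.sum_comm, ← Finset.sum_neg_distrib]
    refine Finset.sum_le_sum fun A _ => ?_
    rw [← Finset.mul_sum, ← mul_neg]
    exact mul_le_mul_of_nonneg_left (T.accumulation_energy_ge D p hpn A) (T.poreVolume_nonneg D A)
  have hdia := Finset.sum_le_sum fun (e : IEdge ⊕ BEdge) (_ : e ∈ Finset.univ) =>
    T.diamond_energy_ge D hθ hθ1 hm hM hε η e (hη e) p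
  have hE : T.energy D dt ε η p pn = _ :=
    Finset.sum_congr rfl fun α _ => T.sum_potential_mul_regRow D dt ε η p pn α
  rw [Finset.sum_add_distrib, ← Finset.mul_sum,
    Finset.sum_comm (s := (Finset.univ : Finset (Fin 2)))
      (t := (Finset.univ : Finset (IEdge ⊕ BEdge)))] at hE
  have hnorm : ∀ u : Fin 2 → T.Dof → ℝ, ∑ e : IEdge ⊕ BEdge, ∑ α,
      (T.tau D e * (u α (T.tgt (e, true)) - u α (T.src (e, true))) ^ 2 +
        T.tauDual D e * (u α (T.dtgt (e, true)) - u α (T.dsrc (e, true))) ^ 2) =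
      ∑ α, T.normTau D (u α) ^ 2 := fun u => by
    rw [Finset.sum_comm]
    exact Finset.sum_congr rfl fun α _ => (T.normTau_sq D (u α)).symm
  have e1 := hnorm (T.discreteGlobalPressure D p)
  have e2 := hnorm (T.pressure p)
  have e3 := hnorm fun α => T.pressure p α - T.pressure p (1 - α)
  rw [Finset.sum_add_distrib, Finset.sum_add_distrib, ← Finset.mul_sum, ← Finset.mul_sum,
    ← Finset.mul_sum, e1, e2, e3] at hdia
  have hdia' := mul_le_mul_of_nonneg_left hdia hdt.le
  have n1 := mul_le_mul_of_nonneg_right hκ1 (Finset.sum_nonneg fun (α : Fin 2) (_ : α ∈ Finset.univ) =>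
    sq_nonneg (T.normTau D (T.discreteGlobalPressure D p α)))
  have n2 := mul_le_mul_of_nonneg_right hκ2 (mul_nonneg hε (Finset.sum_nonneg
    fun (α : Fin 2) (_ : α ∈ Finset.univ) => sq_nonneg (T.normTau D (T.pressure p α))))
  have n3 := mul_le_mul_of_nonneg_right hκ3 (mul_nonneg hη0 (Finset.sum_nonneg
    fun (α : Fin 2) (_ : α ∈ Finset.univ) =>
      sq_nonneg (T.normTau D (T.pressure p α - T.pressure p (1 - α)))))
  rw [hE]
  linarith

theorem energy_eq_zero {dt ε η : ℝ} {p pn : T.State} (h : T.regScheme D dt ε η p pn = 0) :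
    T.energy D dt ε η p pn = 0 := by
  refine Finset.sum_eq_zero fun α _ => Finset.sum_eq_zero fun A _ => ?_
  by_cases hA : T.IsDir A
  · rw [T.pressure_of_isDir p α hA, D.potential_zero, zero_mul]
  · have : T.regRow D dt ε η p pn α A = 0 := congrFun (congrFun h α) ⟨A, hA⟩
    rw [this, mul_zero]

/-- The discrete norm controls the values of a discrete function that vanishes at the Dirichlet
degrees of freedom. -/
theorem exists_abs_le_mul_normTau : ∃ K > 0, ∀ u : T.Dof → ℝ, (∀ A, T.IsDir A → u A = 0) →
    ∀ A, |u A| ≤ K * T.normTau D u := by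
  classical
  have hfin : Finite T.FreeDof := inferInstance
  -- The Boolean selects here the primal or the dual jump, not an orientation. An injective linear
  -- map on a finite-dimensional space is bounded below, and `normTau` dominates each component.
  let L : (T.FreeDof → ℝ) →ₗ[ℝ] ((IEdge ⊕ BEdge) × Bool → ℝ) :=
    { toFun := fun v d => if d.2 then
          Real.sqrt (T.tau D d.1) * (T.ext v (T.tgt (d.1, true)) - T.ext v (T.src (d.1, true)))
        else Real.sqrt (T.tauDual D d.1) *
          (T.ext v (T.dtgt (d.1, true)) - T.ext v (T.dsrc (d.1, true)))
      map_add' := fun v w => by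
        have h : ∀ A, T.ext (v + w) A = T.ext v A + T.ext w A := fun A => by
          unfold ext; split_ifs <;> simp
        funext d
        simp only [h, Pi.add_apply]
        split_ifs <;> ring
      map_smul' := fun c v => by
        have h : ∀ A, T.ext (c • v) A = c * T.ext v A := fun A => by
          unfold ext; split_ifs <;> simp
        funext d
        simp only [h, Pi.smul_apply, smul_eq_mul, RingHom.id_apply]
        split_ifs <;> ring }
  have hinj : Function.Injective L := by
    rw [injective_iff_map_eq_zero]
    intro v hv
    have h := T.eq_zero_of_forall_edge (T.ext v)
      (fun e => by
        have h1 : Real.sqrt (T.tau D e) *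
          (T.ext v (T.tgt (e, true)) - T.ext v (T.src (e, true))) = 0 := congrFun hv (e, true)
        exact sub_eq_zero.1 ((mul_eq_zero.1 h1).resolve_left (Real.sqrt_pos.2 (T.tau_pos D e)).ne'))
      (fun e => by
        have h1 : Real.sqrt (T.tauDual D e) *
          (T.ext v (T.dtgt (e, true)) - T.ext v (T.dsrc (e, true))) = 0 := congrFun hv (e, false)
        exact sub_eq_zero.1 ((mul_eq_zero.1 h1).resolve_left
          (Real.sqrt_pos.2 (T.tauDual_pos D e)).ne'))
      (fun A hA => dif_pos hA)
    funext A
    have := h A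
    rwa [ext, dif_neg A.2] at this
  obtain ⟨K, hK, hKL⟩ := L.injective_iff_antilipschitz.1 hinj
  refine ⟨K, hK, fun u hu A => ?_⟩
  have hext : T.ext (fun A => u A) = u := by
    funext A
    unfold ext
    split_ifs with h
    · exact (hu A h).symm
    · rfl
  have hLu : ‖L fun A => u A‖ ≤ T.normTau D u := by
    refine (pi_norm_le_iff_of_nonneg (Real.sqrt_nonneg _)).2 fun d => ?_
    refine Real.le_sqrt_of_sq_le ?_
    have h1 : (L fun A => u A) d = if d.2 then
          Real.sqrt (T.tau D d.1) * (u (T.tgt (d.1, true)) - u (T.src (d.1, true)))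
        else Real.sqrt (T.tauDual D d.1) *
          (u (T.dtgt (d.1, true)) - u (T.dsrc (d.1, true))) := by
      conv_rhs => rw [← hext]
      rfl
    have hτ := (T.tau_pos D d.1).le
    have hτ' := (T.tauDual_pos D d.1).le
    refine le_trans ?_ (Finset.single_le_sum (f := fun e : IEdge ⊕ BEdge =>
      T.tau D e * (u (T.tgt (e, true)) - u (T.src (e, true))) ^ 2 +
        T.tauDual D e * (u (T.dtgt (e, true)) - u (T.dsrc (e, true))) ^ 2)
      (fun e _ => add_nonneg (mul_nonneg (T.tau_pos D e).le (sq_nonneg _))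
        (mul_nonneg (T.tauDual_pos D e).le (sq_nonneg _))) (Finset.mem_univ d.1))
    rw [h1, Real.norm_eq_abs, sq_abs]
    split_ifs
    · rw [mul_pow, Real.sq_sqrt hτ]
      exact le_add_of_nonneg_right (mul_nonneg hτ' (sq_nonneg _))
    · rw [mul_pow, Real.sq_sqrt hτ']
      exact le_add_of_nonneg_left (mul_nonneg hτ (sq_nonneg _))
  by_cases hA : T.IsDir A
  · rw [hu A hA, abs_zero]
    exact mul_nonneg K.2 (Real.sqrt_nonneg _)
  · have h1 := hKL.le_mul_dist (fun A => u A) 0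
    rw [map_zero, dist_zero_right, dist_zero_right] at h1
    have h2 : |u A| ≤ ‖fun A : T.FreeDof => u A‖ := norm_le_pi_norm (fun A : T.FreeDof => u A) ⟨A, hA⟩
    exact h2.trans (h1.trans (mul_le_mul_of_nonneg_left hLu K.2))

end Fintype

end DDFVMesh

namespace DDFVMesh

variable {Cell IEdge BEdge Vert : Type*} (T : DDFVMesh Cell IEdge BEdge Vert) (D : FlowData T.Ω)
variable [Fintype Cell] [Fintype IEdge] [Fintype BEdge] [Fintype Vert]

/-! ### A priori bounds -/

theorem exists_energy_estimate {dt : ℝ} (hdt : 0 < dt) {pn : T.State}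
    (hpn : T.MaxPrinciple D pn) :
    ∃ C : ℝ, 0 ≤ C ∧ ∀ ε η : ℝ, 0 ≤ ε → 0 ≤ η → ∀ p : T.State,
      T.regScheme D dt ε η p pn = 0 →
      ∑ α, T.normTau D (T.discreteGlobalPressure D p α) ^ 2 +
            ε * ∑ α, T.normTau D (T.pressure p α) ^ 2 +
            η * ∑ α, T.normTau D (T.pressure p α - T.pressure p (1 - α)) ^ 2 ≤ C := by
  obtain ⟨κ, hκ, C, hC⟩ := T.exists_energy_ge D hdt hpn
  refine ⟨max 0 (C / κ), le_max_left _ _, fun ε η hε hη p hp => le_trans ?_ (le_max_right _ _)⟩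
  have h := hC ε η hε hη p
  rw [T.energy_eq_zero D hp, add_zero] at h
  rw [le_div_iff₀ hκ]
  linarith

omit [Fintype Cell] [Fintype IEdge] [Fintype BEdge] [Fintype Vert] in
theorem discreteGlobalPressure_of_isDir (p : T.State) (α : Fin 2) {A : T.Dof} (h : T.IsDir A) :
    T.discreteGlobalPressure D p α A = 0 := by
  unfold discreteGlobalPressure
  rw [D.globalPressure_eq, T.pressure_of_isDir p 0 h, T.pressure_of_isDir p 1 h, sub_zero]
  have h0 : D.pc.symm 0 = 0 := by rw [OrderIso.symm_apply_eq, D.pc_zero]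
  rw [h0, FlowData.corrective, intervalIntegral.integral_same, add_zero]

-- The global pressure is p_w plus a continuous function of p_g - p_w, so a bound on p_g - p_w and
-- one on the global pressure recover both pressures.
omit [Fintype Cell] [Fintype IEdge] [Fintype BEdge] [Fintype Vert] in
theorem exists_abs_le (B Z : ℝ) : ∃ R : ℝ, ∀ p : T.State,
    (∀ A, |T.pressure p 0 A - T.pressure p 1 A| ≤ B) →
    (∀ A, |T.discreteGlobalPressure D p 1 A| ≤ Z) → ∀ α A, |p α A| ≤ R := by
  obtain ⟨k, hk, hg⟩ := D.exists_globalPressure_eq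
  obtain ⟨Kb, hKb⟩ := (isCompact_Icc (a := -B) (b := B)).exists_bound_of_continuousOn hk.continuousOn
  refine ⟨|B| + |Z| + |Kb|, fun p hpB hpZ α A => ?_⟩
  have hw : ∀ A, |T.pressure p 1 A| ≤ |Z| + |Kb| := by
    intro A
    have h1 : T.pressure p 1 A = T.discreteGlobalPressure D p 1 A -
        k (T.pressure p 0 A - T.pressure p 1 A) := by
      rw [discreteGlobalPressure, hg]; ring
    have h2 := hKb _ (abs_le.1 (hpB A))
    rw [Real.norm_eq_abs] at h2
    rw [h1]
    exact (abs_sub _ _).trans (add_le_add ((hpZ A).trans (le_abs_self Z)) (h2.trans (le_abs_self Kb)))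
  have hgas : ∀ A, |T.pressure p 0 A| ≤ |B| + |Z| + |Kb| := by
    intro A
    have h1 : T.pressure p 0 A = (T.pressure p 0 A - T.pressure p 1 A) + T.pressure p 1 A := by ring
    rw [h1, add_assoc]
    exact (abs_add_le _ _).trans (add_le_add ((hpB A).trans (le_abs_self B)) (hw A))
  rw [← T.pressure_free p α A]
  fin_cases α
  · exact hgas A
  · exact (hw A).trans (by rw [add_assoc]; exact le_add_of_nonneg_left (abs_nonneg B))

omit [Fintype Cell] [Fintype Vert] in
theorem abs_discreteGlobalPressure_le {K C : ℝ} (hK : 0 < K)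
    (hKu : ∀ u : T.Dof → ℝ, (∀ A, T.IsDir A → u A = 0) → ∀ A, |u A| ≤ K * T.normTau D u)
    {p : T.State} (h : ∑ α, T.normTau D (T.discreteGlobalPressure D p α) ^ 2 ≤ C) (A : T.Dof) :
    |T.discreteGlobalPressure D p 1 A| ≤ K * Real.sqrt C := by
  refine (hKu _ (fun B hB => T.discreteGlobalPressure_of_isDir D p 1 hB) A).trans ?_
  refine mul_le_mul_of_nonneg_left (Real.le_sqrt_of_sq_le ?_) hK.le
  exact (Finset.single_le_sum (f := fun α => T.normTau D (T.discreteGlobalPressure D p α) ^ 2)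
    (fun α _ => sq_nonneg _) (Finset.mem_univ 1)).trans h

/-! ### Existence -/

/-- With the potentials as unknowns the inner product ⟨F x, x⟩ is the energy, and the ε-term makes
it nonnegative on a large sphere. -/
theorem exists_regScheme_eq_zero {dt ε η : ℝ} (hdt : 0 < dt) (hε : 0 < ε) (hη : 0 ≤ η)
    {pn : T.State} (hpn : T.MaxPrinciple D pn) : ∃ p, T.regScheme D dt ε η p pn = 0 := by
  classical
  have : Fintype T.FreeDof := Fintype.ofFinite _
  have : Fintype {A : T.Dof // T.IsDir A} := Fintype.ofFinite _
  obtain ⟨κ, hκ, C, hC⟩ := T.exists_energy_ge D hdt hpn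
  obtain ⟨K, hK, hKu⟩ := T.exists_abs_le_mul_normTau D
  obtain ⟨c, hc, hcp⟩ := D.exists_abs_potential_le
  let E := EuclideanSpace ℝ (Fin 2 × T.FreeDof)
  let Φ : E → T.State := fun x α A => (D.potentialIso α).symm (x (α, A))
  have hΦ : Continuous Φ := continuous_pi fun α => continuous_pi fun A =>
    (D.potentialIso α).symm.continuous.comp
      ((continuous_apply (α, A)).comp (PiLp.continuous_ofLp 2 _))
  let F : E → E := fun x => WithLp.toLp 2 fun i => T.regScheme D dt ε η (Φ x) pn i.1 i.2
  have hF : Continuous F := by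
    refine (PiLp.continuous_toLp 2 _).comp (continuous_pi fun i => ?_)
    have h1 : Continuous fun x : E => T.regScheme D dt ε η (Φ x) pn :=
      (T.continuous_regScheme D dt pn).comp
        (continuous_const.prodMk (continuous_const.prodMk hΦ))
    exact (continuous_apply i.2).comp ((continuous_apply i.1).comp h1)
  have hinner : ∀ x, inner ℝ (F x) x = T.energy D dt ε η (Φ x) pn := by
    intro x
    have hpot : ∀ (α : Fin 2) (A : T.FreeDof),
        D.potential α (T.pressure (Φ x) α A) = x (α, A) := fun α A => by
      rw [T.pressure_free]
      exact D.potential_potentialIso_symm α _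
    rw [PiLp.inner_apply, Fintype.sum_prod_type]
    refine Finset.sum_congr rfl fun α _ => ?_
    have hsplit := Fintype.sum_subtype_add_sum_subtype T.IsDir
      fun A => D.potential α (T.pressure (Φ x) α A) * T.regRow D dt ε η (Φ x) pn α A
    have hdir : ∀ A : {A : T.Dof // T.IsDir A},
        D.potential α (T.pressure (Φ x) α A) * T.regRow D dt ε η (Φ x) pn α A = 0 := fun A => by
      rw [T.pressure_of_isDir _ α A.2, D.potential_zero, zero_mul]
    simp only [hdir, Finset.sum_const_zero, zero_add] at hsplit
    rw [← hsplit]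
    refine Finset.sum_congr (by ext; simp) fun A _ => ?_
    rw [hpot]
    rfl
  -- Adding 1 keeps N positive even without free degrees of freedom.
  let N : ℝ := Fintype.card T.FreeDof + 1
  have hN : 0 < N := by positivity
  have hnorm : ∀ x : E, c ^ 2 * ‖x‖ ^ 2 ≤ N * K ^ 2 * ∑ α, T.normTau D (T.pressure (Φ x) α) ^ 2 := by
    intro x
    rw [EuclideanSpace.norm_sq_eq, Fintype.sum_prod_type, Finset.mul_sum, Finset.mul_sum]
    refine Finset.sum_le_sum fun α _ => ?_
    have hpt : ∀ A : T.FreeDof, c ^ 2 * ‖x (α, A)‖ ^ 2 ≤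
        K ^ 2 * T.normTau D (T.pressure (Φ x) α) ^ 2 := by
      intro A
      have h1 := hcp α (T.pressure (Φ x) α A)
      rw [T.pressure_free, show D.potential α (Φ x α A) = x (α, A) from
        D.potential_potentialIso_symm α _, ← T.pressure_free (Φ x) α A] at h1
      have h2 := h1.trans (hKu _ (fun B hB => T.pressure_of_isDir (Φ x) α hB) A)
      rw [← mul_pow, ← mul_pow]
      exact pow_le_pow_left₀ (by positivity) h2 2
    rw [Finset.mul_sum]
    calc ∑ A : T.FreeDof, c ^ 2 * ‖x (α, A)‖ ^ 2
        ≤ ∑ _ : T.FreeDof, K ^ 2 * T.normTau D (T.pressure (Φ x) α) ^ 2 :=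
          Finset.sum_le_sum fun A _ => hpt A
      _ = Fintype.card T.FreeDof * (K ^ 2 * T.normTau D (T.pressure (Φ x) α) ^ 2) := by
          rw [Finset.sum_const, nsmul_eq_mul, Finset.card_univ]
      _ ≤ N * (K ^ 2 * T.normTau D (T.pressure (Φ x) α) ^ 2) := by
          refine mul_le_mul_of_nonneg_right ?_ (by positivity)
          exact le_add_of_nonneg_right zero_le_one
      _ = N * K ^ 2 * T.normTau D (T.pressure (Φ x) α) ^ 2 := by ring
  -- R ≥ 1 gives R ≤ R², so a condition linear in R suffices for the quadratic lower bound.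
  obtain ⟨R, hR1, hR⟩ : ∃ R : ℝ, 1 ≤ R ∧ C * (N * K ^ 2) ≤ κ * ε * c ^ 2 * R := by
    have hpos : 0 < κ * ε * c ^ 2 := by positivity
    refine ⟨max 1 (C * (N * K ^ 2) / (κ * ε * c ^ 2)), le_max_left _ _, ?_⟩
    rw [← div_le_iff₀' hpos]
    exact le_max_right _ _
  obtain ⟨x, -, hx⟩ := exists_zero_of_continuous_of_inner_nonneg (by linarith : 0 < R) hF (by
    intro x hx
    rw [hinner]
    have h1 := hC ε η hε.le hη (Φ x)
    have h2 := hnorm x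
    rw [hx] at h2
    have h3 : 0 ≤ ∑ α, T.normTau D (T.discreteGlobalPressure D (Φ x) α) ^ 2 :=
      Finset.sum_nonneg fun α _ => sq_nonneg _
    have h4 : 0 ≤ η * ∑ α, T.normTau D (T.pressure (Φ x) α - T.pressure (Φ x) (1 - α)) ^ 2 :=
      mul_nonneg hη (Finset.sum_nonneg fun α _ => sq_nonneg _)
    have h5 : κ * (ε * ∑ α, T.normTau D (T.pressure (Φ x) α) ^ 2) ≤
        C + T.energy D dt ε η (Φ x) pn := by
      refine le_trans (mul_le_mul_of_nonneg_left ?_ hκ.le) h1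
      linarith
    have h6 : C * (N * K ^ 2) ≤ (C + T.energy D dt ε η (Φ x) pn) * (N * K ^ 2) := by
      calc C * (N * K ^ 2) ≤ κ * ε * c ^ 2 * R := hR
        _ ≤ κ * ε * c ^ 2 * R ^ 2 := by
            refine mul_le_mul_of_nonneg_left ?_ (by positivity)
            nlinarith
        _ = κ * ε * (c ^ 2 * R ^ 2) := by ring
        _ ≤ κ * ε * (N * K ^ 2 * ∑ α, T.normTau D (T.pressure (Φ x) α) ^ 2) :=
            mul_le_mul_of_nonneg_left h2 (by positivity)
        _ = κ * (ε * ∑ α, T.normTau D (T.pressure (Φ x) α) ^ 2) * (N * K ^ 2) := by ring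
        _ ≤ _ := mul_le_mul_of_nonneg_right h5 (by positivity)
    have h7 := le_of_mul_le_mul_right h6 (by positivity)
    linarith)
  refine ⟨Φ x, ?_⟩
  funext α A
  exact congrArg (fun y : E => y (α, A)) hx

omit [Fintype Cell] [Fintype Vert] in
theorem exists_limit_solution [Finite Cell] [Finite Vert] (dt : ℝ) (pn : T.State) {S : Set T.State}
    (hS : IsClosed S) {R : ℝ} {e h : ℕ → ℝ} {ε η : ℝ} (he : Tendsto e atTop (𝓝 ε))
    (hh : Tendsto h atTop (𝓝 η))
    (hsol : ∀ n, ∃ p ∈ S, (∀ α A, |p α A| ≤ R) ∧ T.regScheme D dt (e n) (h n) p pn = 0) :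
    ∃ p ∈ S, T.regScheme D dt ε η p pn = 0 := by
  choose p hpS hpR hp using hsol
  have hcomp : IsCompact (univ.pi fun _ => univ.pi fun _ => Icc (-R) R : Set T.State) :=
    isCompact_univ_pi fun _ => isCompact_univ_pi fun _ => isCompact_Icc
  obtain ⟨q, hq, φ, hφ, hlim⟩ := (hcomp.inter_right hS).tendsto_subseq
    (x := p) fun n => ⟨fun α _ A _ => abs_le.1 (hpR n α A), hpS n⟩
  refine ⟨q, hq.2, ?_⟩
  have h1 : Tendsto (fun n => (e (φ n), h (φ n), p (φ n))) atTop (𝓝 (ε, η, q)) :=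
    (he.comp hφ.tendsto_atTop).prodMk_nhds ((hh.comp hφ.tendsto_atTop).prodMk_nhds hlim)
  have h2 := ((T.continuous_regScheme D dt pn).tendsto _).comp h1
  refine tendsto_nhds_unique h2 ?_
  refine tendsto_const_nhds.congr fun n => ?_
  exact (hp (φ n)).symm

/-- Limit ε → 0: the η-term of the estimate bounds p_g - p_w independently of ε. -/
theorem exists_regScheme_zero_left {dt η : ℝ} (hdt : 0 < dt) (hη : 0 < η)
    {pn : T.State} (hpn : T.MaxPrinciple D pn) : ∃ p, T.regScheme D dt 0 η p pn = 0 := by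
  obtain ⟨C, hC0, hC⟩ := T.exists_energy_estimate D hdt hpn
  obtain ⟨K, hK, hKu⟩ := T.exists_abs_le_mul_normTau D
  obtain ⟨R, hR⟩ := T.exists_abs_le D (K * Real.sqrt (C / η)) (K * Real.sqrt C)
  obtain ⟨p, -, hp⟩ := T.exists_limit_solution D dt pn isClosed_univ (R := R)
    tendsto_one_div_add_atTop_nhds_zero_nat (tendsto_const_nhds (x := η)) fun n => by
      have hn : (0 : ℝ) < 1 / ((n : ℝ) + 1) := Nat.one_div_pos_of_nat
      obtain ⟨p, hp⟩ := T.exists_regScheme_eq_zero D hdt hn hη.le hpn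
      refine ⟨p, mem_univ _, hR p ?_ ?_, hp⟩
      all_goals
        have h1 := hC _ _ hn.le hη.le p hp
        have n1 : 0 ≤ ∑ α, T.normTau D (T.discreteGlobalPressure D p α) ^ 2 :=
          Finset.sum_nonneg fun α _ => sq_nonneg _
        have n2 : 0 ≤ 1 / ((n : ℝ) + 1) * ∑ α, T.normTau D (T.pressure p α) ^ 2 :=
          mul_nonneg hn.le (Finset.sum_nonneg fun α _ => sq_nonneg _)
        have n3 : 0 ≤ η * ∑ α, T.normTau D (T.pressure p α - T.pressure p (1 - α)) ^ 2 :=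
          mul_nonneg hη.le (Finset.sum_nonneg fun α _ => sq_nonneg _)
      · intro A
        have h2 := hKu (T.pressure p 0 - T.pressure p 1) (fun B hB => by
          rw [Pi.sub_apply, T.pressure_of_isDir p 0 hB, T.pressure_of_isDir p 1 hB, sub_zero]) A
        refine h2.trans (mul_le_mul_of_nonneg_left (Real.le_sqrt_of_sq_le ?_) hK.le)
        rw [le_div_iff₀' hη]
        refine le_trans (mul_le_mul_of_nonneg_left ?_ hη.le)
          (by linarith : η * ∑ α, T.normTau D (T.pressure p α - T.pressure p (1 - α)) ^ 2 ≤ C)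
        exact Finset.single_le_sum
          (f := fun α => T.normTau D (T.pressure p α - T.pressure p (1 - α)) ^ 2)
          (fun α _ => sq_nonneg _) (Finset.mem_univ 0)
      · exact T.abs_discreteGlobalPressure_le D hK hKu (by linarith)
  exact ⟨p, hp⟩

omit [Fintype Cell] [Fintype IEdge] [Fintype BEdge] [Fintype Vert] in
theorem isClosed_maxPrinciple : IsClosed {p : T.State | T.MaxPrinciple D p} := by
  simp only [MaxPrinciple, ofPred_forall]
  refine isClosed_iInter fun α => isClosed_iInter fun A => ?_
  exact (isClosed_le continuous_const (T.continuous_saturation D α A)).inter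
    (isClosed_le (T.continuous_saturation D α A) continuous_const)

/-- Limit η → 0: the η-term degenerates, but the maximum principle gives 0 ≤ p_g - p_w ≤ p_c(1), and
it is a closed condition, inherited by the limit. -/
theorem exists_ppScheme_eq_zero {dt : ℝ} (hdt : 0 < dt) {pn : T.State}
    (hpn : T.MaxPrinciple D pn) : ∃ p, T.ppScheme D dt p pn = 0 ∧ T.MaxPrinciple D p := by
  obtain ⟨C, hC0, hC⟩ := T.exists_energy_estimate D hdt hpn
  obtain ⟨K, hK, hKu⟩ := T.exists_abs_le_mul_normTau D
  obtain ⟨R, hR⟩ := T.exists_abs_le D (D.pc 1) (K * Real.sqrt C)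
  obtain ⟨p, hpM, hp⟩ := T.exists_limit_solution D dt pn (T.isClosed_maxPrinciple D) (R := R)
    (tendsto_const_nhds (x := (0 : ℝ))) tendsto_one_div_add_atTop_nhds_zero_nat fun n => by
      have hn : (0 : ℝ) < 1 / ((n : ℝ) + 1) := Nat.one_div_pos_of_nat
      obtain ⟨p, hp⟩ := T.exists_regScheme_zero_left D hdt hn hpn
      have hmax := T.maxPrinciple_of_regScheme_eq_zero D hdt hn hpn hp
      refine ⟨p, hmax, hR p ?_ ?_, hp⟩
      · intro A
        have h0 : D.pc (T.saturation D p 0 A) = T.pressure p 0 A - T.pressure p 1 A :=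
          D.pc.apply_symm_apply _
        have h1 := D.pc.monotone (hmax 0 A).1
        have h2 := D.pc.monotone (hmax 0 A).2
        rw [D.pc_zero] at h1
        rw [← h0, abs_of_nonneg h1]
        exact h2
      · have h1 := hC _ _ le_rfl hn.le p hp
        have n3 : 0 ≤ 1 / ((n : ℝ) + 1) *
            ∑ α, T.normTau D (T.pressure p α - T.pressure p (1 - α)) ^ 2 :=
          mul_nonneg hn.le (Finset.sum_nonneg fun α _ => sq_nonneg _)
        exact T.abs_discreteGlobalPressure_le D hK hKu (by linarith)
  exact ⟨p, by rw [← T.regScheme_zero_zero D dt p pn]; exact hp, hpM⟩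

end DDFVMesh

theorem mainTheorem2 {Cell IEdge BEdge Vert : Type*}
    [Fintype Cell] [Fintype IEdge] [Fintype BEdge] [Fintype Vert]
    (T : DDFVMesh Cell IEdge BEdge Vert) (D : FlowData T.Ω) :
    -- one time step, from any previous state with admissible saturations
    (∀ dt : ℝ, 0 < dt → ∀ pn : T.State, T.MaxPrinciple D pn →
      -- (P.a)
      ContinuousOn (fun q : ℝ × ℝ × T.State => T.regScheme D dt q.1 q.2.1 q.2.2 pn)
        {q | 0 ≤ q.1 ∧ 0 ≤ q.2.1} ∧
      -- (P.b)
      (∀ p : T.State, T.regScheme D dt 0 0 p pn = T.ppScheme D dt p pn) ∧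
      -- (P.c)
      (∀ η : ℝ, 0 < η → ∀ p : T.State, T.regScheme D dt 0 η p pn = 0 → T.MaxPrinciple D p) ∧
      -- (P.d)
      (∀ η : ℝ, 0 < η → ∃ C : ℝ, ∀ ε : ℝ, 0 < ε → ∀ p : T.State,
        T.regScheme D dt ε η p pn = 0 →
          ∑ α, T.normTau D (T.discreteGlobalPressure D p α) ^ 2 +
            ε * ∑ α, T.normTau D (T.pressure p α) ^ 2 +
            η * ∑ α, T.normTau D (T.pressure p α - T.pressure p (1 - α)) ^ 2 ≤ C) ∧
      -- (P.e)
      (∃ C : ℝ, ∀ η : ℝ, 0 < η → ∀ p : T.State, T.regScheme D dt 0 η p pn = 0 →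
        ∑ α, T.normTau D (T.discreteGlobalPressure D p α) ^ 2 ≤ C) ∧
      -- the regularized scheme has a solution
      (∀ ε η : ℝ, 0 < ε → 0 < η → ∃ p : T.State, T.regScheme D dt ε η p pn = 0) ∧
      -- the original scheme has a solution, with admissible saturations
      ∃ p : T.State, T.ppScheme D dt p pn = 0 ∧ T.MaxPrinciple D p) ∧
    -- all the time steps
    ∀ (N : ℕ) (t : ℕ → ℝ), (∀ n < N, t n < t (n + 1)) →
      ∀ p₀ : T.State, T.MaxPrinciple D p₀ →
        ∃ p : ℕ → T.State, p 0 = p₀ ∧ ∀ n < N,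
          T.ppScheme D (t (n + 1) - t n) (p (n + 1)) (p n) = 0 ∧ T.MaxPrinciple D (p (n + 1)) := by
  have step : ∀ dt : ℝ, 0 < dt → ∀ pn : T.State, T.MaxPrinciple D pn →
      ∃ p : T.State, T.ppScheme D dt p pn = 0 ∧ T.MaxPrinciple D p :=
    fun dt hdt pn hpn => T.exists_ppScheme_eq_zero D hdt hpn
  refine ⟨fun dt hdt pn hpn => ?_, fun N t ht p₀ hp₀ => ?_⟩
  · obtain ⟨C, -, hC⟩ := T.exists_energy_estimate D hdt hpn
    refine ⟨(T.continuous_regScheme D dt pn).continuousOn,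
      fun p => T.regScheme_zero_zero D dt p pn,
      fun η hη p hp => T.maxPrinciple_of_regScheme_eq_zero D hdt hη hpn hp,
      fun η hη => ⟨C, fun ε hε p hp => hC ε η hε.le hη.le p hp⟩,
      ⟨C, fun η hη p hp => ?_⟩,
      fun ε η hε hη => T.exists_regScheme_eq_zero D hdt hε hη.le hpn, step dt hdt pn hpn⟩
    have h1 := hC 0 η le_rfl hη.le p hp
    have h2 : 0 ≤ η * ∑ α, T.normTau D (T.pressure p α - T.pressure p (1 - α)) ^ 2 :=
      mul_nonneg hη.le (Finset.sum_nonneg fun α _ => sq_nonneg _)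
    linarith
  · classical
    choose next hnext using step
    -- A step is available only from admissible states and for positive time steps; the state is
    -- kept otherwise, which never happens before time N.
    let p : ℕ → T.State := fun n => Nat.rec p₀ (fun n q =>
      if h : 0 < t (n + 1) - t n ∧ T.MaxPrinciple D q then next _ h.1 q h.2 else q) n
    have hsucc : ∀ n (h : 0 < t (n + 1) - t n ∧ T.MaxPrinciple D (p n)),
        p (n + 1) = next _ h.1 (p n) h.2 := fun n h => dif_pos h
    have hmax : ∀ n ≤ N, T.MaxPrinciple D (p n) := by
      intro n
      induction n with
      | zero => exact fun _ => hp₀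
      | succ n ih =>
        intro hn
        rw [hsucc n ⟨sub_pos.2 (ht n hn), ih (by omega)⟩]
        exact (hnext _ _ _ _).2
    refine ⟨p, rfl, fun n hn => ⟨?_, hmax _ hn⟩⟩
    rw [hsucc n ⟨sub_pos.2 (ht n hn), hmax n hn.le⟩]
    exact (hnext _ _ _ _).1
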